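/- Let $N,k\ge 1$ be integers and $p\in(0,\infty)$. Let $X$ be a rearrangement-invariant Banach function space on $\mathbb{R}^N$ with Lebesgue measure (in the sense of Bennett--Sharpley) with absolutely continuous norm, and suppose that $X$ satisfies the Minkowski-type inequality $$\big\|\,\|F(x,h)\|_{L^p_x}\big\|_{X_h}\le C_0\,\big\|\,\|F(x,h)\|_{X_h}\big\|_{L^p_x}$$ for all measurable $F$ on $\mathbb{R}^{2N}$, with a constant $C_0<\infty$ independent of $F$. Let $\{\rho_\varepsilon\}_{\varepsilon>0}$ be non-negative measurable functions on $(0,\infty)$ such that $\int_0^\infty\rho_\varepsilon(t)\,dt=1$ for every $\varepsilon>0$ and $\lim_{\varepsilon\to0^+}\int_0^a\rho_\varepsilon(t)\,dt=1$ for every $a\in(0,1)$. Let $\dot W^kX$ be the set of all (real) distributions $f$ on $\mathbb{R}^N$ such that $\partial^\alpha f\in X$ for every multi-index $\alpha\in\mathbb{Z}_+^N$ with $|\alpha|=k$. For a function $f$ put $\Delta_h^kf(x)=\sum_{j=0}^k(-1)^{j+k}\binom kj f(x+jh)$, and let $|\nabla^kf(x)|$ be the Euclidean length of the vector $(\partial^\alpha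 f(x))_{|\alpha|=k}$. Then every $f\in\dot W^kX$ is (given by) a locally integrable function, and $$\lim_{\varepsilon\to0^+}\int_0^\infty\frac1{t^{\frac Nk+p}}\left\|\left[\int_{|h|\le t^{1/k}}|\Delta_h^kf(\cdot)|^p\,dh\right]^{\frac1p}\right\|_X^p\rho_\varepsilon(t)\,dt=\frac1{kp+N}\left\|\left[\int_{\mathbb{S}^{N-1}}\Big|\sum_{|\alpha|=k}\frac{k!}{\alpha!}\,\omega^\alpha\partial^\alpha f(\cdot)\Big|^p\,d\sigma^{N-1}(\omega)\right]^{\frac1p}\right\|_X^p ,$$ where $\sigma^{N-1}$ is the surface measure on the unit sphere $\mathbb{S}^{N-1}$ (the counting measure on $\{-1,1\}$ if $N=1$). The limit is finite, and there are constants $0<c\le C<\infty$ depending only on $N,k,p$ such that it lies between $c\,\|\nabla^kf\|_X^p$ and $C\,\|\nabla^kf\|_X^p$, where $\|\nabla^kf\|_X:=\|\,|\nabla^kf|\,\|_X$. -/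

import Mathlib

open MeasureTheory Filter Topology Set
open scoped ENNReal NNReal Distributions LineDeriv

noncomputable section

/-- The Euclidean space `ℝ^N`. -/
abbrev RN (N : ℕ) : Type := EuclideanSpace ℝ (Fin N)

/-- A Banach function norm on `ℝ^N` with Lebesgue measure, in the sense of Luxemburg (and of
Bennett and Sharpley): a functional on the Lebesgue measurable functions `ℝ^N → [0,∞]` with the
properties (P1)-(P5). Its values at non-measurable functions are irrelevant. -/
structure BanachFunctionNorm (N : ℕ) where
  toFun : (RN N → ℝ≥0∞) → ℝ≥0∞
  eq_zero_iff : ∀ f, AEMeasurable f volume → (toFun f = 0 ↔ f =ᵐ[volume] 0)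
  const_mul : ∀ (a : ℝ≥0) (f), AEMeasurable f volume →
    toFun (fun x => (a : ℝ≥0∞) * f x) = (a : ℝ≥0∞) * toFun f
  add_le : ∀ f g, AEMeasurable f volume → AEMeasurable g volume →
    toFun (fun x => f x + g x) ≤ toFun f + toFun g
  mono : ∀ f g, AEMeasurable f volume → AEMeasurable g volume → f ≤ᵐ[volume] g →
    toFun f ≤ toFun g
  fatou : ∀ (f : ℕ → RN N → ℝ≥0∞) (g : RN N → ℝ≥0∞), (∀ n, AEMeasurable (f n) volume) →
    AEMeasurable g volume → (∀ᵐ x ∂volume, Monotone (fun n => f n x)) →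
    (∀ᵐ x ∂volume, Tendsto (fun n => f n x) atTop (𝓝 (g x))) →
    Tendsto (fun n => toFun (f n)) atTop (𝓝 (toFun g))
  indicator_lt_top : ∀ s : Set (RN N), MeasurableSet s → volume s < ∞ →
    toFun (s.indicator fun _ => 1) < ∞
  setLIntegral_le : ∀ s : Set (RN N), MeasurableSet s → volume s < ∞ →
    ∃ C : ℝ≥0, ∀ f, AEMeasurable f volume → ∫⁻ x in s, f x ∂volume ≤ (C : ℝ≥0∞) * toFun f

namespace BanachFunctionNorm

variable {N : ℕ}

/-- A real function `f` belongs to the Banach function space `X`: it is Lebesgue measurable and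
`‖f‖_X = ‖|f|‖_X < ∞`. -/
def Mem (X : BanachFunctionNorm N) (f : RN N → ℝ) : Prop :=
  AEMeasurable f volume ∧ X.toFun (fun x => ‖f x‖ₑ) < ∞

/-- Rearrangement invariance: equimeasurable a.e. finite functions have the same norm. -/
def IsRearrangementInvariant (X : BanachFunctionNorm N) : Prop :=
  ∀ f g : RN N → ℝ≥0∞, AEMeasurable f volume → AEMeasurable g volume →
    (∀ᵐ x ∂volume, f x < ∞) → (∀ᵐ x ∂volume, g x < ∞) →
    (∀ s : ℝ≥0, volume {x | (s : ℝ≥0∞) < f x} = volume {x | (s : ℝ≥0∞) < g x}) →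
    X.toFun f = X.toFun g

/-- `X` has absolutely continuous norm: `‖f 1_{A_n}‖_X → 0` whenever `f ∈ X` and
`1_{A_n} → 0` almost everywhere. -/
def HasAbsolutelyContinuousNorm (X : BanachFunctionNorm N) : Prop :=
  ∀ f : RN N → ℝ, X.Mem f → ∀ A : ℕ → Set (RN N), (∀ n, MeasurableSet (A n)) →
    (∀ᵐ x ∂volume, ∀ᶠ n in atTop, x ∉ A n) →
    Tendsto (fun n => X.toFun ((A n).indicator fun x => ‖f x‖ₑ)) atTop (𝓝 0)

/-- Minkowski's integral inequality between `X` and `L^p`: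
`‖ ‖F(x,h)‖_{L^p_x} ‖_{X_h} ≤ C ‖ ‖F(x,h)‖_{X_h} ‖_{L^p_x}` for all measurable `F` on `ℝ^{2N}`. -/
def SatisfiesMinkowski (X : BanachFunctionNorm N) (p : ℝ) : Prop :=
  ∃ C : ℝ≥0, ∀ F : RN N × RN N → ℝ, AEMeasurable F (volume.prod volume) →
    X.toFun (fun h => (∫⁻ x, ‖F (x, h)‖ₑ ^ p ∂volume) ^ (1 / p)) ≤
      (C : ℝ≥0∞) * (∫⁻ x, X.toFun (fun h => ‖F (x, h)‖ₑ) ^ p ∂volume) ^ (1 / p)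

end BanachFunctionNorm

/-- The multi-indices `α ∈ ℤ_+^N` with `|α| = k`. -/
def multiIndices (N k : ℕ) : Finset (Fin N → ℕ) := Finset.piAntidiag Finset.univ k

/-- The derivative `∂^α T = ∂_1^{α_1} ⋯ ∂_N^{α_N} T` of a distribution on `ℝ^N`. -/
def distDeriv {N : ℕ} (α : Fin N → ℕ) (T : 𝓓'((⊤ : TopologicalSpace.Opens (RN N)), ℝ)) :
    𝓓'((⊤ : TopologicalSpace.Opens (RN N)), ℝ) :=
  (List.finRange N).foldr (fun i S => (fun U => ∂_{(EuclideanSpace.single i (1 : ℝ) : RN N)} U)^[α i] S) T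

/-- The distribution `T` is (given by) the locally integrable function `f`. -/
def IsGivenBy {N : ℕ} (T : 𝓓'((⊤ : TopologicalSpace.Opens (RN N)), ℝ)) (f : RN N → ℝ) : Prop :=
  LocallyIntegrable f volume ∧
    ∀ φ : 𝓓((⊤ : TopologicalSpace.Opens (RN N)), ℝ), T φ = ∫ x, f x * φ x ∂volume

/-- The homogeneous Sobolev-type space `Ẇ^k X`: the distributions on `ℝ^N` all of whose partial
derivatives of order `k` are functions in `X`. -/
def MemHomSobolev {N : ℕ} (X : BanachFunctionNorm N) (k : ℕ)
    (T : 𝓓'((⊤ : TopologicalSpace.Opens (RN N)), ℝ)) : Prop :=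
  ∀ α ∈ multiIndices N k, ∃ g : RN N → ℝ, X.Mem g ∧ IsGivenBy (distDeriv α T) g

/-- The `k`-th order difference `Δ_h^k f (x) = ∑_{j=0}^k (-1)^{j+k} (k choose j) f (x + j h)`. -/
def kthDiff {N : ℕ} (k : ℕ) (h : RN N) (f : RN N → ℝ) (x : RN N) : ℝ :=
  ∑ j ∈ Finset.range (k + 1), (-1 : ℝ) ^ (j + k) * (k.choose j : ℝ) * f (x + (j : ℝ) • h)

/-- `(∫_{|h| ≤ r} |Δ_h^k f (x)|^p dh)^{1/p}`. -/
def ballDiff {N : ℕ} (k : ℕ) (p r : ℝ) (f : RN N → ℝ) (x : RN N) : ℝ≥0∞ :=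
  (∫⁻ h in Metric.closedBall (0 : RN N) r, ‖kthDiff k h f x‖ₑ ^ p ∂volume) ^ (1 / p)

/-- The `k`-th directional derivative `∑_{|α| = k} (k! / α!) ω^α g_α (x)`, where `g_α = ∂^α f`. -/
def dirDeriv {N : ℕ} (k : ℕ) (g : (Fin N → ℕ) → RN N → ℝ) (ω x : RN N) : ℝ :=
  ∑ α ∈ multiIndices N k, (Nat.multinomial Finset.univ α : ℝ) * (∏ i, ω i ^ α i) * g α x

/-- `(∫_{S^{N-1}} |∑_{|α| = k} (k! / α!) ω^α g_α (x)|^p dσ(ω))^{1/p}`, where `σ` is the surface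
measure of the unit sphere (the counting measure of `{-1, 1}` if `N = 1`). -/
def sphereDeriv {N : ℕ} (k : ℕ) (p : ℝ) (g : (Fin N → ℕ) → RN N → ℝ) (x : RN N) : ℝ≥0∞ :=
  (∫⁻ ω : Metric.sphere (0 : RN N) 1, ‖dirDeriv k g (ω : RN N) x‖ₑ ^ p
    ∂((volume : Measure (RN N)).toSphere)) ^ (1 / p)

/-- The Euclidean length `(∑_{|α| = k} |g_α (x)|^2)^{1/2}` of the vector of all `k`-th order
derivatives. -/
def gradLength {N : ℕ} (k : ℕ) (g : (Fin N → ℕ) → RN N → ℝ) (x : RN N) : ℝ≥0∞ :=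
  ENNReal.ofReal (Real.sqrt (∑ α ∈ multiIndices N k, g α x ^ 2))

/-- A family `(ρ_ε)_{ε > 0}` of non-negative functions on `(0,∞)` with `∫_0^∞ ρ_ε = 1` for all
`ε > 0`, and `∫_0^a ρ_ε → 1` as `ε → 0+` for every `a ∈ (0,1)`. -/
structure IsConcentrating (ρ : ℝ → ℝ → ℝ) : Prop where
  aemeasurable : ∀ ε, 0 < ε → AEMeasurable (ρ ε) (volume.restrict (Ioi 0))
  nonneg : ∀ ε, 0 < ε → ∀ t, 0 < t → 0 ≤ ρ ε t
  lintegral_eq_one : ∀ ε, 0 < ε → ∫⁻ t in Ioi (0 : ℝ), ENNReal.ofReal (ρ ε t) = 1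
  tendsto : ∀ a, 0 < a → a < 1 →
    Tendsto (fun ε => ∫⁻ t in Ioo (0 : ℝ) a, ENNReal.ofReal (ρ ε t)) (𝓝[>] 0) (𝓝 1)

/-- `∫_0^∞ t^{-N/k-p} ‖(∫_{|h| ≤ t^{1/k}} |Δ_h^k f|^p dh)^{1/p}‖_X^p w(t) dt`. -/
def diffFunctional {N : ℕ} (X : BanachFunctionNorm N) (k : ℕ) (p : ℝ) (w : ℝ → ℝ)
    (f : RN N → ℝ) : ℝ≥0∞ :=
  ∫⁻ t in Ioi (0 : ℝ), ENNReal.ofReal (t ^ (-((N : ℝ) / (k : ℝ)) - p)) *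
    X.toFun (ballDiff k p (t ^ (1 / (k : ℝ))) f) ^ p * ENNReal.ofReal (w t)

end

/-!
Write `ν` for the law of the sum of `k` independent variables uniform on `(0, 1]`, and `∂_u^k` for
the form `∑ (k! / α!) u^α ∂^α` of order `k`. The proof rests on the formula `Δ_h^k f (x) = ∫ (∂_h^k
f) (x + σ h) dν(σ)`, valid for every `h` and almost every `x` (`kthDiff_ae_eq_integral`). It is
first proved for distributions, by pairing with translated test functions
(`Distribution.sum_translate_eq_integral`). Integrating the distributional version against a smooth
weight `η(h)` with `∫ η = 1` also shows that a distribution in the homogeneous Sobolev space is a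
function: the term `j = 0` of the difference gives `± T`, the terms `j ≥ 1` and the right-hand side
are represented by functions (`exists_isGivenBy`). This needs that distributions commute with
averages of translates of test functions (`Distribution.exists_average`).

With `r = t^{1/k}` and `h = r u`, the factor `t^{-N/k-p}` cancels the Jacobian and the homogeneity
of `∂_h^k`, so the integrand of the functional becomes `‖A_r‖_X^p`, where `A_r(x) = (∫_{|u| ≤ 1} |∫
(∂_u^k f) (x + σ r u) dν(σ)|^p du)^{1/p}` (`ballDiff_ae_eq`). Two facts about `X` are used.
Minkowski's integral inequality `‖∫ F(·, s) ds‖_X ≤ ∫ ‖F(·, s)‖_X ds`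
(`BanachFunctionNorm.lintegral_le`) follows from the Fatou property through Lorentz–Luxemburg
duality (`BanachFunctionNorm.exists_weight`); together with translation invariance and the assumed
Minkowski-type inequality it bounds `‖A_r‖_X` uniformly in `r`. Translations are strongly
continuous on `X`, because the norm is rearrangement invariant and absolutely continuous
(`BanachFunctionNorm.tendsto_translate`); this makes the inner averages converge in `X`, uniformly
in `|u| ≤ 1`, so that `‖A_r‖_X → ‖A_0‖_X` as `r → 0+` (`BanachFunctionNorm.tendsto_toFun_ballAvg`).
For `p < 1` the triangle inequality of `L^p` is replaced by one with a constant close to `1` in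
front of the main term (`exists_lintegral_rpow_le`).

The measures `ρ_ε(t) dt` then select the limit at `t = 0+` (`IsConcentrating.tendsto_lintegral`).
Polar coordinates turn the ball in `A_0` into the sphere and produce the factor `1 / (k p + N)`
(`lintegral_closedBall_dirDeriv`), and compactness of the unit sphere in the space of coefficients
gives the comparison with `|∇^k f|` (`exists_sphereDeriv_equiv_gradLength`).
-/

/-! ### Duality and Minkowski's integral inequality in Banach function spaces -/

noncomputable section

namespace BanachFunctionNorm

variable {N : ℕ} (X : BanachFunctionNorm N)

theorem congr_ae {f g : RN N → ℝ≥0∞} (hf : AEMeasurable f volume) (h : f =ᵐ[volume] g) :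
    X.toFun f = X.toFun g :=
  le_antisymm (X.mono f g hf (hf.congr h) h.le) (X.mono g f (hf.congr h) hf h.symm.le)

theorem toFun_zero : X.toFun (fun _ => 0) = 0 :=
  (X.eq_zero_iff _ aemeasurable_const).2 (ae_of_all _ fun _ => rfl)

/-- The Fatou property in its closedness form: balls of `X` are closed under a.e. convergence. -/
theorem le_of_tendsto_ae {h : ℕ → RN N → ℝ≥0∞} {g : RN N → ℝ≥0∞} {M : ℝ≥0∞}
    (hh : ∀ n, AEMeasurable (h n) volume) (hM : ∀ n, X.toFun (h n) ≤ M)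
    (ht : ∀ᵐ x ∂volume, Tendsto (fun n => h n x) atTop (𝓝 (g x))) : X.toFun g ≤ M := by
  have hm : ∀ n, AEMeasurable (fun x => ⨅ i, h (i + n) x) volume := fun n =>
    AEMeasurable.iInf fun i => hh _
  have hmono : ∀ x, Monotone fun n => ⨅ i, h (i + n) x := by
    intro x m n hmn
    refine le_iInf fun i => ?_
    have : i + n = (i + (n - m)) + m := by omega
    rw [this]
    exact iInf_le (fun i => h (i + m) x) _
  have hlim : ∀ᵐ x ∂volume, Tendsto (fun n => ⨅ i, h (i + n) x) atTop (𝓝 (g x)) := by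
    filter_upwards [ht] with x hx
    have := tendsto_atTop_iSup (hmono x)
    have e : liminf (fun n => h n x) atTop = ⨆ n, ⨅ i, h (i + n) x :=
      liminf_eq_iSup_iInf_of_nat'
    rwa [← e, hx.liminf_eq] at this
  have hg : AEMeasurable g volume := aemeasurable_of_tendsto_metrizable_ae atTop hh ht
  refine le_of_tendsto' (X.fatou _ g hm hg (ae_of_all _ hmono) hlim) fun n => ?_
  refine (X.mono _ (h (0 + n)) (hm n) (hh _) (ae_of_all _ fun x => ?_)).trans (hM _)
  exact iInf_le (fun i => h (i + n) x) 0

/-- Truncation in height to `n` and in space to the ball of radius `n`. -/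
def trunc (f : RN N → ℝ≥0∞) (n : ℕ) : RN N → ℝ≥0∞ :=
  (Metric.ball (0 : RN N) n).indicator fun x => min (f x) n

theorem aemeasurable_trunc {f : RN N → ℝ≥0∞} (hf : AEMeasurable f volume) (n : ℕ) :
    AEMeasurable (trunc f n) volume :=
  (hf.min aemeasurable_const).indicator measurableSet_ball

theorem trunc_le (f : RN N → ℝ≥0∞) (n : ℕ) (x : RN N) : trunc f n x ≤ f x :=
  (indicator_le_self' (fun _ _ => zero_le) x).trans (min_le_left _ _)

theorem trunc_le_nat (f : RN N → ℝ≥0∞) (n : ℕ) (x : RN N) : trunc f n x ≤ n :=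
  (indicator_le_self' (fun _ _ => zero_le) x).trans (min_le_right _ _)

theorem monotone_trunc (f : RN N → ℝ≥0∞) (x : RN N) : Monotone fun n => trunc f n x := by
  intro m n hmn
  have hmn' : (m : ℝ≥0∞) ≤ n := by exact_mod_cast hmn
  simp only [trunc]
  by_cases hx : x ∈ Metric.ball (0 : RN N) m
  · have hx' : x ∈ Metric.ball (0 : RN N) n :=
      Metric.ball_subset_ball (by exact_mod_cast hmn) hx
    rw [indicator_of_mem hx, indicator_of_mem hx']
    exact min_le_min le_rfl hmn'
  · rw [indicator_of_notMem hx]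
    exact zero_le

theorem tendsto_trunc (f : RN N → ℝ≥0∞) (x : RN N) :
    Tendsto (fun n => trunc f n x) atTop (𝓝 (f x)) := by
  have h1 : Tendsto (fun n : ℕ => min (f x) n) atTop (𝓝 (min (f x) ∞)) :=
    tendsto_const_nhds.min ENNReal.tendsto_nat_nhds_top
  rw [min_eq_left le_top] at h1
  refine h1.congr' ?_
  obtain ⟨m, hm⟩ := exists_nat_gt ‖x‖
  filter_upwards [eventually_ge_atTop m] with n hn
  have hx : x ∈ Metric.ball (0 : RN N) n := by
    rw [mem_ball_zero_iff]
    exact hm.trans_le (by exact_mod_cast hn)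
  rw [trunc, indicator_of_mem hx]

theorem memLp_trunc {f : RN N → ℝ≥0∞} (hf : AEMeasurable f volume) (n : ℕ) :
    MemLp (fun x => (trunc f n x).toReal) 2 volume := by
  have hb : MemLp ((Metric.ball (0 : RN N) n).indicator fun _ => (n : ℝ)) 2 volume :=
    memLp_indicator_const 2 measurableSet_ball _ (Or.inr measure_ball_lt_top.ne)
  refine hb.mono (aemeasurable_trunc hf n).ennreal_toReal.aestronglyMeasurable
    (ae_of_all _ fun x => ?_)
  by_cases hx : x ∈ Metric.ball (0 : RN N) n
  · rw [indicator_of_mem hx, Real.norm_of_nonneg ENNReal.toReal_nonneg,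
      Real.norm_of_nonneg (Nat.cast_nonneg _)]
    exact ENNReal.toReal_le_of_le_ofReal (Nat.cast_nonneg _) (by simpa using trunc_le_nat f n x)
  · simp [trunc, indicator_of_notMem hx]

/-- The Lorentz–Luxemburg theorem, in the form in which it is used here: every number below `‖f‖_X`
is beaten by pairing `f` with a weight of associate norm at most one. The weight comes from
separating a truncation of `f` from the closed convex set `{‖h‖_X ≤ r}` of `L²`. -/
theorem exists_weight {f : RN N → ℝ≥0∞} (hf : AEMeasurable f volume) {r : ℝ≥0}
    (hr : (r : ℝ≥0∞) < X.toFun f) :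
    ∃ w : RN N → ℝ≥0∞, Measurable w ∧ (r : ℝ≥0∞) < ∫⁻ x, f x * w x ∂volume ∧
      ∀ h : RN N → ℝ≥0∞, AEMeasurable h volume → ∫⁻ x, h x * w x ∂volume ≤ X.toFun h := by
  wlog hr0 : 0 < r generalizing r
  · obtain ⟨s, hs, hs'⟩ := ENNReal.lt_iff_exists_nnreal_btwn.1 hr
    obtain ⟨w, hw, h1, h2⟩ := this hs' (lt_of_le_of_lt (zero_le) (by exact_mod_cast hs))
    exact ⟨w, hw, hs.trans h1, h2⟩
  have hr0' : (r : ℝ≥0∞) ≠ 0 := by exact_mod_cast hr0.ne'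
  -- By the Fatou property some truncation of `f`, which lies in `L²`, already has norm above `r`.
  obtain ⟨n, hn⟩ : ∃ n, (r : ℝ≥0∞) < X.toFun (trunc f n) :=
    ((X.fatou _ f (aemeasurable_trunc hf) hf (ae_of_all _ (monotone_trunc f))
      (ae_of_all _ (tendsto_trunc f))).eventually_const_lt hr).exists
  set C : Set (Lp ℝ 2 (volume : Measure (RN N))) := {h | X.toFun (fun x => ‖h x‖ₑ) ≤ r} with hC
  have hme : ∀ h : Lp ℝ 2 (volume : Measure (RN N)), AEMeasurable (fun x => ‖h x‖ₑ) volume :=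
    fun h => (Lp.aestronglyMeasurable h).enorm
  have hconv : Convex ℝ C := by
    intro a ha b hb s t hs ht hst
    have e : ∀ᵐ x ∂(volume : Measure (RN N)), ‖(s • a + t • b : Lp ℝ 2 volume) x‖ₑ ≤
        (s.toNNReal : ℝ≥0∞) * ‖a x‖ₑ + (t.toNNReal : ℝ≥0∞) * ‖b x‖ₑ := by
      filter_upwards [Lp.coeFn_add (s • a) (t • b), Lp.coeFn_smul s a, Lp.coeFn_smul t b]
        with x h1 h2 h3
      rw [h1, Pi.add_apply, h2, h3]
      refine (enorm_add_le _ _).trans_eq ?_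
      simp only [Pi.smul_apply, enorm_smul, Real.enorm_of_nonneg hs, Real.enorm_of_nonneg ht]
      rfl
    calc X.toFun (fun x => ‖(s • a + t • b : Lp ℝ 2 volume) x‖ₑ)
        ≤ X.toFun (fun x => (s.toNNReal : ℝ≥0∞) * ‖a x‖ₑ + (t.toNNReal : ℝ≥0∞) * ‖b x‖ₑ) :=
          X.mono _ _ (hme _) (((hme a).const_mul _).add ((hme b).const_mul _)) e
      _ ≤ (s.toNNReal : ℝ≥0∞) * r + (t.toNNReal : ℝ≥0∞) * r := by
          refine (X.add_le _ _ ((hme a).const_mul _) ((hme b).const_mul _)).trans ?_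
          rw [X.const_mul _ _ (hme a), X.const_mul _ _ (hme b)]
          exact add_le_add (mul_le_mul_right ha _) (mul_le_mul_right hb _)
      _ = r := by
          rw [← add_mul]
          have : (s.toNNReal : ℝ≥0∞) + t.toNNReal = 1 := by
            rw [← ENNReal.coe_add, ← Real.toNNReal_add hs ht, hst]; simp
          rw [this, one_mul]
  have hclosed : IsClosed C := by
    refine IsSeqClosed.isClosed fun a b ha hab => ?_
    obtain ⟨ns, -, hns⟩ := (tendstoInMeasure_of_tendsto_Lp hab).exists_seq_tendsto_ae
    refine X.le_of_tendsto_ae (h := fun i x => ‖a (ns i) x‖ₑ) (fun i => hme _)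
      (fun i => ha _) ?_
    filter_upwards [hns] with x hx using hx.enorm
  set fn : Lp ℝ 2 (volume : Measure (RN N)) := (memLp_trunc hf n).toLp _ with hfn
  have hfn_ae : ∀ᵐ x ∂(volume : Measure (RN N)), fn x = (trunc f n x).toReal :=
    MemLp.coeFn_toLp _
  have htop : ∀ g : RN N → ℝ≥0∞, ∀ m x, trunc g m x ≠ ∞ := fun g m x =>
    ne_top_of_le_ne_top (ENNReal.natCast_ne_top m) (trunc_le_nat g m x)
  have hnot : fn ∉ C := by
    intro h
    refine absurd hn (not_lt.2 ?_)
    refine le_trans (le_of_eq (X.congr_ae (aemeasurable_trunc hf n) ?_)) h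
    filter_upwards [hfn_ae] with x hx
    rw [hx, Real.enorm_of_nonneg ENNReal.toReal_nonneg, ENNReal.ofReal_toReal (htop _ _ _)]
  -- Hahn–Banach separates the truncation from `C`, and the separating functional is the inner
  -- product with some `v`.
  obtain ⟨ℓ, u, hu, hufn⟩ := geometric_hahn_banach_closed_point hconv hclosed hnot
  set v : Lp ℝ 2 (volume : Measure (RN N)) := (InnerProductSpace.toDual ℝ _).symm ℓ with hv
  have hℓ : ∀ h, ℓ h = ∫ x, v x * h x ∂volume := by
    intro h
    rw [← InnerProductSpace.toDual_symm_apply, L2.inner_def]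
    refine integral_congr_ae (ae_of_all _ fun x => ?_)
    simp [mul_comm, hv]
  have hint : ∀ a b : Lp ℝ 2 (volume : Measure (RN N)), Integrable (fun x => a x * b x) volume :=
    fun a b => (Lp.memLp a).integrable_mul (Lp.memLp b)
  have hu0 : 0 < u := by
    have h0 : (0 : Lp ℝ 2 (volume : Measure (RN N))) ∈ C := by
      have : X.toFun (fun x => ‖(0 : Lp ℝ 2 (volume : Measure (RN N))) x‖ₑ) = 0 := by
        rw [X.eq_zero_iff _ (hme _)]
        filter_upwards [Lp.coeFn_zero ℝ 2 (volume : Measure (RN N))] with x hx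
        rw [hx]; simp
      exact this.trans_le zero_le
    simpa using hu 0 h0
  have hvm' : Measurable v := (Lp.stronglyMeasurable v).measurable
  -- The function `sign(v) h` belongs to `C` along with `h`, so that the separation bounds the
  -- pairing with `|v|`.
  have hkey : ∀ h : RN N → ℝ≥0∞, AEMeasurable h volume → ∀ m, X.toFun (trunc h m) ≤ r →
      ∫⁻ x, trunc h m x * ‖v x‖ₑ ∂volume ≤ ENNReal.ofReal u := by
    intro h hh m hm
    have hsm : MemLp (fun x => SignType.sign (v x) * (trunc h m x).toReal) 2
        (volume : Measure (RN N)) := by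
      refine (memLp_trunc hh m).mono ?_ (ae_of_all _ fun x => ?_)
      · refine AEStronglyMeasurable.mul ?_ (memLp_trunc hh m).1
        have : Measurable fun x => ((SignType.sign (v x) : SignType) : ℝ) := by
          have hs : Measurable fun t : ℝ => ((SignType.sign t : SignType) : ℝ) := by
            have : (fun t : ℝ => ((SignType.sign t : SignType) : ℝ)) =
                fun t => if 0 < t then 1 else if t < 0 then -1 else 0 := by
              funext t
              rw [sign_apply]
              split_ifs <;> simp
            rw [this]
            exact Measurable.ite measurableSet_Ioi measurable_const
              (Measurable.ite measurableSet_Iio measurable_const measurable_const)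
          exact hs.comp hvm'
        exact this.aestronglyMeasurable
      · rw [norm_mul]
        refine mul_le_of_le_one_left (norm_nonneg _) ?_
        rcases SignType.trichotomy (SignType.sign (v x)) with h | h | h <;> simp [h]
    set q := hsm.toLp _ with hq
    have hqae := hsm.coeFn_toLp
    have hqC : q ∈ C := by
      refine le_trans (X.mono _ _ (hme _) (aemeasurable_trunc hh m) ?_) hm
      filter_upwards [hqae] with x hx
      rw [hx, enorm_mul, Real.enorm_of_nonneg ENNReal.toReal_nonneg,
        ENNReal.ofReal_toReal (htop _ _ _)]
      refine mul_le_of_le_one_left zero_le ?_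
      rcases SignType.trichotomy (SignType.sign (v x)) with h | h | h <;> simp [h]
    have h1 := (hu q hqC).le
    rw [hℓ] at h1
    have h2 : ∀ᵐ x ∂(volume : Measure (RN N)), v x * q x = (trunc h m x).toReal * |v x| := by
      filter_upwards [hqae] with x hx
      rw [hx, ← sign_mul_self (v x)]
      ring
    rw [integral_congr_ae h2] at h1
    have h3 : Integrable (fun x => (trunc h m x).toReal * |v x|) volume :=
      (hint v q).congr h2
    refine le_trans (le_of_eq ?_) (ENNReal.ofReal_le_ofReal h1)
    rw [ofReal_integral_eq_lintegral_ofReal h3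
      (ae_of_all _ fun x => mul_nonneg ENNReal.toReal_nonneg (abs_nonneg _))]
    refine lintegral_congr fun x => ?_
    rw [ENNReal.ofReal_mul ENNReal.toReal_nonneg, ENNReal.ofReal_toReal (htop _ _ _),
      Real.enorm_eq_ofReal_abs]
  -- The weight is `|v|`, rescaled so that the separating constant becomes `r`.
  set c : ℝ≥0∞ := r / ENNReal.ofReal u with hc
  have hou : ENNReal.ofReal u ≠ 0 := by simpa using hu0
  have hc0 : c ≠ 0 := ENNReal.div_ne_zero.2 ⟨hr0', ENNReal.ofReal_ne_top⟩
  have hct : c ≠ ∞ := (ENNReal.div_lt_top ENNReal.coe_ne_top hou).ne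
  have hcu : ENNReal.ofReal u * c = r := by
    rw [hc, ENNReal.mul_div_cancel hou ENNReal.ofReal_ne_top]
  have hvm : Measurable fun x => ‖v x‖ₑ := hvm'.enorm
  refine ⟨fun x => ‖v x‖ₑ * c, hvm.mul_const _, ?_, ?_⟩
  · calc (r : ℝ≥0∞) = ENNReal.ofReal u * c := hcu.symm
      _ < (∫⁻ x, trunc f n x * ‖v x‖ₑ ∂volume) * c := by
          refine (ENNReal.mul_lt_mul_iff_left hc0 hct).2 ?_
          rw [hℓ] at hufn
          have hb : ∀ᵐ x ∂(volume : Measure (RN N)), v x * fn x ≤ (trunc f n x).toReal * |v x| := by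
            filter_upwards [hfn_ae] with x h1
            rw [h1, mul_comm]
            exact mul_le_mul_of_nonneg_left (le_abs_self _) ENNReal.toReal_nonneg
          have hi : Integrable (fun x => (trunc f n x).toReal * |v x|) volume := by
            refine (hint fn v).abs.congr ?_
            filter_upwards [hfn_ae] with x h1
            rw [h1, abs_mul, abs_of_nonneg ENNReal.toReal_nonneg]
          have h4 := hufn.trans_le (integral_mono_ae (hint v fn) hi hb)
          refine ((ENNReal.ofReal_lt_ofReal_iff (hu0.trans h4)).2 h4).trans_eq ?_
          rw [ofReal_integral_eq_lintegral_ofReal hi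
            (ae_of_all _ fun x => mul_nonneg ENNReal.toReal_nonneg (abs_nonneg _))]
          refine lintegral_congr fun x => ?_
          rw [ENNReal.ofReal_mul ENNReal.toReal_nonneg, ENNReal.ofReal_toReal (htop _ _ _),
            Real.enorm_eq_ofReal_abs]
      _ ≤ ∫⁻ x, f x * (‖v x‖ₑ * c) ∂volume := by
          rw [← lintegral_mul_const' _ _ hct]
          refine lintegral_mono fun x => ?_
          rw [mul_assoc]
          exact mul_le_mul_left (trunc_le _ _ _) _
  · intro h hh
    rcases eq_or_ne (X.toFun h) 0 with h0 | h0
    · have := (X.eq_zero_iff h hh).1 h0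
      rw [h0, lintegral_congr_ae (g := fun _ => 0) (by filter_upwards [this] with x hx; simp [hx])]
      simp
    rcases eq_or_ne (X.toFun h) ∞ with ht | ht
    · rw [ht]; exact le_top
    lift X.toFun h to ℝ≥0 using ht with y hy
    have hy0 : y ≠ 0 := by rintro rfl; exact h0 rfl
    -- Rescale `h` to have norm `r`, apply the bound to its truncations, and pass to the limit.
    set s : ℝ≥0 := r / y with hs
    have hs0 : s ≠ 0 := div_ne_zero hr0.ne' hy0
    have hsy : s * y = r := div_mul_cancel₀ _ hy0
    have hsh : AEMeasurable (fun x => (s : ℝ≥0∞) * h x) volume := hh.const_mul _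
    have hXs : X.toFun (fun x => (s : ℝ≥0∞) * h x) = r := by
      rw [X.const_mul _ _ hh, ← hy, ← ENNReal.coe_mul, hsy]
    have hlim : ∫⁻ x, (s : ℝ≥0∞) * h x * ‖v x‖ₑ ∂volume ≤ ENNReal.ofReal u := by
      refine le_of_tendsto' (lintegral_tendsto_of_tendsto_of_monotone
        (f := fun m x => trunc (fun x => (s : ℝ≥0∞) * h x) m x * ‖v x‖ₑ)
        (fun m => (aemeasurable_trunc hsh m).mul hvm.aemeasurable) (ae_of_all _ fun x => ?_)
        (ae_of_all _ fun x => ?_)) fun m => hkey _ hsh m ?_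
      · intro m m' hmm
        exact mul_le_mul_left (monotone_trunc _ x hmm) _
      · exact ENNReal.Tendsto.mul_const (tendsto_trunc _ x) (Or.inr enorm_ne_top)
      · rw [← hXs]
        exact X.mono _ _ (aemeasurable_trunc hsh m) hsh (ae_of_all _ (trunc_le _ _))
    have hs0' : (s : ℝ≥0∞) ≠ 0 := by exact_mod_cast hs0
    have e1 : (s : ℝ≥0∞) * ∫⁻ x, h x * (‖v x‖ₑ * c) ∂volume =
        (∫⁻ x, (s : ℝ≥0∞) * h x * ‖v x‖ₑ ∂volume) * c := by
      rw [← lintegral_mul_const' _ _ hct, ← lintegral_const_mul' _ _ ENNReal.coe_ne_top]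
      refine lintegral_congr fun x => by ring
    have e2 : (s : ℝ≥0∞) * ∫⁻ x, h x * (‖v x‖ₑ * c) ∂volume ≤ (s : ℝ≥0∞) * y := by
      rw [e1, ← ENNReal.coe_mul, hsy, ← hcu]
      exact mul_le_mul_left hlim _
    exact (ENNReal.mul_le_mul_iff_right hs0' ENNReal.coe_ne_top).1 e2

/-- Minkowski's integral inequality `‖∫ F(·,s) ds‖_X ≤ ∫ ‖F(·,s)‖_X ds` in a Banach function
space. No measurability of `s ↦ ‖F(·,s)‖_X` is needed, the lower integral on the right suffices. -/
theorem lintegral_le {A : Type*} [MeasurableSpace A] {ν : Measure A} [SFinite ν]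
    {F : RN N → A → ℝ≥0∞} (hF : AEMeasurable (Function.uncurry F) (volume.prod ν)) :
    X.toFun (fun x => ∫⁻ s, F x s ∂ν) ≤ ∫⁻ s, X.toFun (fun x => F x s) ∂ν := by
  refine le_of_forall_lt fun r hr => ?_
  lift r to ℝ≥0 using hr.ne_top
  have hm : AEMeasurable (fun x => ∫⁻ s, F x s ∂ν) volume := hF.lintegral_prod_right'
  obtain ⟨w, hw, h1, h2⟩ := X.exists_weight hm hr
  refine h1.trans_le ?_
  have hFw : AEMeasurable (Function.uncurry fun x s => F x s * w x) (volume.prod ν) :=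
    hF.mul (hw.comp measurable_fst).aemeasurable
  have hsec : ∀ᵐ x ∂volume, AEMeasurable (F x) ν := by
    obtain ⟨F', hF', hFF'⟩ := hF
    filter_upwards [Measure.ae_ae_of_ae_prod hFF'] with x hx
    exact ⟨fun s => F' (x, s), hF'.comp measurable_prodMk_left, hx⟩
  have hsec' : ∀ᵐ s ∂ν, AEMeasurable (fun x => F x s) volume := by
    obtain ⟨F', hF', hFF'⟩ := hF.comp_quasiMeasurePreserving
      (Measure.measurePreserving_swap (μ := ν) (ν := (volume : Measure (RN N)))).quasiMeasurePreserving
    filter_upwards [Measure.ae_ae_of_ae_prod hFF'] with s hs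
    exact ⟨fun x => F' (s, x), hF'.comp measurable_prodMk_left, hs⟩
  calc ∫⁻ x, (∫⁻ s, F x s ∂ν) * w x ∂volume = ∫⁻ x, ∫⁻ s, F x s * w x ∂ν ∂volume := by
        refine lintegral_congr_ae ?_
        filter_upwards [hsec] with x hx
        rw [lintegral_mul_const'' _ hx]
    _ = ∫⁻ s, ∫⁻ x, F x s * w x ∂volume ∂ν := lintegral_lintegral_swap hFw
    _ ≤ ∫⁻ s, X.toFun (fun x => F x s) ∂ν := by
        refine lintegral_mono_ae ?_
        filter_upwards [hsec'] with s hs using h2 _ hs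

end BanachFunctionNorm

end

/-! ### Continuity of translations -/

noncomputable section

namespace BanachFunctionNorm

variable {N : ℕ} {X : BanachFunctionNorm N}

theorem IsRearrangementInvariant.toFun_translate (hX : X.IsRearrangementInvariant) {g : RN N → ℝ}
    (hg : Measurable g) (z : RN N) :
    X.toFun (fun x => ‖g (x + z)‖ₑ) = X.toFun (fun x => ‖g x‖ₑ) := by
  refine hX _ _ (hg.comp (measurable_add_const z)).enorm.aemeasurable hg.enorm.aemeasurable
    (ae_of_all _ fun x => enorm_lt_top) (ae_of_all _ fun x => enorm_lt_top) fun s => ?_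
  exact measure_preimage_add_right volume z {x | (s : ℝ≥0∞) < ‖g x‖ₑ}

theorem toFun_indicator_const (X : BanachFunctionNorm N) {B : Set (RN N)} (hB : MeasurableSet B)
    (M : ℝ≥0) : X.toFun (B.indicator fun _ => (M : ℝ≥0∞)) =
      M * X.toFun (B.indicator fun _ => 1) := by
  rw [← X.const_mul _ _ (aemeasurable_const.indicator hB)]
  congr 1
  funext x
  by_cases hx : x ∈ B <;> simp [hx]

/-- Dominated convergence in `X` for sequences bounded by a multiple of the characteristic function
of a set of finite measure. -/
theorem HasAbsolutelyContinuousNorm.tendsto_zero_of_dominated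
    (hX : X.HasAbsolutelyContinuousNorm) {B : Set (RN N)} (hB : MeasurableSet B)
    (hBt : volume B < ∞) {M : ℝ≥0} {h : ℕ → RN N → ℝ} (hm : ∀ n, Measurable (h n))
    (hb : ∀ n x, ‖h n x‖ₑ ≤ B.indicator (fun _ => (M : ℝ≥0∞)) x)
    (hl : ∀ᵐ x ∂volume, Tendsto (fun n => h n x) atTop (𝓝 0)) :
    Tendsto (fun n => X.toFun fun x => ‖h n x‖ₑ) atTop (𝓝 0) := by
  have hXB := X.indicator_lt_top B hB hBt
  have heq : ∀ x, ‖B.indicator (fun _ => (M : ℝ)) x‖ₑ = B.indicator (fun _ => (M : ℝ≥0∞)) x := by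
    intro x
    by_cases hx : x ∈ B <;> simp [hx]
  have hmem : X.Mem (B.indicator fun _ => (M : ℝ)) := by
    refine ⟨(measurable_const.indicator hB).aemeasurable, ?_⟩
    simp only [heq]
    rw [X.toFun_indicator_const hB]
    exact ENNReal.mul_lt_top ENNReal.coe_lt_top hXB
  rw [ENNReal.tendsto_nhds_zero]
  intro ε hε
  obtain ⟨η, hη, hηε⟩ : ∃ η : ℝ≥0, 0 < η ∧ (η : ℝ≥0∞) * X.toFun (B.indicator fun _ => 1) ≤ ε / 2 := by
    have ht : Tendsto (fun η : ℝ≥0 => (η : ℝ≥0∞) * X.toFun (B.indicator fun _ => 1)) (𝓝[>] 0)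
        (𝓝 ((0 : ℝ≥0) * X.toFun (B.indicator fun _ => 1))) :=
      ENNReal.Tendsto.mul_const ((ENNReal.tendsto_coe.2 tendsto_id).mono_left nhdsWithin_le_nhds)
        (Or.inr hXB.ne)
    rw [ENNReal.coe_zero, zero_mul] at ht
    have := (ht.eventually (Iic_mem_nhds (ENNReal.half_pos hε.ne'))).and self_mem_nhdsWithin
    obtain ⟨η, h1, h2⟩ := this.exists
    exact ⟨η, h2, h1⟩
  -- Outside `A n` the function is at most `η` on `B`, and on `A n` absolute continuity of the norm
  -- applies to the dominating function.
  set A : ℕ → Set (RN N) := fun n => {x | (η : ℝ≥0∞) < ‖h n x‖ₑ} with hA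
  have hAm : ∀ n, MeasurableSet (A n) := fun n => measurableSet_lt measurable_const (hm n).enorm
  have hlim := hX _ hmem A hAm (by
    filter_upwards [hl] with x hx
    have h0 : Tendsto (fun n => ‖h n x‖ₑ) atTop (𝓝 0) := by simpa using hx.enorm
    filter_upwards [h0.eventually (Iic_mem_nhds (show (0 : ℝ≥0∞) < η by exact_mod_cast hη))]
      with n hn using not_lt.2 hn)
  rw [ENNReal.tendsto_nhds_zero] at hlim
  filter_upwards [hlim (ε / 2) (ENNReal.half_pos hε.ne')] with n hn
  have h1m : AEMeasurable (B.indicator fun _ => (η : ℝ≥0∞)) (volume : Measure (RN N)) :=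
    aemeasurable_const.indicator hB
  have h2m : AEMeasurable ((A n).indicator fun x => ‖B.indicator (fun _ => (M : ℝ)) x‖ₑ)
      (volume : Measure (RN N)) := hmem.1.enorm.indicator (hAm n)
  calc X.toFun (fun x => ‖h n x‖ₑ)
      ≤ X.toFun (fun x => B.indicator (fun _ => (η : ℝ≥0∞)) x +
        (A n).indicator (fun x => ‖B.indicator (fun _ => (M : ℝ)) x‖ₑ) x) := by
        refine X.mono _ _ (hm n).enorm.aemeasurable (h1m.add h2m) (ae_of_all _ fun x => ?_)
        by_cases hx : x ∈ A n
        · simp only [indicator_of_mem hx, heq]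
          exact (hb n x).trans le_add_self
        · simp only [indicator_of_notMem hx, add_zero]
          by_cases hxB : x ∈ B
          · rw [indicator_of_mem hxB]
            exact not_lt.1 hx
          · rw [indicator_of_notMem hxB]
            exact (hb n x).trans_eq (indicator_of_notMem hxB _)
    _ ≤ ε / 2 + ε / 2 := by
        refine (X.add_le _ _ h1m h2m).trans (add_le_add ?_ hn)
        rwa [X.toFun_indicator_const hB]
    _ = ε := ENNReal.add_halves ε

/-- Translations are continuous in `X` at bounded functions vanishing outside a bounded set. -/
theorem HasAbsolutelyContinuousNorm.tendsto_translate_of_bounded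
    (hX : X.HasAbsolutelyContinuousNorm) {g : RN N → ℝ} (hg : Measurable g) (n : ℕ)
    (hb : ∀ x, ‖g x‖ ≤ (Metric.ball (0 : RN N) n).indicator (fun _ => (n : ℝ)) x) :
    Tendsto (fun z : RN N => X.toFun fun x => ‖g (x + z) - g x‖ₑ) (𝓝 0) (𝓝 0) := by
  have hgL : MemLp g 1 volume :=
    (memLp_indicator_const 1 measurableSet_ball (n : ℝ) (Or.inr measure_ball_lt_top.ne)).mono
      hg.aestronglyMeasurable (ae_of_all _ fun x => (hb x).trans (Real.le_norm_self _))
  refine tendsto_of_seq_tendsto fun z hz => tendsto_of_subseq_tendsto fun ns hns => ?_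
  have hz' : Tendsto (fun i => z (ns i)) atTop (𝓝 0) := hz.comp hns
  have hmp : ∀ a : RN N, MeasurePreserving (fun x => x + a) volume volume :=
    fun a => measurePreserving_add_right volume a
  let τ : RN N → C(RN N, RN N) := fun a => ⟨fun x => x + a, by fun_prop⟩
  have hτ : Continuous τ := ContinuousMap.continuous_of_continuous_uncurry _ (by
    simp only [Function.uncurry_def, τ, ContinuousMap.coe_mk]; fun_prop)
  have hτ0 : Tendsto (fun i => τ (z (ns i))) atTop (𝓝 (τ 0)) := (hτ.tendsto 0).comp hz'
  -- Translates converge in `L¹`, hence almost everywhere along a subsequence.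
  have hLp : Tendsto (fun i => Lp.compMeasurePreserving (fun x => x + z (ns i)) (hmp _)
      (hgL.toLp g)) atTop (𝓝 (Lp.compMeasurePreserving (fun x => x + 0) (hmp 0) (hgL.toLp g))) :=
    Filter.Tendsto.compMeasurePreservingLp tendsto_const_nhds hτ0 (fun i => hmp (z (ns i)))
      (hmp 0) ENNReal.one_ne_top
  obtain ⟨ms, -, hms⟩ := (tendstoInMeasure_of_tendsto_Lp hLp).exists_seq_tendsto_ae
  refine ⟨ms, ?_⟩
  have hcoe : ∀ a : RN N, ∀ᵐ x ∂volume,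
      Lp.compMeasurePreserving (fun x => x + a) (hmp a) (hgL.toLp g) x = g (x + a) := by
    intro a
    filter_upwards [Lp.coeFn_compMeasurePreserving (hgL.toLp g) (hmp a),
      (hmp a).quasiMeasurePreserving.ae hgL.coeFn_toLp] with x h1 h2
    rw [h1, Function.comp_apply, h2]
  obtain ⟨R, hR⟩ := hz'.norm.bddAbove_range
  have hR' : ∀ i, ‖z (ns i)‖ ≤ R := fun i => hR (mem_range_self i)
  refine hX.tendsto_zero_of_dominated (B := Metric.ball (0 : RN N) (n + R)) (M := 2 * n)
    measurableSet_ball measure_ball_lt_top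
    (fun i => (hg.comp (measurable_add_const _)).sub hg) (fun i x => ?_) ?_
  · have hle : ∀ y, ‖g y‖ ≤ n := fun y =>
      (hb y).trans (indicator_le_self' (fun _ _ => Nat.cast_nonneg _) y)
    by_cases hx : x ∈ Metric.ball (0 : RN N) (n + R)
    · rw [indicator_of_mem hx]
      have : ‖g (x + z (ns (ms i))) - g x‖ ≤ 2 * n :=
        (norm_sub_le _ _).trans (by linarith [hle (x + z (ns (ms i))), hle x])
      rw [← ofReal_norm]
      refine ENNReal.ofReal_le_of_le_toReal ?_
      simpa using this
    · rw [indicator_of_notMem hx]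
      rw [mem_ball_zero_iff, not_lt] at hx
      have hv : ∀ y : RN N, (n : ℝ) ≤ ‖y‖ → g y = 0 := by
        intro y hy
        have := hb y
        rwa [indicator_of_notMem (by simpa using hy), norm_le_zero_iff] at this
      have hR0 : 0 ≤ R := (norm_nonneg _).trans (hR' 0)
      rw [hv x (by linarith), hv (x + z (ns (ms i)))]
      · simp
      · have := norm_sub_le (x + z (ns (ms i))) (z (ns (ms i)))
        rw [add_sub_cancel_right] at this
        linarith [hR' (ms i)]
  · have hall : ∀ᵐ x ∂(volume : Measure (RN N)), ∀ i,
        Lp.compMeasurePreserving (fun x => x + z (ns (ms i))) (hmp _) (hgL.toLp g) x =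
          g (x + z (ns (ms i))) := ae_all_iff.2 fun i => hcoe _
    filter_upwards [hms, hall, hcoe 0] with x h1 h2 h3
    rw [h3] at h1
    simp only [h2, add_zero] at h1
    simpa using h1.sub_const (g x)

/-- In a rearrangement-invariant space with absolutely continuous norm translations are strongly
continuous. -/
theorem tendsto_translate (hri : X.IsRearrangementInvariant)
    (hX : X.HasAbsolutelyContinuousNorm) {g : RN N → ℝ} (hg : Measurable g) (hmem : X.Mem g) :
    Tendsto (fun z : RN N => X.toFun fun x => ‖g (x + z) - g x‖ₑ) (𝓝 0) (𝓝 0) := by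
  set S : ℕ → Set (RN N) := fun n => Metric.ball 0 n ∩ {x | ‖g x‖ ≤ n} with hS
  have hSm : ∀ n, MeasurableSet (S n) := fun n =>
    measurableSet_ball.inter (measurableSet_le hg.norm measurable_const)
  have hlim := hX g hmem (fun n => (S n)ᶜ) (fun n => (hSm n).compl) (ae_of_all _ fun x => by
    obtain ⟨m, hm⟩ := exists_nat_gt (max ‖x‖ ‖g x‖)
    filter_upwards [eventually_ge_atTop m] with n hn
    have hn' : (m : ℝ) ≤ n := by exact_mod_cast hn
    simp only [hS, mem_compl_iff, not_not, mem_inter_iff, mem_ball_zero_iff]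
    exact ⟨((le_max_left _ _).trans_lt hm).trans_le hn',
      (((le_max_right _ _).trans_lt hm).trans_le hn').le⟩)
  rw [ENNReal.tendsto_nhds_zero] at hlim ⊢
  intro ε hε
  have hε3 : 0 < ε / 3 := ENNReal.div_pos hε.ne' (by norm_num)
  -- Split off the part of `g` where `|x|` or `|g|` is large. Its norm is small, and so are the norms
  -- of its translates.
  obtain ⟨n, hn⟩ := (hlim (ε / 3) hε3).exists
  set G : RN N → ℝ := (S n).indicator g with hG
  have hGm : Measurable G := hg.indicator (hSm n)
  have hGb : ∀ x, ‖G x‖ ≤ (Metric.ball (0 : RN N) n).indicator (fun _ => (n : ℝ)) x := by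
    intro x
    by_cases hx : x ∈ S n
    · rw [hG, indicator_of_mem hx, indicator_of_mem hx.1]
      exact hx.2
    · rw [hG, indicator_of_notMem hx, norm_zero]
      exact indicator_nonneg (fun _ _ => Nat.cast_nonneg _) x
  have hD : X.toFun (fun x => ‖(g - G) x‖ₑ) ≤ ε / 3 := by
    refine le_trans (le_of_eq ?_) hn
    congr 1
    funext x
    by_cases hx : x ∈ S n <;> simp [hG, hx]
  have h3 := ENNReal.tendsto_nhds_zero.1 (hX.tendsto_translate_of_bounded hGm n hGb) (ε / 3) hε3
  filter_upwards [h3] with z hz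
  have hDm : Measurable (g - G) := hg.sub hGm
  have m1 : AEMeasurable (fun x => ‖(g - G) (x + z)‖ₑ) volume :=
    (hDm.comp (measurable_add_const z)).enorm.aemeasurable
  have m2 : AEMeasurable (fun x => ‖G (x + z) - G x‖ₑ) volume :=
    ((hGm.comp (measurable_add_const z)).sub hGm).enorm.aemeasurable
  have m3 : AEMeasurable (fun x => ‖(g - G) x‖ₑ) volume := hDm.enorm.aemeasurable
  calc X.toFun (fun x => ‖g (x + z) - g x‖ₑ)
      ≤ X.toFun (fun x => ‖(g - G) (x + z)‖ₑ + (‖G (x + z) - G x‖ₑ + ‖(g - G) x‖ₑ)) := by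
        refine X.mono _ _ ((hg.comp (measurable_add_const z)).sub hg).enorm.aemeasurable
          (m1.add (m2.add m3)) (ae_of_all _ fun x => ?_)
        have : g (x + z) - g x = (g - G) (x + z) + ((G (x + z) - G x) - (g - G) x) := by
          simp only [Pi.sub_apply]; ring
        dsimp only
        rw [this]
        exact (enorm_add_le _ _).trans (add_le_add le_rfl enorm_sub_le)
    _ ≤ ε / 3 + (ε / 3 + ε / 3) := by
        refine (X.add_le _ _ m1 (m2.add m3)).trans (add_le_add ?_ ?_)
        · exact (hri.toFun_translate hDm z).trans_le hD
        · exact (X.add_le _ _ m2 m3).trans (add_le_add hz hD)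
    _ = ε := by rw [← add_assoc]; exact ENNReal.add_thirds ε

end BanachFunctionNorm

end

/-! ### Averages of translates of test functions -/

noncomputable section

section Average

set_option linter.unusedSectionVars false

variable {A : Type*} [MeasurableSpace A] {μ : Measure A}
  {E : Type*} [NormedAddCommGroup E] [NormedSpace ℝ E] [MeasurableSpace E] [BorelSpace E]
  [SecondCountableTopology E]
  {V : Type*} [NormedAddCommGroup V] [NormedSpace ℝ V]

/-- The weighted average `∫ w(t) Φ(· - a(t)) dμ(t)` of translates of `Φ`. -/
def averageTranslates (μ : Measure A) (a : A → E) (w : A → ℝ) (Φ : E → V) (x : E) : V :=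
  ∫ t, w t • Φ (x - a t) ∂μ

theorem integrable_smul_translate {a : A → E} (ha : Measurable a) {w : A → ℝ} (hw : Integrable w μ)
    {Φ : E → V} (hΦ : Continuous Φ) (hc : HasCompactSupport Φ) (x : E) :
    Integrable (fun t => w t • Φ (x - a t)) μ := by
  obtain ⟨C, hC⟩ := hc.exists_bound_of_continuous hΦ
  exact hw.smul_bdd C
    (hΦ.comp_aestronglyMeasurable (ha.const_sub x).aestronglyMeasurable)
    (ae_of_all _ fun t => hC _)

theorem hasFDerivAt_averageTranslates {a : A → E} (ha : Measurable a) {w : A → ℝ}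
    (hw : Integrable w μ) {Φ : E → V} (hΦ : ContDiff ℝ 1 Φ) (hc : HasCompactSupport Φ) (x : E) :
    HasFDerivAt (averageTranslates μ a w Φ) (averageTranslates μ a w (fderiv ℝ Φ) x) x := by
  have hΦ' : Continuous (fderiv ℝ Φ) := hΦ.continuous_fderiv (by simp)
  obtain ⟨C, hC⟩ := (hc.fderiv ℝ).exists_bound_of_continuous hΦ'
  refine hasFDerivAt_integral_of_dominated_of_fderiv_le (s := univ)
    (F := fun x t => w t • Φ (x - a t)) (F' := fun x t => w t • fderiv ℝ Φ (x - a t))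
    (bound := fun t => ‖w t‖ * C) univ_mem
    (Eventually.of_forall fun y => (integrable_smul_translate ha hw hΦ.continuous hc y).1)
    (integrable_smul_translate ha hw hΦ.continuous hc x)
    (integrable_smul_translate ha hw hΦ' (hc.fderiv ℝ) x).1
    (ae_of_all _ fun t y _ => ?_) (hw.norm.mul_const C) (ae_of_all _ fun t y _ => ?_)
  · rw [norm_smul]
    exact mul_le_mul_of_nonneg_left (hC _) (norm_nonneg _)
  · have h1 := (hΦ.differentiable (by simp) (y - a t)).hasFDerivAt
    have h2 := h1.comp y ((hasFDerivAt_id y).sub_const (a t))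
    simpa [Function.comp_def, Pi.smul_def] using h2.const_smul (w t)

theorem iteratedFDeriv_averageTranslates {a : A → E} (ha : Measurable a) {w : A → ℝ}
    (hw : Integrable w μ) {Φ : E → V} (hΦ : ContDiff ℝ (⊤ : ℕ∞) Φ) (hc : HasCompactSupport Φ)
    (m : ℕ) : iteratedFDeriv ℝ m (averageTranslates μ a w Φ) =
      averageTranslates μ a w (iteratedFDeriv ℝ m Φ) := by
  induction m with
  | zero =>
    funext x
    rw [iteratedFDeriv_zero_eq_comp]
    have := (continuousMultilinearCurryFin0 ℝ E V).symm.toContinuousLinearEquiv.integral_comp_comm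
      (fun t => w t • Φ (x - a t)) (μ := μ)
    simp only [LinearIsometryEquiv.coe_toContinuousLinearEquiv, map_smul] at this
    simp only [averageTranslates, Function.comp_apply, iteratedFDeriv_zero_eq_comp, ← this]
  | succ m ih =>
    funext x
    have hm : ContDiff ℝ 1 (iteratedFDeriv ℝ m Φ) := hΦ.iteratedFDeriv_right (by
      exact_mod_cast le_top)
    rw [iteratedFDeriv_succ_eq_comp_left, ih, Function.comp_apply,
      (hasFDerivAt_averageTranslates ha hw hm (hc.iteratedFDeriv m) x).fderiv]
    let L : (E →L[ℝ] E [×m]→L[ℝ] V) ≃L[ℝ] (E [×(m + 1)]→L[ℝ] V) :=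
      (continuousMultilinearCurryLeftEquiv ℝ
        (fun _ : Fin (m + 1) => E) V).symm.toContinuousLinearEquiv
    have := ContinuousLinearEquiv.integral_comp_comm (𝕜 := ℝ) (E := E →L[ℝ] E [×m]→L[ℝ] V)
      (F := E [×(m + 1)]→L[ℝ] V) L (fun t => w t • fderiv ℝ (iteratedFDeriv ℝ m Φ) (x - a t)) (μ := μ)
    simp only [map_smul] at this
    simp only [averageTranslates, iteratedFDeriv_succ_eq_comp_left, Function.comp_apply]
    exact this.symm

theorem contDiff_averageTranslates {a : A → E} (ha : Measurable a) {w : A → ℝ}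
    (hw : Integrable w μ) {Φ : E → V} (hΦ : ContDiff ℝ (⊤ : ℕ∞) Φ) (hc : HasCompactSupport Φ) :
    ContDiff ℝ (⊤ : ℕ∞) (averageTranslates μ a w Φ) := by
  refine contDiff_of_differentiable_iteratedFDeriv fun m _ x => ?_
  rw [iteratedFDeriv_averageTranslates ha hw hΦ hc]
  have hm : ContDiff ℝ 1 (iteratedFDeriv ℝ m Φ) := hΦ.iteratedFDeriv_right (by
    exact_mod_cast le_top)
  exact (hasFDerivAt_averageTranslates ha hw hm (hc.iteratedFDeriv m) x).differentiableAt

theorem support_averageTranslates_subset [ProperSpace E] {a : A → E} {w : A → ℝ} {R ρ : ℝ}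
    (hR : ∀ t, w t ≠ 0 → ‖a t‖ ≤ R) {Φ : E → V}
    (hΦ : Function.support Φ ⊆ Metric.closedBall 0 ρ) :
    Function.support (averageTranslates μ a w Φ) ⊆ Metric.closedBall 0 (ρ + R) := by
  intro x hx
  by_contra hxn
  refine hx ?_
  refine (integral_congr_ae (ae_of_all _ fun t => ?_)).trans (integral_zero A V)
  by_cases ht : w t = 0
  · simp [ht]
  have : Φ (x - a t) = 0 := by
    by_contra hne
    have h1 := hΦ hne
    rw [mem_closedBall_zero_iff] at h1 hxn
    have h2 := norm_add_le (x - a t) (a t)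
    rw [sub_add_cancel] at h2
    linarith [hR t ht]
  simp [this]

theorem simpleFunc_integral_mul (s : SimpleFunc A E) {w : A → ℝ} (hw : Integrable w μ)
    (Ψ : E → ℝ) :
    ∫ t, w t * Ψ (s t) ∂μ = ∑ c ∈ s.range, (∫ t in s ⁻¹' {c}, w t ∂μ) * Ψ c := by
  have h : ∀ t, w t * Ψ (s t) = ∑ c ∈ s.range, (s ⁻¹' {c}).indicator (fun t => w t * Ψ c) t := by
    intro t
    rw [Finset.sum_eq_single (s t)]
    · rw [indicator_of_mem (by simp)]
    · intro c _ hc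
      rw [indicator_of_notMem]
      simpa using hc.symm
    · intro h
      exact absurd (s.mem_range_self t) h
  simp only [h]
  rw [integral_finsetSum]
  · refine Finset.sum_congr rfl fun c _ => ?_
    rw [integral_indicator (s.measurableSet_preimage _), integral_mul_const]
  · intro c _
    exact (hw.mul_const _).indicator (s.measurableSet_preimage _)

end Average

section Distribution

variable {E : Type*} [NormedAddCommGroup E] [NormedSpace ℝ E]

local notation "𝓓E" => 𝓓((⊤ : TopologicalSpace.Opens E), ℝ)
local notation "𝓓E'" => 𝓓'((⊤ : TopologicalSpace.Opens E), ℝ)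

/-- A smooth function vanishing outside a ball, as a test function. -/
def TestFunction.ofSupportSubsetBall [ProperSpace E] (f : E → ℝ) (hf : ContDiff ℝ (⊤ : ℕ∞) f)
    (r : ℝ) (hs : Function.support f ⊆ Metric.closedBall 0 r) : 𝓓E where
  toFun := f
  contDiff' := hf
  hasCompactSupport' := HasCompactSupport.of_support_subset_isCompact
    (isCompact_closedBall 0 r) hs
  tsupport_subset' := fun _ _ => trivial

/-- The translate `φ(· - a)` of a test function. -/
def TestFunction.translate (a : E) (φ : 𝓓E) : 𝓓E where
  toFun x := φ (x - a)
  contDiff' := φ.contDiff.comp (contDiff_id.sub contDiff_const)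
  hasCompactSupport' := φ.hasCompactSupport.comp_homeomorph (Homeomorph.subRight a)
  tsupport_subset' := fun _ _ => trivial

@[simp]
theorem TestFunction.translate_apply (a : E) (φ : 𝓓E) (x : E) : φ.translate a x = φ (x - a) := rfl

theorem TestFunction.exists_support_subset (φ : 𝓓E) :
    ∃ ρ : ℝ, 0 ≤ ρ ∧ Function.support φ ⊆ Metric.closedBall 0 ρ := by
  obtain ⟨ρ, hρ⟩ := φ.hasCompactSupport.isCompact.isBounded.subset_closedBall 0
  exact ⟨max ρ 0, le_max_right _ _, (subset_tsupport φ).trans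
    (hρ.trans (Metric.closedBall_subset_closedBall (le_max_left _ _)))⟩

theorem TestFunction.support_translate_subset {φ : 𝓓E} {ρ R : ℝ}
    (hφ : Function.support φ ⊆ Metric.closedBall 0 ρ) {a : E} (ha : ‖a‖ ≤ R) :
    Function.support (φ.translate a) ⊆ Metric.closedBall 0 (ρ + R) := by
  intro x hx
  have h1 := hφ (a := x - a) hx
  rw [mem_closedBall_zero_iff] at h1 ⊢
  have h2 := norm_add_le (x - a) a
  rw [sub_add_cancel] at h2
  linarith

/-- A distribution has finite order on every ball. -/
theorem Distribution.exists_bound [ProperSpace E] (T : 𝓓E') (r : ℝ) :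
    ∃ (m : ℕ) (C : ℝ), 0 ≤ C ∧ ∀ (φ : 𝓓E), Function.support φ ⊆ Metric.closedBall 0 r →
      ∀ M : ℝ, 0 ≤ M → (∀ j ≤ m, ∀ x, ‖iteratedFDeriv ℝ j φ x‖ ≤ M) → ‖T φ‖ ≤ C * M := by
  let K : TopologicalSpace.Compacts E := ⟨Metric.closedBall 0 r, isCompact_closedBall 0 r⟩
  have hK : (K : Set E) ⊆ ((⊤ : TopologicalSpace.Opens E) : Set E) := fun _ _ => trivial
  let S : 𝓓^{⊤}_{K}(E, ℝ) →L[ℝ] ℝ :=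
    (T : 𝓓E →L[ℝ] ℝ).comp (TestFunction.ofSupportedInCLM ℝ hK)
  let q : Seminorm ℝ 𝓓^{⊤}_{K}(E, ℝ) := (normSeminorm ℝ ℝ).comp S.toLinearMap
  have hq : Continuous q := continuous_norm.comp S.continuous
  obtain ⟨s, C, -, hC⟩ := Seminorm.bound_of_continuous
    (ContDiffMapSupportedIn.withSeminorms ℝ E ℝ ⊤ K) q hq
  refine ⟨s.sup id, C, C.2, fun φ hφ M hM hb => ?_⟩
  let φK : 𝓓^{⊤}_{K}(E, ℝ) := ContDiffMapSupportedIn.of_support_subset φ.contDiff hφ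
  have hφK : TestFunction.ofSupportedInCLM ℝ hK φK = φ := by
    ext x; rfl
  have h1 : ‖T φ‖ ≤ (C • s.sup (ContDiffMapSupportedIn.seminorm ℝ E ℝ ⊤ K)) φK := by
    have := hC φK
    rwa [show q φK = ‖T φ‖ by
      change ‖T (TestFunction.ofSupportedInCLM ℝ hK φK)‖ = _
      rw [hφK]] at this
  refine h1.trans ?_
  rw [smul_apply]
  refine mul_le_mul_of_nonneg_left (Seminorm.finset_sup_apply_le hM fun j hj => ?_) C.2
  rw [ContDiffMapSupportedIn.seminorm_top_le_iff ℝ hM]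
  exact fun x _ => hb j (Finset.le_sup (f := id) hj) x

end Distribution

end

/-! ### Distributions commute with averages of translates -/

noncomputable section

section Distribution

variable {E : Type*} [NormedAddCommGroup E] [NormedSpace ℝ E]

local notation "𝓓E" => 𝓓((⊤ : TopologicalSpace.Opens E), ℝ)
local notation "𝓓E'" => 𝓓'((⊤ : TopologicalSpace.Opens E), ℝ)

theorem TestFunction.exists_iteratedFDeriv_lipschitz [FiniteDimensional ℝ E] (φ : 𝓓E) (m : ℕ) :
    ∃ L : ℝ, 0 ≤ L ∧ ∀ j ≤ m, ∀ x y,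
      ‖iteratedFDeriv ℝ j φ x - iteratedFDeriv ℝ j φ y‖ ≤ L * ‖x - y‖ := by
  have h : ∀ j, ∃ L : ℝ≥0, LipschitzWith L (iteratedFDeriv ℝ j φ) := fun j =>
    ContDiff.lipschitzWith_of_hasCompactSupport (𝕂 := ℝ) (n := 1)
      (φ.hasCompactSupport.iteratedFDeriv j)
      (φ.contDiff.iteratedFDeriv_right (by exact_mod_cast le_top)) (by simp)
  choose L hL using h
  refine ⟨∑ j ∈ Finset.range (m + 1), (L j : ℝ), Finset.sum_nonneg fun j _ => (L j).2,
    fun j hj x y => ?_⟩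
  refine ((hL j).norm_sub_le x y).trans (mul_le_mul_of_nonneg_right ?_ (norm_nonneg _))
  exact Finset.single_le_sum (f := fun j => (L j : ℝ)) (fun j _ => (L j).2)
    (Finset.mem_range.2 (by omega))

theorem Distribution.exists_translate_lipschitz [FiniteDimensional ℝ E] (T : 𝓓E') (φ : 𝓓E)
    (R : ℝ) : ∃ C : ℝ, 0 ≤ C ∧ ∀ a b : E, ‖a‖ ≤ R → ‖b‖ ≤ R →
      ‖T (φ.translate a) - T (φ.translate b)‖ ≤ C * ‖a - b‖ := by
  obtain ⟨ρ, -, hρ⟩ := φ.exists_support_subset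
  obtain ⟨m, C, hC, hT⟩ := Distribution.exists_bound T (ρ + R)
  obtain ⟨L, hL, hφ⟩ := φ.exists_iteratedFDeriv_lipschitz m
  refine ⟨C * L, mul_nonneg hC hL, fun a b ha hb => ?_⟩
  rw [← map_sub, mul_assoc]
  refine hT _ ?_ _ (mul_nonneg hL (norm_nonneg _)) fun j hj x => ?_
  · exact (Function.support_sub _ _).trans (union_subset
      (TestFunction.support_translate_subset hρ ha) (TestFunction.support_translate_subset hρ hb))
  · have h1 : ∀ c : E, iteratedFDeriv ℝ j (φ.translate c) x = iteratedFDeriv ℝ j φ (x - c) :=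
      fun c => iteratedFDeriv_comp_sub j c x
    have hj' : (j : WithTop ℕ∞) ≤ ((⊤ : ℕ∞) : WithTop ℕ∞) := by exact_mod_cast le_top
    have h2 := iteratedFDeriv_sub_apply (𝕜 := ℝ) (i := j) (x := x)
      ((φ.translate a).contDiff.of_le hj').contDiffAt
      ((φ.translate b).contDiff.of_le hj').contDiffAt
    change ‖iteratedFDeriv ℝ j (⇑(φ.translate a) - ⇑(φ.translate b)) x‖ ≤ _
    rw [h2, h1, h1]
    refine (hφ j hj _ _).trans_eq ?_
    rw [sub_sub_sub_cancel_left, norm_sub_rev]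

theorem Distribution.continuous_translate [FiniteDimensional ℝ E] (T : 𝓓E') (φ : 𝓓E) :
    Continuous fun a => T (φ.translate a) := by
  refine continuous_iff_continuousAt.2 fun a => ?_
  obtain ⟨C, -, hT⟩ := T.exists_translate_lipschitz φ (‖a‖ + 1)
  rw [ContinuousAt, tendsto_iff_norm_sub_tendsto_zero]
  have h0 : Tendsto (fun b => C * ‖b - a‖) (𝓝 a) (𝓝 0) := by
    have : Continuous fun b => C * ‖b - a‖ := by fun_prop
    simpa using this.tendsto a
  refine squeeze_zero' (Eventually.of_forall fun _ => norm_nonneg _) ?_ h0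
  filter_upwards [Metric.ball_mem_nhds a one_pos] with b hb
  refine hT b a ?_ (by linarith)
  have := norm_add_le a (b - a)
  rw [add_sub_cancel] at this
  rw [mem_ball_iff_norm] at hb
  linarith

variable {A : Type*} [MeasurableSpace A] {μ : Measure A} [MeasurableSpace E] [BorelSpace E]

/-- Distributions commute with averages of translates of a test function. The parametrisation `a`
is approximated by simple functions, for which the average is a finite linear combination. -/
theorem Distribution.exists_average [FiniteDimensional ℝ E] (φ : 𝓓E) {a : A → E}
    (ha : Measurable a) {w : A → ℝ} (hw : Integrable w μ) {R : ℝ}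
    (hR : ∀ᵐ t ∂μ, w t ≠ 0 → ‖a t‖ ≤ R) :
    ∃ ψ : 𝓓E, (∀ x, ψ x = ∫ t, w t * φ (x - a t) ∂μ) ∧
      ∀ T : 𝓓E', Integrable (fun t => w t * T (φ.translate (a t))) μ ∧
        T ψ = ∫ t, w t * T (φ.translate (a t)) ∂μ := by
  -- Replacing `a` by `0` where it is large changes nothing where `w` does not vanish.
  wlog hR' : (∀ t, ‖a t‖ ≤ R) ∧ 0 ≤ R generalizing a R
  · set a' : A → E := fun t => if ‖a t‖ ≤ max R 0 then a t else 0 with ha'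
    have ha'm : Measurable a' :=
      Measurable.ite (measurableSet_le ha.norm measurable_const) ha measurable_const
    have hb : ∀ t, ‖a' t‖ ≤ max R 0 := by
      intro t
      simp only [ha']
      split_ifs with h
      · exact h
      · simp
    have heq : ∀ᵐ t ∂μ, w t ≠ 0 → a' t = a t := by
      filter_upwards [hR] with t h ht
      simp only [ha']
      rw [if_pos ((h ht).trans (le_max_left _ _))]
    obtain ⟨ψ, h1, h2⟩ := this ha'm (ae_of_all _ fun t _ => hb t) ⟨hb, le_max_right _ _⟩
    refine ⟨ψ, fun x => ?_, fun T => ?_⟩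
    · rw [h1]
      refine integral_congr_ae ?_
      filter_upwards [heq] with t h
      by_cases ht : w t = 0
      · simp [ht]
      · simp only [h ht]
    · have h3 : (fun t => w t * T (φ.translate (a' t))) =ᵐ[μ]
          fun t => w t * T (φ.translate (a t)) := by
        filter_upwards [heq] with t h
        by_cases ht : w t = 0
        · simp [ht]
        · simp only [h ht]
      exact ⟨(h2 T).1.congr h3, (h2 T).2.trans (integral_congr_ae h3)⟩
  obtain ⟨hR', hR0⟩ := hR'
  obtain ⟨ρ, -, hρ⟩ := φ.exists_support_subset
  -- The average along an arbitrary bounded parametrisation, as a test function.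
  have key : ∀ b : A → E, Measurable b → (∀ t, ‖b t‖ ≤ R) → ∃ ψ : 𝓓E,
      (ψ : E → ℝ) = averageTranslates μ b w φ ∧
      Function.support ψ ⊆ Metric.closedBall 0 (ρ + R) := fun b hb hbR =>
    have hs := support_averageTranslates_subset (μ := μ) (w := w) (fun t _ => hbR t) hρ
    ⟨TestFunction.ofSupportSubsetBall _
      (contDiff_averageTranslates hb hw φ.contDiff φ.hasCompactSupport) (ρ + R) hs, rfl, hs⟩
  obtain ⟨ψ, hψ, hψs⟩ := key a ha hR'
  refine ⟨ψ, fun x => by rw [hψ]; rfl, fun T => ?_⟩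
  obtain ⟨m, C, hC, hT⟩ := T.exists_bound (ρ + R)
  obtain ⟨L, hL, hφ⟩ := φ.exists_iteratedFDeriv_lipschitz m
  obtain ⟨C', hC', hT'⟩ := T.exists_translate_lipschitz φ R
  have h0 : (0 : E) ∈ Metric.closedBall (0 : E) R := by simpa using hR0
  set s : ℕ → SimpleFunc A E := SimpleFunc.approxOn a ha (Metric.closedBall 0 R) 0 h0 with hs
  have hsR : ∀ n t, ‖s n t‖ ≤ R := fun n t => by
    simpa using SimpleFunc.approxOn_mem ha h0 n t
  have hsa : ∀ t, Tendsto (fun n => s n t) atTop (𝓝 (a t)) := fun t =>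
    SimpleFunc.tendsto_approxOn ha h0 (subset_closure (by simpa using hR' t))
  have hδi : ∀ n, Integrable (fun t => ‖w t‖ * ‖s n t - a t‖) μ := fun n => by
    refine (hw.norm.mul_const (2 * R)).mono ?_ (ae_of_all _ fun t => ?_)
    · exact hw.norm.1.mul ((s n).measurable.sub ha).norm.aestronglyMeasurable
    · rw [norm_mul, norm_mul, norm_norm, norm_norm]
      refine mul_le_mul_of_nonneg_left ?_ (norm_nonneg _)
      rw [Real.norm_of_nonneg (by linarith)]
      exact (norm_sub_le _ _).trans (by linarith [hsR n t, hR' t])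
  have hδ : Tendsto (fun n => ∫ t, ‖w t‖ * ‖s n t - a t‖ ∂μ) atTop (𝓝 0) := by
    have := tendsto_integral_of_dominated_convergence (μ := μ)
      (F := fun n t => ‖w t‖ * ‖s n t - a t‖) (f := fun _ => 0) (fun t => ‖w t‖ * (2 * R))
      (fun n => (hδi n).1) (hw.norm.mul_const _) (fun n => ae_of_all _ fun t => ?_)
      (ae_of_all _ fun t => ?_)
    · simpa using this
    · rw [norm_mul, norm_norm, norm_norm]
      refine mul_le_mul_of_nonneg_left ?_ (norm_nonneg _)
      exact (norm_sub_le _ _).trans (by linarith [hsR n t, hR' t])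
    · have h1 := ((hsa t).sub_const (a t)).norm.const_mul ‖w t‖
      simpa using h1
  have hTi : ∀ b : A → E, Measurable b → (∀ t, ‖b t‖ ≤ R) →
      Integrable (fun t => w t * T (φ.translate (b t))) μ := by
    intro b hb hbR
    refine hw.mul_bdd (c := ‖T (φ.translate 0)‖ + C' * R)
      ((T.continuous_translate φ).measurable.comp hb).aestronglyMeasurable (ae_of_all _ fun t => ?_)
    have h1 := hT' (b t) 0 (hbR t) (by simpa using hR0)
    have h2 := norm_add_le (T (φ.translate 0)) (T (φ.translate (b t)) - T (φ.translate 0))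
    rw [add_sub_cancel] at h2
    rw [sub_zero] at h1
    have h3 := mul_le_mul_of_nonneg_left (hbR t) hC'
    linarith
  refine ⟨hTi a ha hR', ?_⟩
  -- Both sides change by at most a multiple of `∫ |w| |s n - a|` when `a` is replaced by the simple
  -- function `s n`.
  have hbound : ∀ n, ‖T ψ - ∫ t, w t * T (φ.translate (a t)) ∂μ‖ ≤
      (C * L + C') * ∫ t, ‖w t‖ * ‖s n t - a t‖ ∂μ := by
    intro n
    obtain ⟨ψn, hψn, hψns⟩ := key (s n) (s n).measurable (hsR n)
    have e1 : T ψn = ∫ t, w t * T (φ.translate (s n t)) ∂μ := by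
      rw [simpleFunc_integral_mul (s n) hw (fun c => T (φ.translate c))]
      have : ψn = ∑ c ∈ (s n).range, (∫ t in s n ⁻¹' {c}, w t ∂μ) • φ.translate c := by
        ext x
        have h1 := simpleFunc_integral_mul (s n) hw (fun c => φ (x - c))
        rw [hψn, averageTranslates]
        simp only [smul_eq_mul, h1]
        symm
        simp
      rw [this, map_sum]
      simp
    have e2 : ‖T ψn - T ψ‖ ≤ C * (L * ∫ t, ‖w t‖ * ‖s n t - a t‖ ∂μ) := by
      rw [← map_sub]
      refine hT _ ((Function.support_sub _ _).trans (union_subset hψns hψs)) _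
        (mul_nonneg hL (integral_nonneg fun t => by positivity)) fun j hj x => ?_
      have hj' : (j : WithTop ℕ∞) ≤ ((⊤ : ℕ∞) : WithTop ℕ∞) := by exact_mod_cast le_top
      have h2 := iteratedFDeriv_sub_apply (𝕜 := ℝ) (i := j) (x := x)
        (ψn.contDiff.of_le hj').contDiffAt (ψ.contDiff.of_le hj').contDiffAt
      have hjc : Continuous (iteratedFDeriv ℝ j φ) := φ.contDiff.continuous_iteratedFDeriv hj'
      have hjs := φ.hasCompactSupport.iteratedFDeriv (𝕜 := ℝ) j
      change ‖iteratedFDeriv ℝ j (⇑ψn - ⇑ψ) x‖ ≤ _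
      rw [h2, hψn, hψ,
        iteratedFDeriv_averageTranslates (s n).measurable hw φ.contDiff φ.hasCompactSupport,
        iteratedFDeriv_averageTranslates ha hw φ.contDiff φ.hasCompactSupport, averageTranslates,
        averageTranslates, ← integral_sub (integrable_smul_translate (s n).measurable hw hjc hjs x)
          (integrable_smul_translate ha hw hjc hjs x), ← integral_const_mul]
      refine norm_integral_le_of_norm_le ((hδi n).const_mul L) (ae_of_all _ fun t => ?_)
      rw [← smul_sub, norm_smul, mul_left_comm]
      refine mul_le_mul_of_nonneg_left ((hφ j hj _ _).trans_eq ?_) (norm_nonneg _)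
      rw [sub_sub_sub_cancel_left, norm_sub_rev]
    have e3 : ‖(∫ t, w t * T (φ.translate (s n t)) ∂μ) - ∫ t, w t * T (φ.translate (a t)) ∂μ‖ ≤
        C' * ∫ t, ‖w t‖ * ‖s n t - a t‖ ∂μ := by
      rw [← integral_sub (hTi _ (s n).measurable (hsR n)) (hTi _ ha hR'), ← integral_const_mul]
      refine norm_integral_le_of_norm_le ((hδi n).const_mul C') (ae_of_all _ fun t => ?_)
      rw [← mul_sub, norm_mul, mul_left_comm]
      exact mul_le_mul_of_nonneg_left (hT' _ _ (hsR n t) (hR' t)) (norm_nonneg _)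
    rw [← e1] at e3
    have e4 := norm_add_le (T ψ - T ψn) (T ψn - ∫ t, w t * T (φ.translate (a t)) ∂μ)
    rw [sub_add_sub_cancel, norm_sub_rev (T ψ) (T ψn)] at e4
    linarith [e4, e3, e2]
  have hlim := ge_of_tendsto' (hδ.const_mul (C * L + C')) hbound
  rw [mul_zero, norm_le_zero_iff, sub_eq_zero] at hlim
  exact hlim

end Distribution

end

/-! ### Differences of order `k` of a distribution -/

noncomputable section

open LineDeriv

/-- The law of the sum of `k` independent random variables uniform on `(0, 1]`: the kernel that
expresses a `k`-th difference through the `k`-th derivative. -/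
def uniformSum : ℕ → Measure ℝ
  | 0 => Measure.dirac 0
  | k + 1 => ((uniformSum k).prod (volume.restrict (Ioc (0 : ℝ) 1))).map fun q => q.1 + q.2

instance isProbabilityMeasure_uniformSum (k : ℕ) : IsProbabilityMeasure (uniformSum k) := by
  induction k with
  | zero => rw [uniformSum]; infer_instance
  | succ k ih =>
    have : IsProbabilityMeasure ((volume : Measure ℝ).restrict (Ioc (0 : ℝ) 1)) :=
      ⟨by simp⟩
    rw [uniformSum]
    exact Measure.isProbabilityMeasure_map (by fun_prop)

theorem ae_mem_Icc_uniformSum (k : ℕ) : ∀ᵐ σ ∂uniformSum k, σ ∈ Icc (0 : ℝ) k := by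
  induction k with
  | zero =>
    rw [uniformSum]
    refine (ae_dirac_iff (p := fun σ => σ ∈ Icc (0 : ℝ) ((0 : ℕ) : ℝ)) measurableSet_Icc).2 ?_
    simp
  | succ k ih =>
    rw [uniformSum]
    refine (ae_map_iff (p := fun σ => σ ∈ Icc (0 : ℝ) ((k + 1 : ℕ) : ℝ)) (by fun_prop)
      measurableSet_Icc).2 ?_
    have h1 := (Measure.quasiMeasurePreserving_fst (μ := uniformSum k)
      (ν := (volume : Measure ℝ).restrict (Ioc (0 : ℝ) 1))).ae ih
    have h2 := (Measure.quasiMeasurePreserving_snd (μ := uniformSum k)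
      (ν := (volume : Measure ℝ).restrict (Ioc (0 : ℝ) 1))).ae (ae_restrict_mem measurableSet_Ioc)
    filter_upwards [h1, h2] with q hq1 hq2
    push_cast
    exact ⟨add_nonneg hq1.1 hq2.1.le, add_le_add hq1.2 hq2.2⟩

theorem integrable_uniformSum (k : ℕ) {f : ℝ → ℝ} (hf : Continuous f) :
    Integrable f (uniformSum k) := by
  obtain ⟨C, hC⟩ := isCompact_Icc.exists_bound_of_continuousOn (s := Icc (0 : ℝ) k) hf.continuousOn
  refine Integrable.of_bound hf.aestronglyMeasurable C ?_
  filter_upwards [ae_mem_Icc_uniformSum k] with σ hσ using hC σ hσ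

/-- The `k`-th forward difference is the average of the `k`-th derivative against `uniformSum k`. -/
theorem fwdDiff_iter_eq_integral (ψ : ℕ → ℝ → ℝ) (hψ : ∀ i s, HasDerivAt (ψ i) (ψ (i + 1) s) s)
    (k : ℕ) (s : ℝ) : (fwdDiff 1)^[k] (ψ 0) s = ∫ σ, ψ k (s + σ) ∂uniformSum k := by
  have hc : ∀ i, Continuous (ψ i) := fun i =>
    continuous_iff_continuousAt.2 fun s => (hψ i s).continuousAt
  induction k generalizing s with
  | zero => simp [uniformSum]
  | succ k ih =>
    have hint : ∀ i m s, Integrable (fun σ => ψ i (s + σ)) (uniformSum m) := fun i m s =>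
      integrable_uniformSum m ((hc i).comp (continuous_const_add s))
    rw [Function.iterate_succ_apply', fwdDiff, ih, ih, ← integral_sub (hint _ _ _) (hint _ _ _)]
    have hi := hint (k + 1) (k + 1) s
    rw [uniformSum] at hi ⊢
    rw [integral_map (by fun_prop) hi.1]
    have hi' := (integrable_map_measure hi.1 (by fun_prop)).1 hi
    simp only [Function.comp_def] at hi'
    rw [integral_prod _ hi']
    refine integral_congr_ae (ae_of_all _ fun σ => ?_)
    dsimp only
    rw [← intervalIntegral.integral_of_le zero_le_one]
    have h1 := intervalIntegral.integral_eq_sub_of_hasDerivAt (a := 0) (b := 1)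
      (f := fun u => ψ k (s + (σ + u))) (f' := fun u => ψ (k + 1) (s + (σ + u)))
      (fun u _ => by
        have h2 : HasDerivAt (fun u : ℝ => s + (σ + u)) 1 u :=
          ((hasDerivAt_id u).const_add σ).const_add s
        simpa [Function.comp_def] using (hψ k (s + (σ + u))).comp u h2)
      (((hc (k + 1)).comp (by fun_prop)).intervalIntegrable 0 1)
    rw [h1]
    congr 2 <;> ring

section Distribution

variable {E : Type*} [NormedAddCommGroup E] [NormedSpace ℝ E]

local notation "𝓓E" => 𝓓((⊤ : TopologicalSpace.Opens E), ℝ)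
local notation "𝓓E'" => 𝓓'((⊤ : TopologicalSpace.Opens E), ℝ)

theorem TestFunction.lineDerivOp_apply_eq_fderiv (φ : 𝓓E) (v x : E) :
    (∂_{v} φ : 𝓓E) x = fderiv ℝ φ x v := by
  have h := TestFunction.lineDerivCLM_apply_of_le (𝕜 := ℝ) (n := ⊤) (k := ⊤) (f := φ) (v := v)
    (x := x) (by simp)
  rw [TestFunction.lineDerivOp_eq_lineDerivCLM ℝ, h,
    ((φ.contDiff.differentiable (by simp)) x).lineDeriv_eq_fderiv]

theorem TestFunction.lineDerivOp_comm (φ : 𝓓E) (u v : E) :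
    (∂_{u} (∂_{v} φ : 𝓓E) : 𝓓E) = ∂_{v} (∂_{u} φ : 𝓓E) := by
  ext x
  have hφ : ContDiff ℝ (⊤ : ℕ∞) φ := φ.contDiff
  have h2 : Differentiable ℝ (fderiv ℝ φ) :=
    (hφ.fderiv_right (m := (⊤ : ℕ∞)) (by simp)).differentiable (by simp)
  have key : ∀ u v : E, (∂_{u} (∂_{v} φ : 𝓓E) : 𝓓E) x = fderiv ℝ (fderiv ℝ φ) x u v := by
    intro u v
    have hv : ((∂_{v} φ : 𝓓E) : E → ℝ) = fun y => fderiv ℝ φ y v :=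
      funext fun y => φ.lineDerivOp_apply_eq_fderiv v y
    rw [TestFunction.lineDerivOp_apply_eq_fderiv, hv, fderiv_clm_apply (h2 x) (by fun_prop)]
    simp
  rw [key, key]
  exact (hφ.contDiffAt.isSymmSndFDerivAt (by
    simp only [minSmoothness_of_isRCLikeNormedField]
    exact WithTop.coe_le_coe.2 (le_top : (2 : ℕ∞) ≤ ⊤))).eq u v

theorem TestFunction.lineDerivOp_translate (φ : 𝓓E) (v a : E) :
    (∂_{v} (φ.translate a) : 𝓓E) = TestFunction.translate a (∂_{v} φ) := by
  ext x
  rw [TestFunction.translate_apply, TestFunction.lineDerivOp_apply_eq_fderiv,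
    TestFunction.lineDerivOp_apply_eq_fderiv]
  have : (φ.translate a : E → ℝ) = fun y => φ (y - a) := rfl
  rw [this, fderiv_comp_sub]

theorem TestFunction.lineDerivOp_iterate_translate (φ : 𝓓E) (v a : E) (k : ℕ) :
    (fun ψ : 𝓓E => (∂_{v} ψ : 𝓓E))^[k] (φ.translate a) =
      TestFunction.translate a ((fun ψ : 𝓓E => (∂_{v} ψ : 𝓓E))^[k] φ) := by
  induction k with
  | zero => rfl
  | succ k ih => rw [Function.iterate_succ_apply', ih, TestFunction.lineDerivOp_translate,
      Function.iterate_succ_apply']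

theorem Distribution.lineDerivOp_comm (T : 𝓓E') (u v : E) :
    (∂_{u} (∂_{v} T : 𝓓E') : 𝓓E') = ∂_{v} (∂_{u} T : 𝓓E') := by
  ext φ
  simp only [Distribution.lineDerivOp_apply_apply, map_neg,
    TestFunction.lineDerivOp_comm φ u v]

theorem Distribution.lineDerivOp_iterate_apply (T : 𝓓E') (v : E) (k : ℕ) (φ : 𝓓E) :
    ((fun S : 𝓓E' => (∂_{v} S : 𝓓E'))^[k] T) φ =
      (-1 : ℝ) ^ k * T ((fun ψ : 𝓓E => (∂_{v} ψ : 𝓓E))^[k] φ) := by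
  induction k generalizing T with
  | zero => simp
  | succ k ih =>
    rw [Function.iterate_succ_apply, ih, Distribution.lineDerivOp_apply_apply, map_neg,
      Function.iterate_succ_apply', pow_succ]
    ring

variable [MeasurableSpace E] [BorelSpace E]

/-- The `k`-th difference of a distribution is the average of translates of its `k`-th directional
derivative. -/
theorem Distribution.sum_translate_eq_integral [FiniteDimensional ℝ E] (T : 𝓓E') (φ : 𝓓E) (h : E)
    (k : ℕ) :
    ∑ j ∈ Finset.range (k + 1), (-1 : ℝ) ^ (j + k) * (k.choose j : ℝ) *
        T (φ.translate ((j : ℝ) • h)) =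
      ∫ σ, ((fun S : 𝓓E' => (∂_{h} S : 𝓓E'))^[k] T) (φ.translate (σ • h)) ∂uniformSum k := by
  set φi : ℕ → 𝓓E := fun i => (fun ψ : 𝓓E => (∂_{h} ψ : 𝓓E))^[i] φ with hφi
  have hb : ∀ᵐ σ ∂uniformSum k, (-1 : ℝ) ^ k ≠ 0 → ‖σ • h‖ ≤ k * ‖h‖ := by
    filter_upwards [ae_mem_Icc_uniformSum k] with σ hσ _
    rw [norm_smul, Real.norm_of_nonneg hσ.1]
    exact mul_le_mul_of_nonneg_right hσ.2 (norm_nonneg _)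
  obtain ⟨ψ, hψ, hTψ⟩ := Distribution.exists_average (φi k)
    (a := fun σ : ℝ => σ • h) (by fun_prop) (w := fun _ => (-1 : ℝ) ^ k)
    (integrable_const (μ := uniformSum k) _) hb
  have hsum : ψ = ∑ j ∈ Finset.range (k + 1), ((-1 : ℝ) ^ (j + k) * (k.choose j : ℝ)) •
      φ.translate ((j : ℝ) • h) := by
    ext x
    rw [hψ]
    have hd : ∀ i s, HasDerivAt (fun s : ℝ => (-1 : ℝ) ^ i * φi i (x - s • h))
        ((-1 : ℝ) ^ (i + 1) * φi (i + 1) (x - s • h)) s := by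
      intro i s
      have h1 : HasDerivAt (fun s : ℝ => x - s • h) (-h) s := by
        simpa using ((hasDerivAt_id s).smul_const h).const_sub x
      have h2 := (((φi i).contDiff.differentiable (by simp)) (x - s • h)).hasFDerivAt
      have h3 := (h2.comp_hasDerivAt s h1).const_mul ((-1 : ℝ) ^ i)
      have h5 : φi (i + 1) = ∂_{h} (φi i) := by
        simp only [hφi, Function.iterate_succ_apply']
      have h6 : (-1 : ℝ) ^ (i + 1) * φi (i + 1) (x - s • h) =
          (-1 : ℝ) ^ i * fderiv ℝ (φi i) (x - s • h) (-h) := by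
        rw [map_neg, ← TestFunction.lineDerivOp_apply_eq_fderiv, pow_succ, h5]
        ring
      rw [h6]
      exact h3
    have h4 := fwdDiff_iter_eq_integral (fun i s => (-1 : ℝ) ^ i * φi i (x - s • h)) hd k 0
    simp only [zero_add] at h4
    rw [← h4, fwdDiff_iter_eq_sum_shift]
    have h7 : (∑ j ∈ Finset.range (k + 1), ((-1 : ℝ) ^ (j + k) * (k.choose j : ℝ)) •
        φ.translate ((j : ℝ) • h)) x = ∑ j ∈ Finset.range (k + 1),
          (-1 : ℝ) ^ (j + k) * (k.choose j : ℝ) * φ (x - (j : ℝ) • h) := by simp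
    rw [h7]
    simp only [zero_add, pow_zero, one_mul, nsmul_eq_mul, mul_one, zsmul_eq_mul, Int.cast_mul,
      Int.cast_pow, Int.cast_neg, Int.cast_one, Int.cast_natCast]
    refine Finset.sum_congr rfl fun j hj => ?_
    have hjk : j ≤ k := Nat.lt_succ_iff.1 (Finset.mem_range.1 hj)
    congr 2
    rw [show j + k = (k - j) + 2 * j by omega, pow_add, pow_mul]
    simp
  calc _ = T ψ := by
        rw [hsum, map_sum]
        simp [mul_assoc]
    _ = _ := by
        rw [(hTψ T).2]
        refine integral_congr_ae (ae_of_all _ fun σ => ?_)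
        dsimp only
        rw [Distribution.lineDerivOp_iterate_apply, TestFunction.lineDerivOp_iterate_translate]

end Distribution

/-- The multinomial theorem for derivatives: `(∂_h)^k = ∑_{|α| = k} (k! / α!) h^α ∂^α`. -/
theorem lineDerivOp_iterate_eq_sum {N : ℕ} (T : 𝓓'((⊤ : TopologicalSpace.Opens (RN N)), ℝ))
    (h : RN N) (k : ℕ) :
    (fun S : 𝓓'((⊤ : TopologicalSpace.Opens (RN N)), ℝ) => ∂_{h} S)^[k] T =
      ∑ α ∈ multiIndices N k, ((Nat.multinomial Finset.univ α : ℝ) * ∏ i, h i ^ α i) •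
        distDeriv α T := by
  let D : RN N → Module.End ℝ 𝓓'((⊤ : TopologicalSpace.Opens (RN N)), ℝ) := fun v =>
    (lineDerivOpCLM ℝ 𝓓'((⊤ : TopologicalSpace.Opens (RN N)), ℝ) v).toLinearMap
  have hD : ∀ v S, D v S = ∂_{v} S := fun _ _ => rfl
  have hDpow : ∀ v (m : ℕ) S, (D v ^ m) S = (fun U => ∂_{v} U)^[m] S := by
    intro v m S
    rw [Module.End.pow_apply]
    rfl
  set e : Fin N → RN N := fun i => EuclideanSpace.single i 1 with he
  have hsum : D h = ∑ i, h i • D (e i) := by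
    ext S : 1
    simp only [LinearMap.sum_apply, LinearMap.smul_apply, hD]
    conv_lhs => rw [show h = ∑ i, h i • e i by
      simpa using ((EuclideanSpace.basisFun (Fin N) ℝ).sum_repr h).symm]
    rw [lineDerivOp_left_sum]
    simp only [lineDerivOp_left_smul]
  have hcomm : ((Finset.univ : Finset (Fin N)) : Set (Fin N)).Pairwise
      (Function.onFun Commute fun i => h i • D (e i)) := by
    intro i _ j _ _
    refine Commute.smul_left (Commute.smul_right ?_ _) _
    ext S : 1
    simp only [Module.End.mul_apply, hD]
    exact Distribution.lineDerivOp_comm S _ _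
  rw [← hDpow, hsum, Finset.sum_pow_eq_sum_piAntidiag_of_commute _ _ hcomm, LinearMap.sum_apply]
  refine Finset.sum_congr rfl fun α _ => ?_
  have hl : ∀ (l : List (Fin N)) (S : 𝓓'((⊤ : TopologicalSpace.Opens (RN N)), ℝ)),
      (l.map fun i => (h i • D (e i)) ^ α i).prod S = (l.map fun i => h i ^ α i).prod •
        l.foldr (fun i S => (fun U => ∂_{e i} U)^[α i] S) S := by
    intro l S
    induction l with
    | nil => simp
    | cons i l ih =>
      rw [List.map_cons, List.prod_cons, Module.End.mul_apply, ih, map_smul, List.map_cons,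
        List.prod_cons, List.foldr_cons, smul_pow, LinearMap.smul_apply, hDpow, smul_smul,
        mul_comm]
  have hprod : Finset.univ.noncommProd (fun i => (h i • D (e i)) ^ α i)
      (fun _ hi _ hj hij => (hcomm hi hj hij).pow_pow _ _) =
        ((List.finRange N).map fun i => (h i • D (e i)) ^ α i).prod :=
    Multiset.noncommProd_coe _ _
  rw [Module.End.mul_apply, hprod, hl, Fin.prod_univ_def, mul_smul, Module.End.natCast_apply,
    Nat.cast_smul_eq_nsmul]
  rfl

end

/-! ### Distributions whose derivatives of order `k` are functions -/

noncomputable section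

open LineDeriv

variable {N : ℕ}

local notation "𝓓N" => 𝓓((⊤ : TopologicalSpace.Opens (RN N)), ℝ)
local notation "𝓓N'" => 𝓓'((⊤ : TopologicalSpace.Opens (RN N)), ℝ)

/-- The functional `ℓ` on test functions is integration against the locally integrable function
`f`. For distributions this is `IsGivenBy`. -/
def Represents (f : RN N → ℝ) (ℓ : 𝓓N → ℝ) : Prop :=
  LocallyIntegrable f volume ∧ ∀ φ : 𝓓N, ℓ φ = ∫ x, f x * φ x ∂volume

theorem MeasureTheory.LocallyIntegrable.integrable_mul_testFunction {f : RN N → ℝ}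
    (hf : LocallyIntegrable f volume) (φ : 𝓓N) : Integrable (fun x => f x * φ x) volume := by
  simpa using hf.integrable_smul_right_of_hasCompactSupport φ.continuous φ.hasCompactSupport

theorem Represents.const_mul {f : RN N → ℝ} {ℓ : 𝓓N → ℝ} (h : Represents f ℓ) (c : ℝ) :
    Represents (fun x => c * f x) fun φ => c * ℓ φ := by
  refine ⟨h.1.smul c, fun φ => ?_⟩
  dsimp only
  rw [h.2, ← integral_const_mul]
  simp only [mul_assoc]

theorem Represents.sub {f f' : RN N → ℝ} {ℓ ℓ' : 𝓓N → ℝ} (h : Represents f ℓ)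
    (h' : Represents f' ℓ') : Represents (fun x => f x - f' x) fun φ => ℓ φ - ℓ' φ := by
  refine ⟨h.1.sub h'.1, fun φ => ?_⟩
  dsimp only
  rw [h.2, h'.2, ← integral_sub (h.1.integrable_mul_testFunction φ)
    (h'.1.integrable_mul_testFunction φ)]
  simp only [sub_mul]

theorem Represents.sum {ι : Type*} (s : Finset ι) {f : ι → RN N → ℝ} {ℓ : ι → 𝓓N → ℝ}
    (h : ∀ i ∈ s, Represents (f i) (ℓ i)) :
    Represents (fun x => ∑ i ∈ s, f i x) fun φ => ∑ i ∈ s, ℓ i φ := by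
  refine ⟨locallyIntegrable_finsetSum s fun i hi => (h i hi).1, fun φ => ?_⟩
  simp only [Finset.sum_mul]
  rw [integral_finsetSum _ fun i hi => (h i hi).1.integrable_mul_testFunction φ]
  exact Finset.sum_congr rfl fun i hi => (h i hi).2 φ

theorem Represents.ae_eq {f f' : RN N → ℝ} {ℓ : 𝓓N → ℝ} (h : Represents f ℓ)
    (h' : Represents f' ℓ) : f =ᵐ[volume] f' := by
  refine ae_eq_of_integral_contDiff_smul_eq h.1 h'.1 fun φ hφ hφc => ?_
  let φ' : 𝓓N := ⟨φ, hφ, hφc, fun _ _ => trivial⟩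
  have := (h.2 φ').symm.trans (h'.2 φ')
  simp only [smul_eq_mul, mul_comm (φ _)]
  exact this

section Average

variable {A : Type*} [MeasurableSpace A] {μ : Measure A} [SFinite μ]

theorem integrable_prod_translate {G : RN N → ℝ} (hG : Integrable G volume) {a : A → RN N}
    (ha : Measurable a) {w : A → ℝ} (hw : Integrable w μ) :
    Integrable (fun q : RN N × A => w q.2 * G (q.1 + a q.2)) (volume.prod μ) := by
  have hmp : MeasurePreserving (fun q : A × RN N => (q.1, q.2 + a q.1)) (μ.prod volume)
      (μ.prod volume) :=
    (MeasurePreserving.id μ).skew_product (g := fun t x => x + a t)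
      (by simp only [Function.uncurry_def]; fun_prop)
      (ae_of_all _ fun t => (measurePreserving_add_right volume (a t)).map_eq)
  exact (hmp.integrable_comp_of_integrable (hw.mul_prod hG)).swap

theorem MeasureTheory.LocallyIntegrable.integrable_indicator_closedBall {g : RN N → ℝ}
    (hg : LocallyIntegrable g volume) (r : ℝ) :
    Integrable ((Metric.closedBall (0 : RN N) r).indicator g) volume :=
  (integrable_indicator_iff measurableSet_closedBall).2
    (hg.integrableOn_isCompact (isCompact_closedBall 0 r))

/-- Averages of translates of a locally integrable function are locally integrable, and act on test
functions as expected. -/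
theorem represents_average {g : RN N → ℝ} (hg : LocallyIntegrable g volume) {a : A → RN N}
    (ha : Measurable a) {w : A → ℝ} (hw : Integrable w μ) {R : ℝ}
    (hR : ∀ᵐ t ∂μ, w t ≠ 0 → ‖a t‖ ≤ R) :
    Represents (fun x => ∫ t, w t * g (x + a t) ∂μ)
      fun φ => ∫ t, w t * ∫ x, g x * φ (x - a t) ∂volume ∂μ := by
  -- Near a given ball only the values of `g` on a larger ball matter.
  have hloc : ∀ ρ : ℝ, ∀ᵐ t ∂μ, ∀ x ∈ Metric.closedBall (0 : RN N) ρ, w t * g (x + a t) =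
      w t * (Metric.closedBall (0 : RN N) (ρ + R)).indicator g (x + a t) := by
    intro ρ
    filter_upwards [hR] with t ht x hx
    by_cases hw0 : w t = 0
    · simp [hw0]
    · rw [indicator_of_mem]
      rw [mem_closedBall_zero_iff] at hx ⊢
      exact (norm_add_le _ _).trans (add_le_add hx (ht hw0))
  constructor
  · rw [locallyIntegrable_iff]
    intro K hK
    obtain ⟨ρ, hρ⟩ := hK.isBounded.subset_closedBall 0
    refine IntegrableOn.mono_set ?_ hρ
    refine ((integrable_prod_translate (hg.integrable_indicator_closedBall (ρ + R)) ha
      hw).integral_prod_left.integrableOn).congr_fun (fun x hx => ?_) measurableSet_closedBall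
    refine integral_congr_ae ?_
    filter_upwards [hloc ρ] with t ht using (ht x hx).symm
  · intro φ
    obtain ⟨ρ, -, hρ⟩ := φ.exists_support_subset
    set G := (Metric.closedBall (0 : RN N) (ρ + R)).indicator g with hG
    have hGi : Integrable G volume := hg.integrable_indicator_closedBall (ρ + R)
    have hprod : Integrable (fun q : RN N × A => w q.2 * G (q.1 + a q.2) * φ q.1)
        (volume.prod μ) := by
      obtain ⟨C, hC⟩ := φ.hasCompactSupport.exists_bound_of_continuous φ.continuous
      exact (integrable_prod_translate hGi ha hw).mul_bdd (c := C)
        (φ.continuous.measurable.comp measurable_fst).aestronglyMeasurable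
        (ae_of_all _ fun q => hC _)
    symm
    calc ∫ x, (∫ t, w t * g (x + a t) ∂μ) * φ x ∂volume
        = ∫ x, ∫ t, w t * G (x + a t) * φ x ∂μ ∂volume := by
          refine integral_congr_ae (ae_of_all _ fun x => ?_)
          dsimp only
          rw [← integral_mul_const]
          by_cases hx : φ x = 0
          · simp [hx]
          refine integral_congr_ae ?_
          filter_upwards [hloc ρ] with t ht
          rw [ht x (hρ hx)]
      _ = ∫ t, ∫ x, w t * G (x + a t) * φ x ∂volume ∂μ := integral_integral_swap hprod
      _ = ∫ t, w t * ∫ x, g x * φ (x - a t) ∂volume ∂μ := by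
          refine integral_congr_ae ?_
          filter_upwards [hloc ρ] with t ht
          rw [← integral_const_mul,
            ← integral_add_right_eq_self (fun x => w t * (g x * φ (x - a t))) (a t)]
          refine integral_congr_ae (ae_of_all _ fun x => ?_)
          dsimp only
          rw [add_sub_cancel_right, ← mul_assoc]
          by_cases hx : φ x = 0
          · simp [hx]
          rw [ht x (hρ hx)]

end Average

theorem locallyIntegrable_translate {g : RN N → ℝ} (hg : LocallyIntegrable g volume) (a : RN N) :
    LocallyIntegrable (fun x => g (x + a)) volume := by
  have := (represents_average (μ := Measure.dirac ()) hg (a := fun _ => a) measurable_const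
    (w := fun _ => 1) (integrable_const _) (R := ‖a‖) (ae_of_all _ fun _ _ => le_rfl)).1
  simpa using this

theorem IsGivenBy.apply_translate {T : 𝓓N'} {f : RN N → ℝ} (h : IsGivenBy T f) (φ : 𝓓N)
    (a : RN N) : T (φ.translate a) = ∫ x, f (x + a) * φ x ∂volume := by
  rw [h.2, ← integral_add_right_eq_self _ a]
  simp

theorem isGivenBy_lineDerivOp_iterate {T : 𝓓N'} {k : ℕ} {g : (Fin N → ℕ) → RN N → ℝ}
    (hg : ∀ α ∈ multiIndices N k, IsGivenBy (distDeriv α T) (g α)) (h : RN N) :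
    IsGivenBy ((fun S : 𝓓N' => ∂_{h} S)^[k] T) (dirDeriv k g h) := by
  have h1 := Represents.sum (multiIndices N k) fun α hα =>
    Represents.const_mul (ℓ := fun φ => distDeriv α T φ) (hg α hα)
      ((Nat.multinomial Finset.univ α : ℝ) * ∏ i, h i ^ α i)
  refine ⟨h1.1, fun φ => ?_⟩
  rw [lineDerivOp_iterate_eq_sum]
  have h2 := h1.2 φ
  simp only [dirDeriv]
  rw [← h2]
  simp

/-- The integral formula `Δ_h^k f(x) = ∫ (∂_h^k f)(x + σh) dν(σ)`, `ν` the law of a sum of `k`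
uniform variables, for functions whose weak derivatives of order `k` are locally integrable. -/
theorem kthDiff_ae_eq_integral {T : 𝓓N'} {k : ℕ} {f : RN N → ℝ} {g : (Fin N → ℕ) → RN N → ℝ}
    (hf : IsGivenBy T f) (hg : ∀ α ∈ multiIndices N k, IsGivenBy (distDeriv α T) (g α))
    (h : RN N) :
    ∀ᵐ x ∂volume, kthDiff k h f x = ∫ σ, dirDeriv k g h (x + σ • h) ∂uniformSum k := by
  have hG := isGivenBy_lineDerivOp_iterate hg h
  have hb : ∀ᵐ σ ∂uniformSum k, (1 : ℝ) ≠ 0 → ‖σ • h‖ ≤ k * ‖h‖ := by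
    filter_upwards [ae_mem_Icc_uniformSum k] with σ hσ _
    rw [norm_smul, Real.norm_of_nonneg hσ.1]
    exact mul_le_mul_of_nonneg_right hσ.2 (norm_nonneg _)
  have h1 := represents_average (μ := uniformSum k) hG.1 (a := fun σ : ℝ => σ • h) (by fun_prop)
    (w := fun _ => 1) (integrable_const _) hb
  simp only [one_mul] at h1
  have h2 : Represents (kthDiff k h f) fun φ => ∑ j ∈ Finset.range (k + 1),
      (-1 : ℝ) ^ (j + k) * (k.choose j : ℝ) * T (φ.translate ((j : ℝ) • h)) :=
    Represents.sum _ fun j _ => Represents.const_mul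
      ⟨locallyIntegrable_translate hf.1 _, fun φ => hf.apply_translate φ _⟩ _
  have h3 : (fun φ : 𝓓N => ∑ j ∈ Finset.range (k + 1),
      (-1 : ℝ) ^ (j + k) * (k.choose j : ℝ) * T (φ.translate ((j : ℝ) • h))) =
      fun φ => ∫ σ, ∫ x, dirDeriv k g h x * φ (x - σ • h) ∂volume ∂uniformSum k := by
    funext φ
    rw [Distribution.sum_translate_eq_integral]
    refine integral_congr_ae (ae_of_all _ fun σ => ?_)
    exact hG.2 _
  rw [h3] at h2
  exact h2.ae_eq h1

/-- Averaging translates `T(φ(· - jh))`, `j ≠ 0`, over `h` with a smooth weight gives a functional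
represented by a continuous function: the weight takes over the role of the test function. -/
theorem represents_integral_translate (T : 𝓓N') (η : 𝓓N) {j : ℝ} (hj : 0 < j) :
    ∃ F : RN N → ℝ, Represents F fun φ => ∫ h, η h * T (φ.translate (j • h)) ∂volume := by
  let ηj : 𝓓N := ⟨fun z => |(j ^ Module.finrank ℝ (RN N))⁻¹| * η (j⁻¹ • z),
    contDiff_const.mul (η.contDiff.comp (contDiff_const_smul _)),
    (η.hasCompactSupport.comp_homeomorph
      (Homeomorph.smulOfNeZero j⁻¹ (inv_ne_zero hj.ne'))).mul_left, fun _ _ => trivial⟩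
  have hc : Continuous fun y => T (ηj.translate y) := T.continuous_translate ηj
  refine ⟨fun y => T (ηj.translate y), hc.locallyIntegrable, fun φ => ?_⟩
  obtain ⟨ρ, -, hρ⟩ := η.exists_support_subset
  obtain ⟨ρ', -, hρ'⟩ := φ.exists_support_subset
  have hη : Integrable η volume := η.continuous.integrable_of_hasCompactSupport η.hasCompactSupport
  have hφ : Integrable φ volume := φ.continuous.integrable_of_hasCompactSupport φ.hasCompactSupport
  obtain ⟨ψ₁, h1, h1'⟩ := Distribution.exists_average φ (μ := volume)
    (a := fun h : RN N => j • h) (by fun_prop) hη (R := j * ρ) (ae_of_all _ fun h hh => by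
      rw [norm_smul, Real.norm_of_nonneg hj.le]
      exact mul_le_mul_of_nonneg_left (by simpa using hρ hh) hj.le)
  obtain ⟨ψ₂, h2, h2'⟩ := Distribution.exists_average ηj (μ := volume)
    (a := fun y : RN N => y) measurable_id hφ (R := ρ') (ae_of_all _ fun h hh => by
      simpa using hρ' hh)
  have h12 : ψ₁ = ψ₂ := by
    ext x
    rw [h1, h2]
    have e1 := Measure.integral_comp_smul (volume : Measure (RN N))
      (fun z => η (j⁻¹ • z) * φ (x - z)) j
    simp only [smul_smul, inv_mul_cancel₀ hj.ne', one_smul] at e1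
    rw [e1, ← integral_sub_left_eq_self _ _ x, ← integral_smul]
    refine integral_congr_ae (ae_of_all _ fun y => ?_)
    simp only [sub_sub_cancel, smul_eq_mul]
    change _ = φ y * (|(j ^ Module.finrank ℝ (RN N))⁻¹| * η (j⁻¹ • (x - y)))
    ring
  dsimp only
  rw [← (h1' T).2, h12, (h2' T).2]
  simp only [mul_comm]

/-- A distribution whose derivatives of order `k` are locally integrable functions is itself a
locally integrable function. Averaging the identity between `k`-th differences and `k`-th
derivatives over all steps `h` with a smooth weight `η`, `∫ η = 1`, isolates the term `j = 0`, which
is `± T`; all other terms are represented by functions. -/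
theorem exists_isGivenBy {T : 𝓓N'} {k : ℕ} {g : (Fin N → ℕ) → RN N → ℝ}
    (hg : ∀ α ∈ multiIndices N k, IsGivenBy (distDeriv α T) (g α)) :
    ∃ f : RN N → ℝ, IsGivenBy T f := by
  let b : ContDiffBump (0 : RN N) := ⟨1, 2, one_pos, one_lt_two⟩
  let η : 𝓓N := ⟨b.normed volume, b.contDiff_normed, b.hasCompactSupport_normed,
    fun _ _ => trivial⟩
  have hη : Integrable η volume := η.continuous.integrable_of_hasCompactSupport η.hasCompactSupport
  have hη1 : ∫ h, η h ∂volume = 1 := b.integral_normed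
  obtain ⟨ρ, -, hρ⟩ := η.exists_support_subset
  have hF : ∀ j : ℕ, ∃ F : RN N → ℝ, Represents F fun φ =>
      ∫ h, η h * T (φ.translate (((j + 1 : ℕ) : ℝ) • h)) ∂volume := fun j =>
    represents_integral_translate T η (by positivity)
  choose F hF using hF
  set w : (Fin N → ℕ) → RN N × ℝ → ℝ := fun α q => η q.1 * ∏ i, q.1 i ^ α i with hw
  have hwi : ∀ α, Integrable (w α) ((volume : Measure (RN N)).prod (uniformSum k)) := by
    intro α
    have h1 : Integrable (fun h : RN N => η h * ∏ i, h i ^ α i) volume := by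
      refine Continuous.integrable_of_hasCompactSupport ?_ (η.hasCompactSupport.mul_right)
      exact η.continuous.mul (by fun_prop)
    exact h1.comp_fst (uniformSum k)
  have ha : Measurable fun q : RN N × ℝ => q.2 • q.1 := by fun_prop
  have hb : ∀ α, ∀ᵐ q ∂((volume : Measure (RN N)).prod (uniformSum k)),
      w α q ≠ 0 → ‖q.2 • q.1‖ ≤ k * ρ := by
    intro α
    filter_upwards [(Measure.quasiMeasurePreserving_snd (μ := (volume : Measure (RN N)))
      (ν := uniformSum k)).ae (ae_mem_Icc_uniformSum k)] with q hq hne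
    have h1 : q.1 ∈ Metric.closedBall 0 ρ := hρ (left_ne_zero_of_mul hne)
    rw [norm_smul, Real.norm_of_nonneg hq.1]
    exact mul_le_mul hq.2 (by simpa using h1) (norm_nonneg _) (Nat.cast_nonneg _)
  have hR : ∀ α ∈ multiIndices N k, ∃ G : RN N → ℝ, Represents G fun φ =>
      ∫ q, w α q * distDeriv α T (φ.translate (q.2 • q.1))
        ∂((volume : Measure (RN N)).prod (uniformSum k)) := by
    intro α hα
    have h1 := represents_average (hg α hα).1 ha (hwi α) (hb α)
    refine ⟨_, h1.1, fun φ => ?_⟩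
    rw [← h1.2 φ]
    refine integral_congr_ae (ae_of_all _ fun q => ?_)
    exact congrArg _ ((hg α hα).2 _)
  choose! G hG using hR
  have hrep := ((Represents.sum (multiIndices N k) fun α hα =>
    (hG α hα).const_mul (Nat.multinomial Finset.univ α : ℝ)).sub
    (Represents.sum (Finset.range k) fun j _ => (hF j).const_mul
      ((-1 : ℝ) ^ (j + 1 + k) * (k.choose (j + 1) : ℝ)))).const_mul ((-1 : ℝ) ^ k)
  refine ⟨_, hrep.1, fun φ => ?_⟩
  rw [← hrep.2 φ]
  -- Integrate the difference formula against `η`.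
  have hint : ∀ j : ℕ, Integrable (fun h => η h * T (φ.translate ((j : ℝ) • h))) volume := by
    intro j
    obtain ⟨_, -, h⟩ := Distribution.exists_average φ (μ := volume)
      (a := fun h : RN N => (j : ℝ) • h) (by fun_prop) hη (R := j * ρ) (ae_of_all _ fun h hh => by
        rw [norm_smul, Real.norm_of_nonneg (Nat.cast_nonneg j)]
        exact mul_le_mul_of_nonneg_left (by simpa using hρ hh) (Nat.cast_nonneg j))
    exact (h T).1
  have hint' : ∀ α, Integrable (fun q : RN N × ℝ => w α q * distDeriv α T (φ.translate (q.2 • q.1)))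
      ((volume : Measure (RN N)).prod (uniformSum k)) := by
    intro α
    obtain ⟨_, -, h⟩ := Distribution.exists_average φ ha (hwi α) (hb α)
    exact (h (distDeriv α T)).1
  have hmain : ∑ j ∈ Finset.range (k + 1), (-1 : ℝ) ^ (j + k) * (k.choose j : ℝ) *
      ∫ h, η h * T (φ.translate ((j : ℝ) • h)) ∂volume =
      ∑ α ∈ multiIndices N k, (Nat.multinomial Finset.univ α : ℝ) *
        ∫ q, w α q * distDeriv α T (φ.translate (q.2 • q.1))
          ∂((volume : Measure (RN N)).prod (uniformSum k)) := by
    calc _ = ∫ h, η h * ∑ j ∈ Finset.range (k + 1), (-1 : ℝ) ^ (j + k) * (k.choose j : ℝ) *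
          T (φ.translate ((j : ℝ) • h)) ∂volume := by
          simp only [Finset.mul_sum, ← integral_const_mul]
          rw [← integral_finsetSum _ fun j _ => (hint j).const_mul _]
          refine integral_congr_ae (ae_of_all _ fun h => Finset.sum_congr rfl fun j _ => ?_)
          ring
      _ = ∫ h, ∫ σ, ∑ α ∈ multiIndices N k, (Nat.multinomial Finset.univ α : ℝ) *
          (w α (h, σ) * distDeriv α T (φ.translate (σ • h))) ∂uniformSum k ∂volume := by
          refine integral_congr_ae (ae_of_all _ fun h => ?_)
          dsimp only
          rw [Distribution.sum_translate_eq_integral, ← integral_const_mul]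
          refine integral_congr_ae (ae_of_all _ fun σ => ?_)
          dsimp only
          rw [lineDerivOp_iterate_eq_sum]
          simp only [hw]
          have : (∑ α ∈ multiIndices N k, ((Nat.multinomial Finset.univ α : ℝ) *
              ∏ i, h i ^ α i) • distDeriv α T) (φ.translate (σ • h)) =
              ∑ α ∈ multiIndices N k, ((Nat.multinomial Finset.univ α : ℝ) *
              ∏ i, h i ^ α i) * distDeriv α T (φ.translate (σ • h)) := by simp
          rw [this, Finset.mul_sum]
          refine Finset.sum_congr rfl fun α _ => ?_
          ring
      _ = _ := by
          simp only [← integral_const_mul]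
          rw [← integral_finsetSum _ fun α _ => (hint' α).const_mul _, integral_prod]
          exact integrable_finsetSum _ fun α _ => (hint' α).const_mul _
  rw [Finset.sum_range_succ'] at hmain
  have h0 : ∫ h, η h * T (φ.translate (((0 : ℕ) : ℝ) • h)) ∂volume = T φ := by
    have : ∀ h : RN N, φ.translate (((0 : ℕ) : ℝ) • h) = φ := fun h => by ext x; simp
    simp only [this]
    rw [integral_mul_const, hη1, one_mul]
  rw [h0] at hmain
  dsimp only
  rw [← hmain]
  have hs : (-1 : ℝ) ^ k * (-1 : ℝ) ^ k = 1 := by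
    rw [← mul_pow]; simp
  simp only [zero_add, Nat.choose_zero_right, Nat.cast_one, mul_one, add_sub_cancel_left]
  rw [← mul_assoc, hs, one_mul]

end

/-! ### Polar coordinates and forms on the sphere -/

noncomputable section

variable {N : ℕ}

theorem multiIndices_prod_smul {k : ℕ} {α : Fin N → ℕ} (hα : α ∈ multiIndices N k) (r : ℝ)
    (u : RN N) : ∏ i, (r • u) i ^ α i = r ^ k * ∏ i, u i ^ α i := by
  have h : ∑ i, α i = k := (Finset.mem_piAntidiag.1 hα).1
  simp only [PiLp.smul_apply, smul_eq_mul, mul_pow, Finset.prod_mul_distrib,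
    Finset.prod_pow_eq_pow_sum, h]

/-- The `k`-th directional derivative is homogeneous of degree `k` in the direction. -/
theorem dirDeriv_smul (k : ℕ) (g : (Fin N → ℕ) → RN N → ℝ) (r : ℝ) (u x : RN N) :
    dirDeriv k g (r • u) x = r ^ k * dirDeriv k g u x := by
  rw [dirDeriv, dirDeriv, Finset.mul_sum]
  refine Finset.sum_congr rfl fun α hα => ?_
  rw [multiIndices_prod_smul hα]
  ring

theorem continuous_dirDeriv (k : ℕ) (g : (Fin N → ℕ) → RN N → ℝ) (x : RN N) :
    Continuous fun u => dirDeriv k g u x := by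
  unfold dirDeriv
  fun_prop

/-- Integration in polar coordinates over the unit ball of a positively homogeneous function. -/
theorem lintegral_closedBall_eq_toSphere (hN : 1 ≤ N) {F : RN N → ℝ≥0∞} (hF : Measurable F) {d : ℝ}
    (hd : 0 ≤ d) (hom : ∀ r : ℝ, 0 < r → ∀ u, F (r • u) = ENNReal.ofReal (r ^ d) * F u) :
    ∫⁻ u in Metric.closedBall (0 : RN N) 1, F u ∂volume = ENNReal.ofReal (1 / (d + N)) *
      ∫⁻ ω : Metric.sphere (0 : RN N) 1, F ω ∂(volume : Measure (RN N)).toSphere := by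
  have : Nontrivial (RN N) := by
    have : Nonempty (Fin N) := ⟨⟨0, hN⟩⟩
    infer_instance
  have hdim : Module.finrank ℝ (RN N) = N := by simp
  -- The radial factor is `∫_0^1 r^(d + N - 1) dr`.
  have hrad : ∫⁻ r : Ioi (0 : ℝ), (Iic (1 : ℝ)).indicator (fun r => ENNReal.ofReal (r ^ d)) r
      ∂Measure.volumeIoiPow (Module.finrank ℝ (RN N) - 1) = ENNReal.ofReal (1 / (d + N)) := by
    have hm : Measurable fun r : ℝ => (Iic (1 : ℝ)).indicator (fun r => ENNReal.ofReal (r ^ d)) r :=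
      Measurable.indicator (by fun_prop) measurableSet_Iic
    have hm' : Measurable fun r : Ioi (0 : ℝ) =>
        (Iic (1 : ℝ)).indicator (fun r => ENNReal.ofReal (r ^ d)) (r : ℝ) :=
      hm.comp measurable_subtype_coe
    rw [Measure.volumeIoiPow, lintegral_withDensity_eq_lintegral_mul _ (by fun_prop) hm']
    simp only [Pi.mul_apply]
    rw [lintegral_subtype_comap measurableSet_Ioi (fun r : ℝ => ENNReal.ofReal
      (r ^ (Module.finrank ℝ (RN N) - 1)) *
        (Iic (1 : ℝ)).indicator (fun r => ENNReal.ofReal (r ^ d)) r)]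
    have e1 : ∀ r ∈ Ioi (0 : ℝ), ENNReal.ofReal (r ^ (Module.finrank ℝ (RN N) - 1)) *
        (Iic (1 : ℝ)).indicator (fun r => ENNReal.ofReal (r ^ d)) r =
        (Iic (1 : ℝ)).indicator (fun r => ENNReal.ofReal (r ^ (d + N - 1))) r := by
      intro r hr
      by_cases h1 : r ∈ Iic (1 : ℝ)
      · rw [indicator_of_mem h1, indicator_of_mem h1,
          ← ENNReal.ofReal_mul (pow_nonneg (le_of_lt hr) _), ← Real.rpow_natCast,
          ← Real.rpow_add hr, hdim, Nat.cast_sub hN]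
        congr 2
        push_cast
        ring
      · simp [h1]
    have hN' : (1 : ℝ) ≤ N := by exact_mod_cast hN
    rw [setLIntegral_congr_fun measurableSet_Ioi e1, lintegral_indicator measurableSet_Iic,
      Measure.restrict_restrict measurableSet_Iic, Iic_inter_Ioi,
      ← ofReal_integral_eq_lintegral_ofReal, ← intervalIntegral.integral_of_le zero_le_one,
      integral_rpow (Or.inl (by linarith))]
    · rw [sub_add_cancel, Real.one_rpow, Real.zero_rpow (by linarith), sub_zero]
    · exact (intervalIntegrable_iff_integrableOn_Ioc_of_le zero_le_one).1
        (intervalIntegral.intervalIntegrable_rpow' (by linarith))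
    · filter_upwards [ae_restrict_mem measurableSet_Ioc] with r hr
      exact Real.rpow_nonneg hr.1.le _
  set F' : RN N → ℝ≥0∞ := (Metric.closedBall (0 : RN N) 1).indicator F with hF'
  have hF'm : Measurable F' := hF.indicator measurableSet_closedBall
  calc ∫⁻ u in Metric.closedBall (0 : RN N) 1, F u ∂volume = ∫⁻ u, F' u ∂volume := by
        rw [lintegral_indicator measurableSet_closedBall]
    _ = ∫⁻ u : ({(0 : RN N)}ᶜ : Set (RN N)), F' u ∂(volume.comap Subtype.val) := by
        rw [lintegral_subtype_comap (measurableSet_singleton _).compl, restrict_compl_singleton]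
    _ = ∫⁻ q : Metric.sphere (0 : RN N) 1 × Ioi (0 : ℝ),
          F' ((homeomorphUnitSphereProd (RN N)).symm q : RN N)
          ∂((volume : Measure (RN N)).toSphere.prod
            (Measure.volumeIoiPow (Module.finrank ℝ (RN N) - 1))) := by
        rw [← (volume : Measure (RN N)).measurePreserving_homeomorphUnitSphereProd.lintegral_comp_emb
          (Homeomorph.measurableEmbedding _)]
        simp
    _ = ∫⁻ q : Metric.sphere (0 : RN N) 1 × Ioi (0 : ℝ), F q.1 *
          (Iic (1 : ℝ)).indicator (fun r => ENNReal.ofReal (r ^ d)) q.2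
          ∂((volume : Measure (RN N)).toSphere.prod
            (Measure.volumeIoiPow (Module.finrank ℝ (RN N) - 1))) := by
        refine lintegral_congr fun q => ?_
        rw [homeomorphUnitSphereProd_symm_apply_coe]
        have hq : 0 < (q.2 : ℝ) := q.2.2
        have hn : ‖(q.2 : ℝ) • (q.1 : RN N)‖ = q.2 := by
          rw [norm_smul, Real.norm_of_nonneg hq.le, mem_sphere_zero_iff_norm.1 q.1.2, mul_one]
        by_cases h1 : (q.2 : ℝ) ∈ Iic (1 : ℝ)
        · rw [hF', indicator_of_mem (by rwa [mem_closedBall_zero_iff, hn]), hom _ hq,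
            indicator_of_mem h1, mul_comm]
        · rw [hF', indicator_of_notMem (by rwa [mem_closedBall_zero_iff, hn]),
            indicator_of_notMem h1, mul_zero]
    _ = _ := by
        have hm : Measurable fun r : ℝ =>
            (Iic (1 : ℝ)).indicator (fun r => ENNReal.ofReal (r ^ d)) r :=
          Measurable.indicator (by fun_prop) measurableSet_Iic
        rw [lintegral_prod_mul (f := fun ω : Metric.sphere (0 : RN N) 1 => F ω)
          (g := fun r : Ioi (0 : ℝ) =>
            (Iic (1 : ℝ)).indicator (fun r => ENNReal.ofReal (r ^ d)) (r : ℝ))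
          (hF.comp measurable_subtype_coe).aemeasurable
          (hm.comp measurable_subtype_coe).aemeasurable, hrad, mul_comm]

/-- The integrand of `sphereDeriv` integrated over the ball rather than over the sphere. -/
theorem lintegral_closedBall_dirDeriv (hN : 1 ≤ N) (k : ℕ) {p : ℝ} (hp : 0 < p)
    (g : (Fin N → ℕ) → RN N → ℝ) (x : RN N) :
    (∫⁻ u in Metric.closedBall (0 : RN N) 1, ‖dirDeriv k g u x‖ₑ ^ p ∂volume) ^ (1 / p) =
      ENNReal.ofReal (1 / (k * p + N)) ^ (1 / p) * sphereDeriv k p g x := by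
  rw [lintegral_closedBall_eq_toSphere hN (d := k * p) _ (by positivity), sphereDeriv,
    ENNReal.mul_rpow_of_nonneg _ _ (by positivity)]
  · intro r hr u
    rw [dirDeriv_smul, enorm_mul, ENNReal.mul_rpow_of_nonneg _ _ hp.le,
      Real.enorm_of_nonneg (by positivity), ENNReal.ofReal_rpow_of_nonneg (by positivity) hp.le,
      ← Real.rpow_natCast, ← Real.rpow_mul hr.le]
  · exact ((continuous_dirDeriv k g x).measurable.enorm).pow_const p

/-- On the finite-dimensional space of coefficients `(v_α)_{|α| = k}`, the `L^p` (quasi-)norm over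
the sphere of the form `∑ (k! / α!) ω^α v_α` is comparable with the Euclidean length. It is
continuous, homogeneous, and vanishes at `v = 0` only, since a form vanishing on the sphere vanishes
identically. -/
theorem exists_sphereDeriv_equiv_gradLength (hN : 1 ≤ N) (k : ℕ) {p : ℝ} (hp : 0 < p) :
    ∃ c C : ℝ≥0, 0 < c ∧ ∀ (g : (Fin N → ℕ) → RN N → ℝ) (x : RN N),
      c * gradLength k g x ≤ sphereDeriv k p g x ∧
        sphereDeriv k p g x ≤ C * gradLength k g x := by
  let V := EuclideanSpace ℝ (multiIndices N k)
  let P : V → RN N → ℝ := fun v ω => ∑ α : multiIndices N k,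
    (Nat.multinomial Finset.univ α.1 : ℝ) * (∏ i, ω i ^ α.1 i) * v α
  have hPc : Continuous fun q : V × Metric.sphere (0 : RN N) 1 => P q.1 q.2 := by
    refine continuous_finsetSum _ fun α _ => ?_
    have h1 : Continuous fun q : V × Metric.sphere (0 : RN N) 1 => q.1 α :=
      (EuclideanSpace.proj (𝕜 := ℝ) α).continuous.comp continuous_fst
    have h2 : Continuous fun q : V × Metric.sphere (0 : RN N) 1 => ∏ i, (q.2 : RN N) i ^ α.1 i := by
      fun_prop
    exact (continuous_const.mul h2).mul h1
  have hPsmul : ∀ (t : ℝ) v ω, P (t • v) ω = t * P v ω := by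
    intro t v ω
    simp only [P, Finset.mul_sum]
    refine Finset.sum_congr rfl fun α _ => ?_
    rw [PiLp.smul_apply, smul_eq_mul]
    ring
  have hPhom : ∀ (r : ℝ) v ω, P v (r • ω) = r ^ k * P v ω := by
    intro r v ω
    simp only [P, Finset.mul_sum]
    refine Finset.sum_congr rfl fun α _ => ?_
    rw [multiIndices_prod_smul α.2]
    ring
  have hP0 : ∀ v : V, (∀ ω : Metric.sphere (0 : RN N) 1, P v ω = 0) → v = 0 := by
    intro v hv
    have hall : ∀ x : RN N, P v x = 0 := by
      intro x
      obtain ⟨ω, hω⟩ : ∃ ω : Metric.sphere (0 : RN N) 1, x = ‖x‖ • (ω : RN N) := by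
        by_cases hx : x = 0
        · exact ⟨⟨EuclideanSpace.single ⟨0, hN⟩ 1, by simp⟩, by simp [hx]⟩
        · exact ⟨⟨‖x‖⁻¹ • x, by simp [norm_smul, hx]⟩, by simp [hx]⟩
      rw [hω, hPhom, hv, mul_zero]
    set Q : MvPolynomial (Fin N) ℝ := ∑ α : multiIndices N k,
      MvPolynomial.monomial (Finsupp.equivFunOnFinite.symm α.1)
        ((Nat.multinomial Finset.univ α.1 : ℝ) * v α) with hQ
    have hQ0 : Q = 0 := by
      refine MvPolynomial.funext fun x => ?_
      have h1 := hall (WithLp.toLp 2 x)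
      rw [map_zero, ← h1, hQ, map_sum]
      refine Finset.sum_congr rfl fun α _ => ?_
      rw [MvPolynomial.eval_monomial, Finsupp.prod_fintype _ _ (fun i => pow_zero _)]
      simp only [Finsupp.equivFunOnFinite_symm_apply_apply]
      ring
    ext β
    have h2 : MvPolynomial.coeff (Finsupp.equivFunOnFinite.symm β.1) Q =
        (Nat.multinomial Finset.univ β.1 : ℝ) * v β := by
      rw [hQ, MvPolynomial.coeff_sum, Finset.sum_eq_single β]
      · simp
      · intro α _ hαβ
        rw [MvPolynomial.coeff_monomial, if_neg]
        intro h
        exact hαβ (Subtype.ext (Finsupp.equivFunOnFinite.symm.injective h))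
      · simp
    rw [hQ0, MvPolynomial.coeff_zero] at h2
    have h3 : (Nat.multinomial Finset.univ β.1 : ℝ) ≠ 0 := by
      exact_mod_cast (Nat.multinomial_pos _ _).ne'
    simpa [h3] using h2.symm
  let σ : Measure (Metric.sphere (0 : RN N) 1) := (volume : Measure (RN N)).toSphere
  let q : V → ℝ := fun v => ∫ ω, |P v ω| ^ p ∂σ
  have hfc : ∀ v, Continuous fun ω : Metric.sphere (0 : RN N) 1 => |P v ω| ^ p := fun v =>
    ((hPc.comp (Continuous.prodMk_right v)).abs).rpow_const fun _ => Or.inr hp.le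
  have hq : Continuous q := by
    have := continuous_parametric_integral_of_continuous (μ := σ) (s := univ)
      (f := fun v ω => |P v ω| ^ p) (hPc.abs.rpow_const fun _ => Or.inr hp.le) isCompact_univ
    simpa only [Measure.restrict_univ] using this
  have hqsmul : ∀ (t : ℝ) v, 0 ≤ t → q (t • v) = t ^ p * q v := by
    intro t v ht
    simp only [q, hPsmul, abs_mul, abs_of_nonneg ht, Real.mul_rpow ht (abs_nonneg _)]
    rw [integral_const_mul]
  have hqpos : ∀ v, v ≠ 0 → 0 < q v := by
    intro v hv
    obtain ⟨ω, hω⟩ : ∃ ω : Metric.sphere (0 : RN N) 1, P v ω ≠ 0 := by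
      by_contra! h
      exact hv (hP0 v h)
    refine (hfc v).integral_pos_of_hasCompactSupport_nonneg_nonzero
      (HasCompactSupport.of_compactSpace _) (fun ω => Real.rpow_nonneg (abs_nonneg _) _) (x := ω) ?_
    exact (Real.rpow_pos_of_pos (abs_pos.2 hω) _).ne'
  obtain ⟨c, C, hc, hC, hcC⟩ : ∃ c C : ℝ, 0 < c ∧ 0 ≤ C ∧
      ∀ v ∈ Metric.sphere (0 : V) 1, c ≤ q v ∧ q v ≤ C := by
    rcases (Metric.sphere (0 : V) 1).eq_empty_or_nonempty with h | h
    · exact ⟨1, 0, one_pos, le_rfl, fun v hv => by simp [h] at hv⟩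
    obtain ⟨v₁, hv₁, h₁⟩ := (isCompact_sphere (0 : V) 1).exists_isMinOn h hq.continuousOn
    obtain ⟨v₂, hv₂, h₂⟩ := (isCompact_sphere (0 : V) 1).exists_isMaxOn h hq.continuousOn
    refine ⟨q v₁, q v₂, hqpos _ (ne_zero_of_mem_unit_sphere ⟨v₁, hv₁⟩),
      integral_nonneg fun ω => Real.rpow_nonneg (abs_nonneg _) _, fun v hv => ⟨h₁ hv, h₂ hv⟩⟩
  have hall : ∀ v, ‖v‖ ^ p * c ≤ q v ∧ q v ≤ ‖v‖ ^ p * C := by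
    intro v
    by_cases hv : v = 0
    · have : q v = 0 := by
        have := hqsmul 0 v le_rfl
        rwa [zero_smul, Real.zero_rpow hp.ne', zero_mul, ← hv] at this
      rw [this, hv, norm_zero, Real.zero_rpow hp.ne']
      simp
    have h1 := hcC (‖v‖⁻¹ • v) (by
      rw [mem_sphere_zero_iff_norm, norm_smul, norm_inv, norm_norm,
        inv_mul_cancel₀ (norm_ne_zero_iff.2 hv)])
    have h2 := hqsmul ‖v‖ (‖v‖⁻¹ • v) (norm_nonneg _)
    rw [smul_smul, mul_inv_cancel₀ (norm_ne_zero_iff.2 hv), one_smul] at h2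
    rw [h2]
    exact ⟨mul_le_mul_of_nonneg_left h1.1 (by positivity),
      mul_le_mul_of_nonneg_left h1.2 (by positivity)⟩
  refine ⟨(c ^ (1 / p)).toNNReal, (C ^ (1 / p)).toNNReal,
    Real.toNNReal_pos.2 (Real.rpow_pos_of_pos hc _), fun g x => ?_⟩
  set v : V := WithLp.toLp 2 fun α => g α.1 x with hv
  have hgrad : gradLength k g x = ENNReal.ofReal ‖v‖ := by
    rw [gradLength, EuclideanSpace.norm_eq, ← Finset.sum_coe_sort]
    simp [hv]
  have hP : ∀ ω, dirDeriv k g ω x = P v ω := by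
    intro ω
    rw [dirDeriv, ← Finset.sum_coe_sort]
  have hsph : sphereDeriv k p g x = ENNReal.ofReal (q v ^ (1 / p)) := by
    have hqn : 0 ≤ q v := integral_nonneg fun ω => Real.rpow_nonneg (abs_nonneg _) _
    rw [sphereDeriv, ← ENNReal.ofReal_rpow_of_nonneg hqn (by positivity),
      ofReal_integral_eq_lintegral_ofReal]
    · congr 1
      refine lintegral_congr fun ω => ?_
      rw [hP, Real.enorm_eq_ofReal_abs, ENNReal.ofReal_rpow_of_nonneg (abs_nonneg _) hp.le]
    · exact (hfc v).integrable_of_hasCompactSupport (HasCompactSupport.of_compactSpace _)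
    · exact ae_of_all _ fun ω => Real.rpow_nonneg (abs_nonneg _) _
  have hroot : ∀ b : ℝ, 0 ≤ b → (‖v‖ ^ p * b) ^ (1 / p) = b ^ (1 / p) * ‖v‖ := by
    intro b hb
    rw [Real.mul_rpow (by positivity) hb, ← Real.rpow_mul (norm_nonneg _),
      mul_one_div_cancel hp.ne', Real.rpow_one, mul_comm]
  have hmul : ∀ b : ℝ, 0 ≤ b → ((b ^ (1 / p)).toNNReal : ℝ≥0∞) * ENNReal.ofReal ‖v‖ =
      ENNReal.ofReal ((‖v‖ ^ p * b) ^ (1 / p)) := by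
    intro b hb
    rw [hroot b hb, ENNReal.ofReal_mul (by positivity)]
    rfl
  rw [hgrad, hsph, hmul c hc.le, hmul C hC]
  have h0 : 0 ≤ ‖v‖ ^ p * c := by positivity
  exact ⟨ENNReal.ofReal_le_ofReal (Real.rpow_le_rpow h0 (hall v).1 (by positivity)),
    ENNReal.ofReal_le_ofReal (Real.rpow_le_rpow (h0.trans (hall v).1) (hall v).2 (by positivity))⟩

end

/-! ### Almost-triangle inequalities and approximate identities -/

noncomputable section

/-- A substitute for the triangle inequality that is valid for every exponent `q > 0` and has a
constant arbitrarily close to `1` in front of the main term. -/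
theorem ENNReal.exists_add_rpow_le {q : ℝ} (hq : 0 < q) {κ : ℝ≥0} (hκ : 1 < κ) :
    ∃ C : ℝ≥0, ∀ a b : ℝ≥0∞, (a + b) ^ q ≤ κ * a ^ q + C * b ^ q := by
  obtain ⟨δ, hδ, hδκ⟩ : ∃ δ : ℝ≥0, 0 < δ ∧ (1 + δ) ^ q ≤ κ := by
    have h1 : Tendsto (fun δ : ℝ≥0 => (1 + δ) ^ q) (𝓝[>] 0) (𝓝 1) := by
      have h : Continuous fun δ : ℝ≥0 => (1 + δ) ^ q :=
        (NNReal.continuous_rpow_const hq.le).comp (by fun_prop)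
      simpa using (h.tendsto 0).mono_left nhdsWithin_le_nhds
    obtain ⟨δ, h2, h3⟩ := ((h1.eventually (ge_mem_nhds hκ)).and self_mem_nhdsWithin).exists
    exact ⟨δ, h3, h2⟩
  refine ⟨(δ⁻¹ + 1) ^ q, fun a b => ?_⟩
  have hscale : ∀ (c : ℝ≥0) (y : ℝ≥0∞), ((c : ℝ≥0∞) * y) ^ q = ((c ^ q : ℝ≥0) : ℝ≥0∞) * y ^ q := by
    intro c y
    rw [ENNReal.mul_rpow_of_nonneg _ _ hq.le, ENNReal.coe_rpow_of_nonneg _ hq.le]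
  -- Either `b` is a small multiple of `a`, or `a` is bounded by a multiple of `b`.
  rcases le_total b (δ * a) with h | h
  · refine le_trans ?_ le_self_add
    calc (a + b) ^ q ≤ (((1 + δ : ℝ≥0) : ℝ≥0∞) * a) ^ q := by
          refine ENNReal.rpow_le_rpow ?_ hq.le
          rw [ENNReal.coe_add, ENNReal.coe_one, add_mul, one_mul]
          gcongr
      _ = (((1 + δ) ^ q : ℝ≥0) : ℝ≥0∞) * a ^ q := hscale _ _
      _ ≤ κ * a ^ q := by gcongr
  · refine le_trans ?_ le_add_self
    have ha : a ≤ ((δ⁻¹ : ℝ≥0) : ℝ≥0∞) * b := by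
      calc a = ((δ⁻¹ : ℝ≥0) : ℝ≥0∞) * (δ * a) := by
            rw [← mul_assoc, ← ENNReal.coe_mul, inv_mul_cancel₀ hδ.ne', ENNReal.coe_one, one_mul]
        _ ≤ _ := by gcongr
    calc (a + b) ^ q ≤ (((δ⁻¹ + 1 : ℝ≥0) : ℝ≥0∞) * b) ^ q := by
          refine ENNReal.rpow_le_rpow ?_ hq.le
          rw [ENNReal.coe_add, ENNReal.coe_one, add_mul, one_mul]
          gcongr
      _ = _ := hscale _ _

/-- The almost-triangle inequality for the quasi-norm of `L^p`, `p > 0`. -/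
theorem exists_lintegral_rpow_le {p : ℝ} (hp : 0 < p) {κ : ℝ≥0} (hκ : 1 < κ) :
    ∃ C : ℝ≥0, ∀ {A : Type} [MeasurableSpace A] (μ : Measure A) (a b c : A → ℝ≥0∞),
      Measurable a → Measurable b → (∀ s, c s ≤ a s + b s) →
      (∫⁻ s, c s ^ p ∂μ) ^ (1 / p) ≤
        κ * (∫⁻ s, a s ^ p ∂μ) ^ (1 / p) + C * (∫⁻ s, b s ^ p ∂μ) ^ (1 / p) := by
  have hq : 0 < 1 / p := by positivity
  obtain ⟨κ₁, h1, hκ₁⟩ : ∃ κ₁ : ℝ≥0, 1 < κ₁ ∧ κ₁ * κ₁ ^ (1 / p) ≤ κ := by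
    have h1 : Tendsto (fun δ : ℝ≥0 => δ * δ ^ (1 / p)) (𝓝[>] 1) (𝓝 1) := by
      have h : Continuous fun δ : ℝ≥0 => δ * δ ^ (1 / p) :=
        continuous_id.mul (NNReal.continuous_rpow_const hq.le)
      simpa using (h.tendsto 1).mono_left nhdsWithin_le_nhds
    obtain ⟨δ, h2, h3⟩ := ((h1.eventually (ge_mem_nhds hκ)).and self_mem_nhdsWithin).exists
    exact ⟨δ, h3, h2⟩
  obtain ⟨C₁, hC₁⟩ := ENNReal.exists_add_rpow_le hp h1
  obtain ⟨C₂, hC₂⟩ := ENNReal.exists_add_rpow_le hq h1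
  have hscale : ∀ (c : ℝ≥0) (y : ℝ≥0∞), ((c : ℝ≥0∞) * y) ^ (1 / p) =
      ((c ^ (1 / p) : ℝ≥0) : ℝ≥0∞) * y ^ (1 / p) := by
    intro c y
    rw [ENNReal.mul_rpow_of_nonneg _ _ hq.le, ENNReal.coe_rpow_of_nonneg _ hq.le]
  refine ⟨C₂ * C₁ ^ (1 / p), fun μ a b c ha hb hc => ?_⟩
  have h2 : ∫⁻ s, c s ^ p ∂μ ≤ κ₁ * ∫⁻ s, a s ^ p ∂μ + C₁ * ∫⁻ s, b s ^ p ∂μ := by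
    rw [← lintegral_const_mul _ (ha.pow_const p), ← lintegral_const_mul _ (hb.pow_const p),
      ← lintegral_add_left ((ha.pow_const p).const_mul _)]
    exact lintegral_mono fun s => (ENNReal.rpow_le_rpow (hc s) hp.le).trans (hC₁ _ _)
  refine ((ENNReal.rpow_le_rpow h2 hq.le).trans (hC₂ _ _)).trans ?_
  rw [hscale, hscale, ← mul_assoc, ← mul_assoc, ← ENNReal.coe_mul, ← ENNReal.coe_mul]
  gcongr

theorem ENNReal.tendsto_of_forall_le_mul_add {ι : Type*} {l : Filter ι} {a d : ι → ℝ≥0∞}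
    {a₀ : ℝ≥0∞} (ha₀ : a₀ ≠ ∞) (hd : Tendsto d l (𝓝 0))
    (h : ∀ κ : ℝ≥0, 1 < κ → ∃ C : ℝ≥0, ∀ i, a i ≤ κ * a₀ + C * d i ∧ a₀ ≤ κ * a i + C * d i) :
    Tendsto a l (𝓝 a₀) := by
  have hκ : ∀ b : ℝ≥0∞, b ≠ ∞ →
      Tendsto (fun κ : ℝ≥0 => (κ : ℝ≥0∞) * b) (𝓝[>] 1) (𝓝 b) := by
    intro b hb
    have h1 : Tendsto (fun κ : ℝ≥0 => (κ : ℝ≥0∞)) (𝓝[>] 1) (𝓝 ((1 : ℝ≥0) : ℝ≥0∞)) :=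
      (ENNReal.continuous_coe.tendsto 1).mono_left nhdsWithin_le_nhds
    simpa using ENNReal.Tendsto.mul_const h1 (Or.inr hb)
  have hlim : ∀ (C : ℝ≥0) (b : ℝ≥0∞), Tendsto (fun i => b + C * d i) l (𝓝 b) := by
    intro C b
    have h1 := ENNReal.Tendsto.const_mul hd (a := (C : ℝ≥0∞)) (Or.inr ENNReal.coe_ne_top)
    simpa using tendsto_const_nhds.add h1
  refine tendsto_order.2 ⟨fun b hb => ?_, fun b hb => ?_⟩
  · obtain ⟨κ, hκb, hκ1⟩ := (((hκ b hb.ne_top).eventually (gt_mem_nhds hb)).and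
      self_mem_nhdsWithin).exists
    obtain ⟨C, hC⟩ := h κ hκ1
    filter_upwards [(hlim C (κ * b)).eventually (gt_mem_nhds hκb)] with i hi
    by_contra! hab
    refine absurd ((hC i).2.trans ?_) (not_le.2 hi)
    gcongr
  · obtain ⟨κ, hκb, hκ1⟩ := (((hκ a₀ ha₀).eventually (gt_mem_nhds hb)).and
      self_mem_nhdsWithin).exists
    obtain ⟨C, hC⟩ := h κ hκ1
    filter_upwards [(hlim C (κ * a₀)).eventually (gt_mem_nhds hκb)] with i hi
    exact (hC i).1.trans_lt hi

/-- A concentrating family acts as an approximate identity at `0+`, on bounded functions, measurable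
or not. -/
theorem IsConcentrating.tendsto_lintegral {ρ : ℝ → ℝ → ℝ} (hρ : IsConcentrating ρ)
    {φ : ℝ → ℝ≥0∞} {M L : ℝ≥0∞} (hM : M ≠ ∞) (hφ : ∀ t, 0 < t → φ t ≤ M)
    (h : Tendsto φ (𝓝[>] 0) (𝓝 L)) :
    Tendsto (fun ε => ∫⁻ t in Ioi (0 : ℝ), φ t * ENNReal.ofReal (ρ ε t)) (𝓝[>] 0) (𝓝 L) := by
  have hnear : ∀ P : ℝ → Prop, (∀ᶠ t in 𝓝[>] 0, P t) →
      ∃ a, 0 < a ∧ a < 1 ∧ ∀ t ∈ Ioo 0 a, P t := by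
    intro P hP
    obtain ⟨u, hu, hu'⟩ := mem_nhdsGT_iff_exists_Ioo_subset.1 hP
    refine ⟨min u (1 / 2), lt_min hu (by norm_num), (min_le_right _ _).trans_lt (by norm_num),
      fun t ht => hu' ⟨ht.1, ht.2.trans_le (min_le_left _ _)⟩⟩
  refine tendsto_order.2 ⟨fun b hb => ?_, fun b hb => ?_⟩
  · obtain ⟨b', hb1, hb2⟩ := exists_between hb
    obtain ⟨a, ha0, ha1, ha⟩ := hnear _ (h.eventually (lt_mem_nhds hb2))
    have h1 := ENNReal.Tendsto.const_mul (hρ.tendsto a ha0 ha1) (a := b') (Or.inr hb2.ne_top)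
    rw [mul_one] at h1
    filter_upwards [h1.eventually (lt_mem_nhds hb1)] with ε hε
    refine hε.trans_le ?_
    calc b' * ∫⁻ t in Ioo 0 a, ENNReal.ofReal (ρ ε t)
        ≤ ∫⁻ t in Ioo 0 a, b' * ENNReal.ofReal (ρ ε t) := lintegral_const_mul_le _ _
      _ ≤ ∫⁻ t in Ioo 0 a, φ t * ENNReal.ofReal (ρ ε t) :=
          setLIntegral_mono' measurableSet_Ioo fun t ht => by gcongr; exact (ha t ht).le
      _ ≤ _ := lintegral_mono_set Ioo_subset_Ioi_self
  · obtain ⟨b', hb1, hb2⟩ := exists_between hb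
    obtain ⟨a, ha0, ha1, ha⟩ := hnear _ (h.eventually (gt_mem_nhds hb1))
    -- On `(0, a)` the function is at most `b'`, and the mass of `ρ ε` on `[a, ∞)` tends to `0`.
    have hsplit : ∀ F : ℝ → ℝ≥0∞, ∫⁻ t in Ioi 0, F t =
        (∫⁻ t in Ioo 0 a, F t) + ∫⁻ t in Ici a, F t := by
      intro F
      rw [← lintegral_union measurableSet_Ici, Ioo_union_Ici_eq_Ioi ha0]
      exact Set.disjoint_left.2 fun t ht ht' => (not_le.2 ht.2) ht'
    have htail : ∀ ε, 0 < ε → ∫⁻ t in Ici a, ENNReal.ofReal (ρ ε t) =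
        1 - ∫⁻ t in Ioo 0 a, ENNReal.ofReal (ρ ε t) := by
      intro ε hε
      have h1 := hρ.lintegral_eq_one ε hε
      rw [hsplit] at h1
      refine ENNReal.eq_sub_of_add_eq' ENNReal.one_ne_top ?_
      rw [add_comm, h1]
    have h1 := ENNReal.Tendsto.const_mul (hρ.tendsto a ha0 ha1) (a := b') (Or.inr hb2.ne_top)
    have h2 := ENNReal.Tendsto.const_mul
      (ENNReal.Tendsto.sub tendsto_const_nhds (hρ.tendsto a ha0 ha1) (a := 1)
        (Or.inl ENNReal.one_ne_top)) (a := M) (Or.inr hM)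
    have h3 := h1.add h2
    rw [tsub_self, mul_one, mul_zero, add_zero] at h3
    filter_upwards [h3.eventually (gt_mem_nhds hb2), self_mem_nhdsWithin] with ε hε hε0
    refine lt_of_le_of_lt ?_ hε
    have hae : AEMeasurable (fun t => ENNReal.ofReal (ρ ε t)) (volume.restrict (Ioi 0)) :=
      (hρ.aemeasurable ε hε0).ennreal_ofReal
    rw [hsplit, ← htail ε hε0, ← lintegral_const_mul'' _
      (hae.mono_measure (Measure.restrict_mono Ioo_subset_Ioi_self le_rfl)),
      ← lintegral_const_mul'' _
      (hae.mono_measure (Measure.restrict_mono (Ici_subset_Ioi.2 ha0) le_rfl))]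
    refine add_le_add (setLIntegral_mono' measurableSet_Ioo fun t ht => ?_)
      (setLIntegral_mono' measurableSet_Ici fun t ht => ?_)
    · gcongr
      exact (ha t ht).le
    · gcongr
      exact hφ t (ha0.trans_le ht)

namespace BanachFunctionNorm

variable {N : ℕ} (X : BanachFunctionNorm N)

theorem toFun_finset_sum_le {ι : Type*} (s : Finset ι) {f : ι → RN N → ℝ≥0∞}
    (hf : ∀ i ∈ s, Measurable (f i)) :
    X.toFun (fun x => ∑ i ∈ s, f i x) ≤ ∑ i ∈ s, X.toFun (f i) := by
  classical
  induction s using Finset.induction_on with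
  | empty => simpa using X.toFun_zero.le
  | insert i s hi ih =>
    simp only [Finset.sum_insert hi]
    have hs : ∀ j ∈ s, Measurable (f j) := fun j hj => hf j (Finset.mem_insert_of_mem hj)
    refine (X.add_le _ _ (hf i (Finset.mem_insert_self i s)).aemeasurable
      (Finset.measurable_fun_sum s hs).aemeasurable).trans ?_
    gcongr
    exact ih hs

theorem ae_lt_top {f : RN N → ℝ≥0∞} (hf : AEMeasurable f volume) (h : X.toFun f < ∞) :
    ∀ᵐ x, f x < ∞ := by
  refine ae_of_forall_measure_lt_top_ae_restrict _ fun s hs hs' => ?_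
  obtain ⟨C, hC⟩ := X.setLIntegral_le s hs hs'
  exact ae_lt_top' hf.restrict ((hC f hf).trans_lt (ENNReal.mul_lt_top ENNReal.coe_lt_top h)).ne

theorem toFun_enorm_integral_le {A : Type*} [MeasurableSpace A] {ν : Measure A} [SFinite ν]
    {Φ : RN N → A → ℝ} (hΦ : Measurable (Function.uncurry Φ)) :
    X.toFun (fun x => ‖∫ s, Φ x s ∂ν‖ₑ) ≤ ∫⁻ s, X.toFun (fun x => ‖Φ x s‖ₑ) ∂ν := by
  refine le_trans ?_ (X.lintegral_le (F := fun x s => ‖Φ x s‖ₑ) hΦ.enorm.aemeasurable)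
  refine X.mono _ _ ?_ ?_ (ae_of_all _ fun x => enorm_integral_le_lintegral_enorm _)
  · exact (hΦ.stronglyMeasurable.integral_prod_right (ν := ν)).measurable.enorm.aemeasurable
  · exact (hΦ.enorm.lintegral_prod_right' (ν := ν)).aemeasurable

/-- Minkowski's inequality for functions on the unit ball whose norms in `X` are bounded. -/
theorem SatisfiesMinkowski.exists_le {X : BanachFunctionNorm N} {p : ℝ} (hX : X.SatisfiesMinkowski p)
    (hp : 0 < p) : ∃ C : ℝ≥0, ∀ (F : RN N → RN N → ℝ) (M : ℝ≥0∞),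
      Measurable (Function.uncurry F) →
      (∀ u ∈ Metric.closedBall (0 : RN N) 1, X.toFun (fun x => ‖F u x‖ₑ) ≤ M) →
      X.toFun (fun x => (∫⁻ u in Metric.closedBall (0 : RN N) 1, ‖F u x‖ₑ ^ p ∂volume) ^ (1 / p)) ≤
        C * M := by
  obtain ⟨C₀, hC₀⟩ := hX
  set B : Set (RN N) := Metric.closedBall 0 1 with hB
  have hBm : MeasurableSet B := measurableSet_closedBall
  have hBfin : volume B ≠ ∞ := measure_closedBall_lt_top.ne
  refine ⟨C₀ * (volume B).toNNReal ^ (1 / p), fun F M hF hM => ?_⟩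
  have h1 := hC₀ (fun q => B.indicator (fun u => F u q.2) q.1) ?_
  · have h2 : ∀ u, (fun x => ‖B.indicator (fun u => F u x) u‖ₑ ^ p) =
        fun x => B.indicator (fun u => ‖F u x‖ₑ ^ p) u := by
      intro u
      ext x
      by_cases hu : u ∈ B
      · simp [hu]
      · simp [hu, hp]
    have h3 : ∀ x u, ‖B.indicator (fun u => F u x) u‖ₑ ^ p = B.indicator (fun u => ‖F u x‖ₑ ^ p) u :=
      fun x u => congrFun (h2 u) x
    simp only [h3, lintegral_indicator hBm] at h1
    refine h1.trans ?_
    have h4 : ∀ u, X.toFun (fun x => ‖B.indicator (fun u => F u x) u‖ₑ) ^ p ≤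
        B.indicator (fun _ => M ^ p) u := by
      intro u
      by_cases hu : u ∈ B
      · simp only [indicator_of_mem hu]
        exact ENNReal.rpow_le_rpow (hM u hu) hp.le
      · simp [indicator_of_notMem hu, X.toFun_zero, hp]
    have h5 := ENNReal.rpow_le_rpow (lintegral_mono (μ := volume) h4) (z := 1 / p) (by positivity)
    rw [lintegral_indicator hBm, setLIntegral_const, ENNReal.mul_rpow_of_nonneg _ _ (by positivity),
      ← ENNReal.rpow_mul, mul_one_div_cancel hp.ne', ENNReal.rpow_one] at h5
    rw [ENNReal.coe_mul, ENNReal.coe_rpow_of_nonneg _ (by positivity : 0 ≤ 1 / p),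
      ENNReal.coe_toNNReal hBfin, mul_assoc, mul_comm (volume B ^ (1 / p))]
    gcongr
  · have : (fun q : RN N × RN N => B.indicator (fun u => F u q.2) q.1) =
        (Prod.fst ⁻¹' B).indicator (Function.uncurry F) := by
      ext q
      by_cases hq : q.1 ∈ B
      · simp [hq, indicator, Function.uncurry]
      · simp [hq, indicator]
    rw [this]
    exact (hF.indicator (measurable_fst hBm)).aemeasurable

end BanachFunctionNorm

end

/-! ### Averages of the directional derivatives -/

noncomputable section

variable {N : ℕ}

/-- The average of the `k`-th directional derivative in the direction `u` along the segment from `x`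
to `x + k r u`, with respect to the law of a sum of `k` independent uniform variables. If
`g α = ∂^α f` and `r > 0`, then it is `r⁻ᵏ` times the difference of order `k` of `f` with step `r u`,
almost everywhere. -/
def avgDeriv (k : ℕ) (g : (Fin N → ℕ) → RN N → ℝ) (r : ℝ) (u x : RN N) : ℝ :=
  ∫ σ, dirDeriv k g u (x + (σ * r) • u) ∂uniformSum k

/-- The `L^p` (quasi-)norm of `avgDeriv` in the direction variable, over the unit ball. -/
def ballAvg (k : ℕ) (p : ℝ) (g : (Fin N → ℕ) → RN N → ℝ) (r : ℝ) (x : RN N) : ℝ≥0∞ :=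
  (∫⁻ u in Metric.closedBall (0 : RN N) 1, ‖avgDeriv k g r u x‖ₑ ^ p ∂volume) ^ (1 / p)

section measurability

variable {k : ℕ} {g : (Fin N → ℕ) → RN N → ℝ} (hg : ∀ α ∈ multiIndices N k, Measurable (g α))

include hg

theorem measurable_dirDeriv : Measurable fun q : RN N × RN N => dirDeriv k g q.1 q.2 := by
  unfold dirDeriv
  refine Finset.measurable_fun_sum _ fun α hα => ?_
  have h1 : Measurable fun q : RN N × RN N => ∏ i, q.1 i ^ α i := by
    have : Continuous fun q : RN N × RN N => ∏ i, q.1 i ^ α i := by fun_prop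
    exact this.measurable
  exact (h1.const_mul _).mul ((hg α hα).comp measurable_snd)

theorem measurable_dirDeriv_right (u : RN N) : Measurable fun x => dirDeriv k g u x := by
  have h : Measurable fun x : RN N => (u, x) := measurable_prodMk_left
  have := (measurable_dirDeriv hg).comp h
  exact this

theorem measurable_dirDeriv_translate (r : ℝ) :
    Measurable fun q : (RN N × RN N) × ℝ => dirDeriv k g q.1.1 (q.1.2 + (q.2 * r) • q.1.1) := by
  have h : Measurable fun q : (RN N × RN N) × ℝ => (q.1.1, q.1.2 + (q.2 * r) • q.1.1) := by
    fun_prop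
  exact (measurable_dirDeriv hg).comp h

theorem measurable_dirDeriv_translate_right (r : ℝ) (u : RN N) :
    Measurable fun q : RN N × ℝ => dirDeriv k g u (q.1 + (q.2 * r) • u) := by
  have h : Measurable fun q : RN N × ℝ => ((u, q.1), q.2) := by fun_prop
  have := (measurable_dirDeriv_translate hg r).comp h
  exact this

theorem measurable_avgDeriv (r : ℝ) :
    Measurable fun q : RN N × RN N => avgDeriv k g r q.1 q.2 :=
  ((measurable_dirDeriv_translate hg r).stronglyMeasurable.integral_prod_right'
    (ν := uniformSum k)).measurable

theorem measurable_ballAvg (p r : ℝ) : Measurable (ballAvg k p g r) := by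
  have h : Measurable fun q : RN N × RN N => ‖avgDeriv k g r q.2 q.1‖ₑ ^ p :=
    ((measurable_avgDeriv hg r).comp measurable_swap).enorm.pow_const p
  exact (h.lintegral_prod_right' (ν := volume.restrict (Metric.closedBall (0 : RN N) 1))).pow_const _

variable {X : BanachFunctionNorm N}

theorem BanachFunctionNorm.toFun_dirDeriv_le {u : RN N} (hu : ‖u‖ ≤ 1) :
    X.toFun (fun x => ‖dirDeriv k g u x‖ₑ) ≤ ∑ α ∈ multiIndices N k,
      ((Nat.multinomial Finset.univ α : ℝ≥0) : ℝ≥0∞) * X.toFun (fun x => ‖g α x‖ₑ) := by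
  have hm : ∀ α ∈ multiIndices N k, Measurable fun x =>
      ((Nat.multinomial Finset.univ α : ℝ≥0) : ℝ≥0∞) * ‖g α x‖ₑ :=
    fun α hα => (hg α hα).enorm.const_mul _
  refine (X.mono _ _ ?_ (Finset.measurable_fun_sum _ hm).aemeasurable (ae_of_all _ fun x => ?_)).trans
    ((X.toFun_finset_sum_le _ hm).trans_eq ?_)
  · exact (measurable_dirDeriv_right hg u).enorm.aemeasurable
  · refine (enorm_sum_le _ _).trans (Finset.sum_le_sum fun α _ => ?_)
    rw [enorm_mul]
    gcongr
    rw [enorm_eq_nnnorm, ENNReal.coe_le_coe, ← NNReal.coe_le_coe, coe_nnnorm, norm_mul,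
      Real.norm_natCast, norm_prod]
    refine (mul_le_of_le_one_right (Nat.cast_nonneg _) ?_).trans_eq (by simp)
    refine Finset.prod_le_one (fun i _ => norm_nonneg _) fun i _ => ?_
    rw [norm_pow]
    exact pow_le_one₀ (norm_nonneg _) ((PiLp.norm_apply_le u i).trans hu)
  · exact Finset.sum_congr rfl fun α hα => X.const_mul _ _ (hg α hα).enorm.aemeasurable

theorem BanachFunctionNorm.lintegral_toFun_translate_dirDeriv
    (hX : X.IsRearrangementInvariant) (r : ℝ) (u : RN N) :
    ∫⁻ σ, X.toFun (fun x => ‖dirDeriv k g u (x + (σ * r) • u)‖ₑ) ∂uniformSum k =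
      X.toFun fun x => ‖dirDeriv k g u x‖ₑ := by
  have h : ∀ σ : ℝ, X.toFun (fun x => ‖dirDeriv k g u (x + (σ * r) • u)‖ₑ) =
      X.toFun fun x => ‖dirDeriv k g u x‖ₑ := fun σ =>
    hX.toFun_translate (measurable_dirDeriv_right hg u) _
  simp only [h, lintegral_const, measure_univ, mul_one]

theorem BanachFunctionNorm.toFun_avgDeriv_le (hX : X.IsRearrangementInvariant) (r : ℝ) (u : RN N) :
    X.toFun (fun x => ‖avgDeriv k g r u x‖ₑ) ≤ X.toFun fun x => ‖dirDeriv k g u x‖ₑ := by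
  refine (X.toFun_enorm_integral_le (ν := uniformSum k)
    (Φ := fun x σ => dirDeriv k g u (x + (σ * r) • u))
    (measurable_dirDeriv_translate_right hg r u)).trans_eq
    (lintegral_toFun_translate_dirDeriv hg hX r u)

theorem BanachFunctionNorm.toFun_avgDeriv_sub_le (hX : X.IsRearrangementInvariant) {r : ℝ} {u : RN N}
    (hfin : X.toFun (fun x => ‖dirDeriv k g u x‖ₑ) < ∞) {M : ℝ≥0∞}
    (hM : ∀ σ ∈ Icc (0 : ℝ) k,
      X.toFun (fun x => ‖dirDeriv k g u (x + (σ * r) • u) - dirDeriv k g u x‖ₑ) ≤ M) :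
    X.toFun (fun x => ‖avgDeriv k g r u x - dirDeriv k g u x‖ₑ) ≤ M := by
  have h0 := measurable_dirDeriv_translate_right hg r u
  have h1 := measurable_dirDeriv_right hg u
  have h2 : Measurable fun x => ∫⁻ σ, ‖dirDeriv k g u (x + (σ * r) • u)‖ₑ ∂uniformSum k :=
    h0.enorm.lintegral_prod_right'
  -- The average is an absolutely convergent integral for almost every base point.
  have hint : ∀ᵐ x, Integrable (fun σ => dirDeriv k g u (x + (σ * r) • u)) (uniformSum k) := by
    have h3 : X.toFun (fun x => ∫⁻ σ, ‖dirDeriv k g u (x + (σ * r) • u)‖ₑ ∂uniformSum k) < ∞ := by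
      refine lt_of_le_of_lt (X.lintegral_le (ν := uniformSum k)
        (F := fun x σ => ‖dirDeriv k g u (x + (σ * r) • u)‖ₑ) h0.enorm.aemeasurable) ?_
      rwa [lintegral_toFun_translate_dirDeriv hg hX r u]
    filter_upwards [X.ae_lt_top h2.aemeasurable h3] with x hx
    exact ⟨(h0.comp measurable_prodMk_left).aestronglyMeasurable, hx⟩
  have hae : (fun x => ‖∫ σ, (dirDeriv k g u (x + (σ * r) • u) - dirDeriv k g u x) ∂uniformSum k‖ₑ)
      =ᵐ[volume] fun x => ‖avgDeriv k g r u x - dirDeriv k g u x‖ₑ := by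
    filter_upwards [hint] with x hx
    rw [integral_sub hx (integrable_const _), integral_const, probReal_univ, one_smul, avgDeriv]
  have h4 : Measurable fun q : RN N × ℝ =>
      dirDeriv k g u (q.1 + (q.2 * r) • u) - dirDeriv k g u q.1 :=
    h0.sub (h1.comp measurable_fst)
  rw [← X.congr_ae (h4.stronglyMeasurable.integral_prod_right' (ν := uniformSum
    k)).measurable.enorm.aemeasurable hae]
  refine (X.toFun_enorm_integral_le (ν := uniformSum k)
    (Φ := fun x σ => dirDeriv k g u (x + (σ * r) • u) - dirDeriv k g u x) h4).trans ?_
  calc _ ≤ ∫⁻ _, M ∂uniformSum k := by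
        refine lintegral_mono_ae ?_
        filter_upwards [ae_mem_Icc_uniformSum k] with σ hσ
        exact hM σ hσ
    _ = M := by simp

/-- The (quasi-)norm in `X` of `ballAvg` is bounded in `r` and tends to its value for the
derivatives themselves as `r → 0+`. -/
theorem BanachFunctionNorm.tendsto_toFun_ballAvg (hX : X.IsRearrangementInvariant)
    (hac : X.HasAbsolutelyContinuousNorm) {p : ℝ} (hp : 0 < p) (hmin : X.SatisfiesMinkowski p)
    (hmem : ∀ α ∈ multiIndices N k, X.Mem (g α)) :
    (∃ M : ℝ≥0, ∀ r, X.toFun (ballAvg k p g r) ≤ M) ∧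
      X.toFun (ballAvg k p g 0) < ∞ ∧
      Tendsto (fun r => X.toFun (ballAvg k p g r)) (𝓝[>] 0) (𝓝 (X.toFun (ballAvg k p g 0))) := by
  obtain ⟨C, hC⟩ := hmin.exists_le hp
  set m : (Fin N → ℕ) → ℝ≥0∞ := fun α => ((Nat.multinomial Finset.univ α : ℝ≥0) : ℝ≥0∞) with hm
  set S : ℝ≥0∞ := ∑ α ∈ multiIndices N k, m α * X.toFun (fun x => ‖g α x‖ₑ) with hS
  have hSfin : S < ∞ :=
    ENNReal.sum_lt_top.2 fun α hα => ENNReal.mul_lt_top ENNReal.coe_lt_top (hmem α hα).2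
  have hle : ∀ u ∈ Metric.closedBall (0 : RN N) 1, X.toFun (fun x => ‖dirDeriv k g u x‖ₑ) ≤ S :=
    fun u hu => X.toFun_dirDeriv_le hg (mem_closedBall_zero_iff.1 hu)
  have hbound : ∀ r, X.toFun (ballAvg k p g r) ≤ C * S := fun r =>
    hC (avgDeriv k g r) S (measurable_avgDeriv hg r)
      fun u hu => (X.toFun_avgDeriv_le hg hX r u).trans (hle u hu)
  have hCS : C * S < ∞ := ENNReal.mul_lt_top ENNReal.coe_lt_top hSfin
  refine ⟨⟨(C * S).toNNReal, fun r => by rw [ENNReal.coe_toNNReal hCS.ne]; exact hbound r⟩,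
    (hbound 0).trans_lt hCS, ?_⟩
  have h0 : ∀ u x, avgDeriv k g 0 u x = dirDeriv k g u x := by
    intro u x
    simp [avgDeriv]
  -- The modulus of continuity of translations, for all derivatives of order `k` together.
  have hω : Tendsto (fun z => ∑ α ∈ multiIndices N k, m α * X.toFun fun x => ‖g α (x + z) - g α x‖ₑ)
      (𝓝 0) (𝓝 0) := by
    have : Tendsto (fun z => ∑ α ∈ multiIndices N k, m α * X.toFun fun x => ‖g α (x + z) - g α x‖ₑ)
        (𝓝 0) (𝓝 (∑ α ∈ multiIndices N k, m α * 0)) :=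
      tendsto_finsetSum _ fun α hα => ENNReal.Tendsto.const_mul
        (X.tendsto_translate hX hac (hg α hα) (hmem α hα)) (Or.inr ENNReal.coe_ne_top)
    simpa using this
  have hmsub : ∀ r, Measurable fun q : RN N × RN N =>
      avgDeriv k g r q.1 q.2 - dirDeriv k g q.1 q.2 :=
    fun r => (measurable_avgDeriv hg r).sub (measurable_dirDeriv hg)
  -- The points `x + σ r u` are at distance at most `k r` from `x`, so that the modulus of continuity
  -- is small uniformly in `u` and `σ`.
  have hD : Tendsto (fun r => X.toFun fun x => (∫⁻ u in Metric.closedBall (0 : RN N) 1,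
      ‖avgDeriv k g r u x - dirDeriv k g u x‖ₑ ^ p ∂volume) ^ (1 / p)) (𝓝[>] 0) (𝓝 0) := by
    refine ENNReal.tendsto_nhds_zero.2 fun ε hε => ?_
    have hε' : 0 < ε / C := ENNReal.div_pos hε.ne' ENNReal.coe_ne_top
    obtain ⟨δ, hδ, hδ'⟩ := Metric.eventually_nhds_iff.1 (ENNReal.tendsto_nhds_zero.1 hω _ hε')
    have hkr : Tendsto (fun r : ℝ => (k : ℝ) * r) (𝓝[>] 0) (𝓝 0) := by
      have : Continuous fun r : ℝ => (k : ℝ) * r := by fun_prop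
      simpa using (this.tendsto 0).mono_left nhdsWithin_le_nhds
    filter_upwards [hkr.eventually (gt_mem_nhds hδ), self_mem_nhdsWithin] with r hr hr0
    have hr0' : (0 : ℝ) < r := hr0
    refine (hC (fun u x => avgDeriv k g r u x - dirDeriv k g u x) (ε / C) (hmsub r)
      fun u hu => ?_).trans ENNReal.mul_div_le
    refine X.toFun_avgDeriv_sub_le hg hX ((hle u hu).trans_lt hSfin) fun σ hσ => ?_
    have hz : dist ((σ * r) • u) 0 < δ := by
      rw [dist_zero_right, norm_smul, Real.norm_of_nonneg (mul_nonneg hσ.1 hr0'.le)]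
      have hu1 : ‖u‖ ≤ 1 := mem_closedBall_zero_iff.1 hu
      calc σ * r * ‖u‖ ≤ k * r * 1 := by
            gcongr
            exact hσ.2
        _ < δ := by rwa [mul_one]
    refine le_trans ?_ (hδ' hz)
    have hsub : ∀ x, dirDeriv k g u (x + (σ * r) • u) - dirDeriv k g u x =
        dirDeriv k (fun α x => g α (x + (σ * r) • u) - g α x) u x := by
      intro x
      simp only [dirDeriv, ← Finset.sum_sub_distrib, mul_sub]
    simp only [hsub]
    exact X.toFun_dirDeriv_le
      (fun α hα => ((hg α hα).comp (measurable_add_const _)).sub (hg α hα))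
      (mem_closedBall_zero_iff.1 hu)
  refine ENNReal.tendsto_of_forall_le_mul_add ((hbound 0).trans_lt hCS).ne hD fun κ hκ => ?_
  obtain ⟨C', hC'⟩ := exists_lintegral_rpow_le hp hκ
  have hDm : ∀ r, Measurable fun x => (∫⁻ u in Metric.closedBall (0 : RN N) 1,
      ‖avgDeriv k g r u x - dirDeriv k g u x‖ₑ ^ p ∂volume) ^ (1 / p) := fun r =>
    ((((hmsub r).comp measurable_swap).enorm.pow_const p).lintegral_prod_right'
      (ν := volume.restrict (Metric.closedBall (0 : RN N) 1))).pow_const _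
  have hsum : ∀ r s t, (∀ x, ballAvg k p g r x ≤ κ * ballAvg k p g s x +
      C' * (∫⁻ u in Metric.closedBall (0 : RN N) 1,
        ‖avgDeriv k g t u x - dirDeriv k g u x‖ₑ ^ p ∂volume) ^ (1 / p)) →
      X.toFun (ballAvg k p g r) ≤ κ * X.toFun (ballAvg k p g s) + C' * X.toFun fun x =>
        (∫⁻ u in Metric.closedBall (0 : RN N) 1,
          ‖avgDeriv k g t u x - dirDeriv k g u x‖ₑ ^ p ∂volume) ^ (1 / p) := by
    intro r s t h
    have e1 := measurable_ballAvg hg p s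
    rw [← X.const_mul _ _ e1.aemeasurable, ← X.const_mul _ _ (hDm t).aemeasurable]
    refine (X.mono _ _ (measurable_ballAvg hg p r).aemeasurable
      ((e1.const_mul _).add ((hDm t).const_mul _)).aemeasurable (ae_of_all _ h)).trans ?_
    exact X.add_le _ _ (e1.const_mul _).aemeasurable ((hDm t).const_mul _).aemeasurable
  have hsec : ∀ r x, Measurable fun u => ‖avgDeriv k g r u x‖ₑ := fun r x =>
    ((measurable_avgDeriv hg r).comp measurable_prodMk_right).enorm
  have hsec' : ∀ r x, Measurable fun u => ‖avgDeriv k g r u x - dirDeriv k g u x‖ₑ := fun r x =>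
    ((hmsub r).comp measurable_prodMk_right).enorm
  refine ⟨C', fun r => ⟨hsum r 0 r fun x => hC' _ _ _ _ (hsec 0 x) (hsec' r x) fun u => ?_,
    hsum 0 r r fun x => hC' _ _ _ _ (hsec r x) (hsec' r x) fun u => ?_⟩⟩
  · rw [h0]
    calc ‖avgDeriv k g r u x‖ₑ
        = ‖dirDeriv k g u x + (avgDeriv k g r u x - dirDeriv k g u x)‖ₑ := by rw [add_sub_cancel]
      _ ≤ _ := enorm_add_le _ _
  · rw [h0]
    calc ‖dirDeriv k g u x‖ₑ
        = ‖avgDeriv k g r u x - (avgDeriv k g r u x - dirDeriv k g u x)‖ₑ := by rw [sub_sub_cancel]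
      _ ≤ _ := enorm_sub_le

end measurability

end

/-! ### The limit formula -/

noncomputable section

variable {N : ℕ}

theorem lintegral_closedBall_eq_smul {r : ℝ} (hr : 0 < r) (F : RN N → ℝ≥0∞) :
    ∫⁻ h in Metric.closedBall (0 : RN N) r, F h ∂volume = ENNReal.ofReal (r ^ N) *
      ∫⁻ u in Metric.closedBall (0 : RN N) 1, F (r • u) ∂volume := by
  have hemb : MeasurableEmbedding fun u : RN N => r • u :=
    (Homeomorph.smulOfNeZero r hr.ne').measurableEmbedding
  have hpre : (fun u : RN N => r • u) ⁻¹' Metric.closedBall 0 r = Metric.closedBall 0 1 := by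
    ext u
    rw [mem_preimage, mem_closedBall_zero_iff, mem_closedBall_zero_iff, norm_smul,
      Real.norm_of_nonneg hr.le]
    exact mul_le_iff_le_one_right hr
  have hmap : (volume : Measure (RN N)).map (fun u => r • u) =
      ENNReal.ofReal ((r ^ N)⁻¹) • (volume : Measure (RN N)) := by
    have h := Measure.map_addHaar_smul (volume : Measure (RN N)) hr.ne'
    rwa [finrank_euclideanSpace_fin, abs_of_pos (by positivity)] at h
  have h1 : ∫⁻ u in Metric.closedBall (0 : RN N) 1, F (r • u) ∂volume =
      ENNReal.ofReal ((r ^ N)⁻¹) * ∫⁻ h in Metric.closedBall (0 : RN N) r, F h ∂volume := by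
    rw [← hpre, ← hemb.lintegral_map, ← hemb.restrict_map, hmap, Measure.restrict_smul,
      lintegral_smul_measure, smul_eq_mul]
  rw [h1, ← mul_assoc, ← ENNReal.ofReal_mul (by positivity), mul_inv_cancel₀ (by positivity),
    ENNReal.ofReal_one, one_mul]

theorem measurable_kthDiff (k : ℕ) {f : RN N → ℝ} (hf : Measurable f) :
    Measurable fun q : RN N × RN N => kthDiff k q.1 f q.2 := by
  unfold kthDiff
  refine Finset.measurable_fun_sum _ fun j _ => ?_
  have h : Measurable fun q : RN N × RN N => q.2 + (j : ℝ) • q.1 := by fun_prop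
  exact (hf.comp h).const_mul _

theorem measurable_ballDiff (k : ℕ) (p r : ℝ) {f : RN N → ℝ} (hf : Measurable f) :
    Measurable (ballDiff k p r f) := by
  have h : Measurable fun q : RN N × RN N => ‖kthDiff k q.2 f q.1‖ₑ ^ p :=
    ((measurable_kthDiff k hf).comp measurable_swap).enorm.pow_const p
  exact (h.lintegral_prod_right' (ν := volume.restrict (Metric.closedBall (0 : RN N) r))).pow_const _

theorem ballDiff_congr_ae (k : ℕ) (p r : ℝ) {f f' : RN N → ℝ} (h : f =ᵐ[volume] f') :
    ballDiff k p r f =ᵐ[volume] ballDiff k p r f' := by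
  set S : Set (RN N) := toMeasurable volume {x | f x ≠ f' x} with hS
  have hSm : MeasurableSet S := measurableSet_toMeasurable _ _
  have hS0 : ∀ᵐ x, x ∉ S := by
    rw [ae_iff]
    simpa [hS, measure_toMeasurable] using ae_iff.1 h
  have hSf : ∀ x, x ∉ S → f x = f' x := fun x hx => by
    by_contra hne
    exact hx (subset_toMeasurable _ _ hne)
  have h1 : ∀ j : ℕ, ∀ᵐ x : RN N, ∀ᵐ y : RN N, x + (j : ℝ) • y ∉ S := by
    intro j
    have hm : MeasurableSet {q : RN N × RN N | q.1 + (j : ℝ) • q.2 ∉ S} := by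
      have h2 : Measurable fun q : RN N × RN N => q.1 + (j : ℝ) • q.2 := by fun_prop
      exact h2 hSm.compl
    refine (Measure.ae_ae_comm (p := fun x y => x + (j : ℝ) • y ∉ S) hm).2
      (ae_of_all _ fun y => ?_)
    exact (measurePreserving_add_right volume ((j : ℝ) • y)).quasiMeasurePreserving.ae hS0
  filter_upwards [ae_all_iff.2 h1] with x hx
  unfold ballDiff
  congr 1
  refine lintegral_congr_ae (ae_restrict_of_ae ?_)
  filter_upwards [ae_all_iff.2 hx] with y hy
  simp only [kthDiff, hSf _ (hy _)]

/-- Rescaling the ball of radius `r` to the unit ball turns the average of differences into `ballAvg`,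
up to a power of `r`. -/
theorem ballDiff_ae_eq {k : ℕ} {p r : ℝ} (hp : 0 < p) (hr : 0 < r) {f : RN N → ℝ}
    {g : (Fin N → ℕ) → RN N → ℝ} (hf : Measurable f)
    (hg : ∀ α ∈ multiIndices N k, Measurable (g α))
    (hfg : ∀ h : RN N, ∀ᵐ x, kthDiff k h f x =
      ∫ σ, dirDeriv k g h (x + σ • h) ∂uniformSum k) :
    ballDiff k p r f =ᵐ[volume] fun x =>
      ENNReal.ofReal ((r ^ ((N : ℝ) + k * p)) ^ (1 / p)) * ballAvg k p g r x := by
  -- For every `u` the formula holds for almost every `x`; both sides are jointly measurable, so for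
  -- almost every `x` it holds for almost every `u`.
  have h1 : ∀ u : RN N, ∀ᵐ x, kthDiff k (r • u) f x = r ^ k * avgDeriv k g r u x := by
    intro u
    filter_upwards [hfg (r • u)] with x hx
    simp only [hx, avgDeriv, dirDeriv_smul, integral_const_mul, smul_smul]
  have hm : MeasurableSet {q : RN N × RN N |
      kthDiff k (r • q.1) f q.2 = r ^ k * avgDeriv k g r q.1 q.2} := by
    refine measurableSet_eq_fun ?_ ((measurable_avgDeriv hg r).const_mul _)
    have h2 : Measurable fun q : RN N × RN N => (r • q.1, q.2) := by fun_prop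
    have h3 := (measurable_kthDiff k hf).comp h2
    exact h3
  have h2 := (Measure.ae_ae_comm (μ := volume) (ν := volume) (p := fun u x => kthDiff k (r • u) f x =
    r ^ k * avgDeriv k g r u x) hm).1 (ae_of_all _ h1)
  filter_upwards [h2] with x hx
  have h3 : ∀ u, ‖r ^ k * avgDeriv k g r u x‖ₑ ^ p =
      ENNReal.ofReal (r ^ (k * p)) * ‖avgDeriv k g r u x‖ₑ ^ p := by
    intro u
    rw [enorm_mul, ENNReal.mul_rpow_of_nonneg _ _ hp.le, Real.enorm_of_nonneg (by positivity),
      ENNReal.ofReal_rpow_of_nonneg (by positivity) hp.le, ← Real.rpow_natCast, ← Real.rpow_mul hr.le]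
  have h4 : Measurable fun u => ‖avgDeriv k g r u x‖ₑ ^ p :=
    ((measurable_avgDeriv hg r).comp measurable_prodMk_right).enorm.pow_const p
  have h5 : ∫⁻ u in Metric.closedBall (0 : RN N) 1, ‖kthDiff k (r • u) f x‖ₑ ^ p ∂volume =
      ENNReal.ofReal (r ^ (k * p)) *
        ∫⁻ u in Metric.closedBall (0 : RN N) 1, ‖avgDeriv k g r u x‖ₑ ^ p ∂volume := by
    rw [← lintegral_const_mul _ h4]
    refine lintegral_congr_ae (ae_restrict_of_ae ?_)
    filter_upwards [hx] with u hu
    rw [hu, h3]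
  rw [ballDiff, lintegral_closedBall_eq_smul hr, h5, ← mul_assoc, ← ENNReal.ofReal_mul (by positivity),
    ← Real.rpow_natCast, ← Real.rpow_add hr, ENNReal.mul_rpow_of_nonneg _ _ (by positivity),
    ENNReal.ofReal_rpow_of_nonneg (by positivity) (by positivity), ballAvg]

theorem IsGivenBy.congr_ae {T : 𝓓'((⊤ : TopologicalSpace.Opens (RN N)), ℝ)} {f f' : RN N → ℝ}
    (h : IsGivenBy T f) (hff' : f =ᵐ[volume] f') : IsGivenBy T f' := by
  refine ⟨h.1.congr hff', fun φ => (h.2 φ).trans (integral_congr_ae ?_)⟩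
  filter_upwards [hff'] with x hx
  rw [hx]

theorem dirDeriv_congr {k : ℕ} {g g' : (Fin N → ℕ) → RN N → ℝ} {x : RN N}
    (h : ∀ α ∈ multiIndices N k, g α x = g' α x) (u : RN N) :
    dirDeriv k g u x = dirDeriv k g' u x :=
  Finset.sum_congr rfl fun α hα => by rw [h α hα]

theorem mainTheorem10 (N k : ℕ) (hN : 1 ≤ N) (hk : 1 ≤ k) (p : ℝ) (hp : 0 < p) :
    ∃ c C : ℝ≥0, 0 < c ∧
      ∀ X : BanachFunctionNorm N, X.IsRearrangementInvariant → X.HasAbsolutelyContinuousNorm →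
        X.SatisfiesMinkowski p →
      ∀ ρ : ℝ → ℝ → ℝ, IsConcentrating ρ →
      ∀ T : 𝓓'((⊤ : TopologicalSpace.Opens (RN N)), ℝ), MemHomSobolev X k T →
        (∃ f : RN N → ℝ, IsGivenBy T f) ∧
        ∀ (f : RN N → ℝ) (g : (Fin N → ℕ) → RN N → ℝ), IsGivenBy T f →
          (∀ α ∈ multiIndices N k, IsGivenBy (distDeriv α T) (g α)) →
          ∃ L : ℝ≥0,
            Tendsto (fun ε => diffFunctional X k p (ρ ε) f) (𝓝[>] 0) (𝓝 (L : ℝ≥0∞)) ∧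
            (L : ℝ≥0∞) =
              ENNReal.ofReal (1 / ((k : ℝ) * p + (N : ℝ))) * X.toFun (sphereDeriv k p g) ^ p ∧
            (c : ℝ≥0∞) * X.toFun (gradLength k g) ^ p ≤ (L : ℝ≥0∞) ∧
            (L : ℝ≥0∞) ≤ (C : ℝ≥0∞) * X.toFun (gradLength k g) ^ p := by
  obtain ⟨c, C, hc, hcC⟩ := exists_sphereDeriv_equiv_gradLength hN k hp
  set d : ℝ≥0 := (1 / ((k : ℝ) * p + (N : ℝ))).toNNReal with hd
  have hd0 : 0 < d := by
    rw [hd, Real.toNNReal_pos]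
    positivity
  have hscale : ∀ (b : ℝ≥0) (y : ℝ≥0∞), ((d * b ^ p : ℝ≥0) : ℝ≥0∞) * y ^ p =
      (d : ℝ≥0∞) * ((b : ℝ≥0∞) * y) ^ p := by
    intro b y
    rw [ENNReal.mul_rpow_of_nonneg _ _ hp.le, ← ENNReal.coe_rpow_of_nonneg _ hp.le,
      ENNReal.coe_mul, mul_assoc]
  refine ⟨d * c ^ p, d * C ^ p, mul_pos hd0 (NNReal.rpow_pos hc), ?_⟩
  intro X hri hac hmin ρ hρ T hT
  refine ⟨?_, fun f₀ g₀ hf₀ hg₀ => ?_⟩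
  · choose! g hg hg' using hT
    exact exists_isGivenBy hg'
  -- Pass to measurable representatives of the function and of its derivatives.
  obtain ⟨f, hf, hff⟩ := hf₀.1.aestronglyMeasurable.aemeasurable
  have hrep : ∀ α ∈ multiIndices N k, ∃ g', Measurable g' ∧ g₀ α =ᵐ[volume] g' := fun α hα =>
    (hg₀ α hα).1.aestronglyMeasurable.aemeasurable
  choose! g hg hgg using hrep
  have hTf : IsGivenBy T f := hf₀.congr_ae hff
  have hTg : ∀ α ∈ multiIndices N k, IsGivenBy (distDeriv α T) (g α) := fun α hα =>
    (hg₀ α hα).congr_ae (hgg α hα)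
  have hmem : ∀ α ∈ multiIndices N k, X.Mem (g α) := by
    intro α hα
    obtain ⟨g₁, hg₁, hTg₁⟩ := hT α hα
    have h1 : g₁ =ᵐ[volume] g α := Represents.ae_eq hTg₁ (hTg α hα)
    refine ⟨(hg α hα).aemeasurable, lt_of_eq_of_lt ?_ hg₁.2⟩
    refine X.congr_ae (hg α hα).enorm.aemeasurable ?_
    filter_upwards [h1] with x hx
    rw [hx]
  have hall : ∀ᵐ x, ∀ α ∈ multiIndices N k, g₀ α x = g α x :=
    (Finset.eventually_all _).2 hgg
  obtain ⟨⟨M, hM⟩, hfin, hlim⟩ := X.tendsto_toFun_ballAvg hg hri hac hp hmin hmem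
  have hd1 : d ^ (1 / p) ≠ 0 := (NNReal.rpow_pos hd0).ne'
  have h0 : ∀ x, ballAvg k p g 0 x = ((d ^ (1 / p) : ℝ≥0) : ℝ≥0∞) * sphereDeriv k p g x := by
    intro x
    have h : _ = (d : ℝ≥0∞) ^ (1 / p) * sphereDeriv k p g x :=
      lintegral_closedBall_dirDeriv hN k hp g x
    rw [ENNReal.coe_rpow_of_nonneg _ (by positivity), ← h, ballAvg]
    simp [avgDeriv]
  have hsm : Measurable (sphereDeriv k p g) := by
    have h : sphereDeriv k p g = fun x => ((d ^ (1 / p) : ℝ≥0)⁻¹ : ℝ≥0) * ballAvg k p g 0 x := by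
      funext x
      rw [h0, ← mul_assoc, ← ENNReal.coe_mul, inv_mul_cancel₀ hd1, ENNReal.coe_one, one_mul]
    rw [h]
    exact (measurable_ballAvg hg p 0).const_mul _
  have hgm : Measurable (gradLength k g) := by
    unfold gradLength
    refine (Real.continuous_sqrt.measurable.comp ?_).ennreal_ofReal
    exact Finset.measurable_fun_sum _ fun α hα => (hg α hα).pow_const 2
  have hs : X.toFun (sphereDeriv k p g₀) = X.toFun (sphereDeriv k p g) := by
    refine (X.congr_ae hsm.aemeasurable ?_).symm
    filter_upwards [hall] with x hx
    simp only [sphereDeriv, dirDeriv_congr hx]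
  have hgr : X.toFun (gradLength k g₀) = X.toFun (gradLength k g) := by
    refine (X.congr_ae hgm.aemeasurable ?_).symm
    filter_upwards [hall] with x hx
    have h : ∑ α ∈ multiIndices N k, g α x ^ 2 = ∑ α ∈ multiIndices N k, g₀ α x ^ 2 :=
      Finset.sum_congr rfl fun α hα => by rw [hx α hα]
    rw [gradLength, gradLength, h]
  have hval : X.toFun (ballAvg k p g 0) ^ p = d * X.toFun (sphereDeriv k p g) ^ p := by
    have h : ballAvg k p g 0 = fun x => ((d ^ (1 / p) : ℝ≥0) : ℝ≥0∞) * sphereDeriv k p g x :=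
      funext h0
    rw [h, X.const_mul _ _ hsm.aemeasurable, ENNReal.mul_rpow_of_nonneg _ _ hp.le,
      ENNReal.coe_rpow_of_nonneg _ (by positivity), ← ENNReal.rpow_mul,
      one_div_mul_cancel hp.ne', ENNReal.rpow_one]
  have hvfin : X.toFun (ballAvg k p g 0) ^ p ≠ ∞ := ENNReal.rpow_ne_top_of_nonneg hp.le hfin.ne
  have hk0 : (k : ℝ) ≠ 0 := by
    exact_mod_cast (Nat.one_le_iff_ne_zero.1 hk)
  -- With `r = t ^ (1 / k)` the scaling factor of the ball average cancels the power of `t`.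
  have hint : ∀ t, 0 < t → ENNReal.ofReal (t ^ (-((N : ℝ) / (k : ℝ)) - p)) *
      X.toFun (ballDiff k p (t ^ (1 / (k : ℝ))) f₀) ^ p =
        X.toFun (ballAvg k p g (t ^ (1 / (k : ℝ)))) ^ p := by
    intro t ht
    have hr : 0 < t ^ (1 / (k : ℝ)) := Real.rpow_pos_of_pos ht _
    have hexp : (t ^ (1 / (k : ℝ))) ^ ((N : ℝ) + k * p) = t ^ ((N : ℝ) / k + p) := by
      rw [← Real.rpow_mul ht.le]
      congr 1
      field_simp
    have hb := X.congr_ae (measurable_ballDiff k p _ hf).aemeasurable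
      (ballDiff_congr_ae k p (t ^ (1 / (k : ℝ))) hff).symm
    have hb' := X.congr_ae (measurable_ballDiff k p _ hf).aemeasurable
      (ballDiff_ae_eq hp hr hf hg (kthDiff_ae_eq_integral hTf hTg))
    have hc' : X.toFun (fun x => ENNReal.ofReal ((t ^ ((N : ℝ) / k + p)) ^ (1 / p)) *
        ballAvg k p g (t ^ (1 / (k : ℝ))) x) = ENNReal.ofReal ((t ^ ((N : ℝ) / k + p)) ^ (1 / p)) *
          X.toFun (ballAvg k p g (t ^ (1 / (k : ℝ)))) :=
      X.const_mul _ _ (measurable_ballAvg hg p _).aemeasurable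
    rw [← hb, hb', hexp, hc', ENNReal.mul_rpow_of_nonneg _ _ hp.le, ← mul_assoc]
    have hpos : 0 < t ^ ((N : ℝ) / k + p) := Real.rpow_pos_of_pos ht _
    rw [ENNReal.ofReal_rpow_of_nonneg (by positivity) hp.le, ← Real.rpow_mul hpos.le,
      one_div_mul_cancel hp.ne', Real.rpow_one, ← ENNReal.ofReal_mul (by positivity),
      ← Real.rpow_add ht]
    have hz : -((N : ℝ) / k) - p + ((N : ℝ) / k + p) = 0 := by ring
    rw [hz, Real.rpow_zero, ENNReal.ofReal_one, one_mul]
  have hroot : Tendsto (fun t : ℝ => t ^ (1 / (k : ℝ))) (𝓝[>] 0) (𝓝[>] 0) := by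
    have hk1 : (0 : ℝ) < 1 / k := by positivity
    refine tendsto_nhdsWithin_iff.2 ⟨?_, ?_⟩
    · have h := ((Real.continuous_rpow_const hk1.le).tendsto 0).mono_left
        (nhdsWithin_le_nhds (s := Ioi (0 : ℝ)))
      rwa [Real.zero_rpow hk1.ne'] at h
    · filter_upwards [self_mem_nhdsWithin] with t ht
      exact Real.rpow_pos_of_pos ht _
  have hφ : Tendsto (fun t => X.toFun (ballAvg k p g (t ^ (1 / (k : ℝ)))) ^ p) (𝓝[>] 0)
      (𝓝 (X.toFun (ballAvg k p g 0) ^ p)) :=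
    (ENNReal.continuous_rpow_const.tendsto _).comp (hlim.comp hroot)
  have hmain := hρ.tendsto_lintegral (M := (M : ℝ≥0∞) ^ p)
    (ENNReal.rpow_ne_top_of_nonneg hp.le ENNReal.coe_ne_top)
    (fun t _ => ENNReal.rpow_le_rpow (hM _) hp.le) hφ
  refine ⟨(X.toFun (ballAvg k p g 0) ^ p).toNNReal, ?_⟩
  rw [ENNReal.coe_toNNReal hvfin, hval, hs, hgr]
  refine ⟨?_, rfl, ?_, ?_⟩
  · rw [← hval]
    refine hmain.congr fun ε => setLIntegral_congr_fun measurableSet_Ioi fun t ht => ?_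
    rw [← hint t ht]
  · rw [hscale, ← X.const_mul _ _ hgm.aemeasurable]
    gcongr
    exact X.mono _ _ (hgm.const_mul _).aemeasurable hsm.aemeasurable (ae_of_all _ fun x => (hcC g x).1)
  · rw [hscale, ← X.const_mul _ _ hgm.aemeasurable]
    gcongr
    exact X.mono _ _ hsm.aemeasurable (hgm.const_mul _).aemeasurable (ae_of_all _ fun x => (hcC g x).2)

end
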